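/- Fix $T>0$, $d\in\mathbb N$ and a nonempty metric space $U$. **Paths.** For $t\in[0,T]$ let $\hat\Lambda_t$ (resp. $\Lambda_t$) be the set of càdlàg (resp. continuous) functions $\gamma_t:[0,t]\to\mathbb R^d$, $\hat\Lambda^t=\bigcup_{s\in[t,T]}\hat\Lambda_s$, $\Lambda^t=\bigcup_{s\in[t,T]}\Lambda_s$, $\hat\Lambda=\hat\Lambda^0$, $\Lambda=\Lambda^0$. Put $\|\gamma_t\|_0=\sup_{0\le s\le t}|\gamma_t(s)|$ and $$d_\infty(\gamma_t,\eta_s)=|t-s|+\sup_{0\le r\le T}|\gamma_t(r\wedge t)-\eta_s(r\wedge s)|.$$ For $t\le \bar t\le T$ let $\gamma_{t,\bar t}\in\hat\Lambda_{\bar t}$ be the extension of $\gamma_t$ by the constant $\gamma_t(t)$ on $(t,\bar t]$; for $x\in\mathbb R^d$ let $\gamma_t^x\in\hat\Lambda_t$ equal $\gamma_t$ on $[0,t)$ and $\gamma_t(t)+x$ at $t$. For $\mu,M_0>0$ let $\mathcal C^\mu_{t,M_0}$ be the set of all $\gamma_s\in\Lambda^t$ with $\|\gamma_s\|_0\le M_0$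 and $|\gamma_s(l)-\gamma_s(r)|\le\mu(1+M_0)|l-r|$ for all $l,r\in[0,s]$. **Test functionals.** For $t<T$, $f\in C^1(\hat\Lambda^t)$ means that $f:\hat\Lambda^t\to\mathbb R$ is $d_\infty$-continuous and has on $\hat\Lambda^t$ the $d_\infty$-continuous derivatives $\partial_tf(\gamma_s)=\lim_{h\downarrow0}\frac1h[f(\gamma_{s,s+h})-f(\gamma_s)]$ for $s<T$, $\partial_tf(\gamma_T)=\lim_{s\uparrow T}\partial_tf(\gamma_T|_{[0,s]})$, and $\partial_{x}f=(\partial_{x_1}f,\dots,\partial_{x_d}f)$ with $\partial_{x_i}f(\gamma_s)=\lim_{h\to0}\frac1h[f(\gamma_s^{he_i})-f(\gamma_s)]$. A functional on $\Lambda^t$ is in $C^1(\Lambda^t)$ if it is the restriction of some $f\in C^1(\hat\Lambda^t)$; its derivatives are those of $f$. **Hypothesis.** $F:\Lambda\times U\to\mathbb R^d$, $q:\Lambda\times U\to\mathbb R$ and $\phi:\Lambda_T\to\mathbb R$ are continuous; $F$ and $q$ are moreover continuous in the path variable uniformly in the control, i.e. for every $\gamma_t\in\Lambda$, $\sup_{u\in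 U}\big(|F(\eta_s,u)-F(\gamma_t,u)|+|q(\eta_s,u)-q(\gamma_t,u)|\big)\to0$ as $d_\infty(\eta_s,\gamma_t)\to0$; and for some $L>0$ and all $t\in[0,T]$, $\gamma_t,\gamma_t'\in\Lambda_t$, $u\in U$, $\eta_T,\eta_T'\in\Lambda_T$, $$|F(\gamma_t,u)-F(\gamma_t',u)|\vee|q(\gamma_t,u)-q(\gamma_t',u)|\le L\|\gamma_t-\gamma_t'\|_0,\qquad |F(\gamma_t,u)|\vee|q(\gamma_t,u)|\le L(1+\|\gamma_t\|_0),$$ $$|\phi(\eta_T)-\phi(\eta_T')|\le L\|\eta_T-\eta_T'\|_0,\qquad |\phi(\eta_T)|\le L(1+\|\eta_T\|_0).$$ **Control problem.** For $\gamma_t\in\Lambda$ and a measurable $u:[t,T]\to U$ let $X=X^{\gamma_t,u}$ be the continuous function on $[0,T]$ with $X=\gamma_t$ on $[0,t]$ and $X(s)=\gamma_t(t)+\int_t^sF(X_\sigma,u(\sigma))\,d\sigma$ for $s\in[t,T]$, where $X_\sigma=X|_{[0,\sigma]}$, and let $$V(\gamma_t)=\inf_{u}\Big[\int_t^Tq(X^{\gamma_t,u}_\sigma,u(\sigma))\,d\sigma+\phi(X^{\gamma_t,u}_T)\Big],\qquad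 \mathbf H(\gamma_t,p)=\inf_{u\in U}\big[(p,F(\gamma_t,u))+q(\gamma_t,u)\big].$$ **Viscosity solutions.** Consider the equation $$\partial_tV(\gamma_t)+\mathbf H(\gamma_t,\partial_xV(\gamma_t))=0\ \ (t<T),\qquad V(\gamma_T)=\phi(\gamma_T).\tag{1}$$ Let $w:\Lambda\to\mathbb R$ be $d_\infty$-continuous. It is a viscosity $\mu$-subsolution of (1) if $w\le\phi$ on $\Lambda_T$ and, for all $M_0>0$, all $s<T$, all $\gamma_s\in\mathcal C^\mu_{0,M_0}$ with $|\gamma_s(s)|<M_0$ and all $\varphi\in C^1(\Lambda^s)$ with $0=(w-\varphi)(\gamma_s)=\sup_{\mathcal C^\mu_{s,M_0}}(w-\varphi)$, one has $\partial_t\varphi(\gamma_s)+\mathbf H(\gamma_s,\partial_x\varphi(\gamma_s))\ge0$. It is a viscosity $\mu$-supersolution if $w\ge\phi$ on $\Lambda_T$ and, for the same $M_0,\gamma_s$ and all $\varphi\in C^1(\Lambda^s)$ with $0=(w+\varphi)(\gamma_s)=\inf_{\mathcal C^\mu_{s,M_0}}(w+\varphi)$, one has $-\partial_t\varphi(\gamma_s)+\mathbf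 H(\gamma_s,-\partial_x\varphi(\gamma_s))\le0$. It is a viscosity solution if for some $\mu_0>0$ it is a $\mu$-subsolution for all $\mu\ge\mu_0$, and for some $\mu_0'>0$ a $\mu$-supersolution for all $\mu\ge\mu_0'$. **Theorem.** Under the hypothesis, $X^{\gamma_t,u}$ exists and is unique for all $\gamma_t$ and $u$, the infimum defining $V$ is finite, and $V$ is a viscosity solution of (1) that belongs to the class of functionals $w:\Lambda\to\mathbb R$ for which there is a constant $L'>0$ with $$|w(\gamma_t)|\le L'(1+\|\gamma_t\|_0),\qquad |w(\gamma_t)-w(\eta_s)|\le L'(1+\|\gamma_t\|_0\vee\|\eta_s\|_0)\,d_\infty(\gamma_t,\eta_s)$$ for all $\gamma_t,\eta_s\in\Lambda$. Every viscosity solution of (1) in this class equals $V$. -/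

import Mathlib

open Set Filter Topology MeasureTheory

noncomputable section

namespace PHJB

/-- A càdlàg path `γ_t` with values in `ℝ^d`, with final time `t ∈ [0,T]`. The path is a function on
`[0,t]`; it is stored as the function on `ℝ` that is constant on `(-∞,0]` and on `[t,∞)`, so that
two paths are equal exactly if they have the same final time `t` and agree on `[0,t]`. -/
structure CadlagPath (T : ℝ) (d : ℕ) where
  /-- the final time -/
  time : ℝ
  time_mem : time ∈ Icc 0 T
  toFun : ℝ → EuclideanSpace ℝ (Fin d)
  frozen : ∀ s, toFun s = toFun (max 0 (min s time))
  right_cont : ∀ s, ContinuousWithinAt toFun (Ici s) s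
  left_lim : ∀ s, ∃ l, Tendsto toFun (𝓝[<] s) (𝓝 l)

namespace CadlagPath

variable {T : ℝ} {d : ℕ}

instance : CoeFun (CadlagPath T d) (fun _ => ℝ → EuclideanSpace ℝ (Fin d)) := ⟨CadlagPath.toFun⟩

theorem ext' {γ η : CadlagPath T d} (h : γ.time = η.time) (h' : γ.toFun = η.toFun) : γ = η := by
  cases γ; cases η; simp_all

/-- Càdlàg paths are bounded. -/
theorem exists_bound (γ : CadlagPath T d) : ∃ C, ∀ s, ‖γ s‖ ≤ C := by
  have hK : ∃ C, ∀ s ∈ Icc (0 : ℝ) γ.time, ‖γ s‖ ≤ C := by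
    refine isCompact_Icc.induction_on (p := fun S => ∃ C, ∀ s ∈ S, ‖γ s‖ ≤ C) ⟨0, by simp⟩ ?_ ?_ ?_
    · rintro S S' hS ⟨C, hC⟩
      exact ⟨C, fun s hs => hC s (hS hs)⟩
    · rintro S S' ⟨C, hC⟩ ⟨C', hC'⟩
      refine ⟨max C C', ?_⟩
      rintro s (hs | hs)
      · exact (hC s hs).trans (le_max_left _ _)
      · exact (hC' s hs).trans (le_max_right _ _)
    · intro x _
      obtain ⟨l, hl⟩ := γ.left_lim x
      have h1 : ∀ᶠ s in 𝓝[<] x, ‖γ s‖ ≤ ‖l‖ + 1 :=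
        (hl.norm.eventually (gt_mem_nhds (lt_add_one ‖l‖))).mono fun _ h => h.le
      have h2 : ∀ᶠ s in 𝓝[≥] x, ‖γ s‖ ≤ ‖γ x‖ + 1 :=
        ((γ.right_cont x).norm.eventually (gt_mem_nhds (lt_add_one ‖γ x‖))).mono
          fun _ h => h.le
      have h3 : ∀ᶠ s in 𝓝 x, ‖γ s‖ ≤ max (‖l‖ + 1) (‖γ x‖ + 1) := by
        rw [← nhdsLT_sup_nhdsGE, eventually_sup]
        exact ⟨h1.mono fun _ h => h.trans (le_max_left _ _),
          h2.mono fun _ h => h.trans (le_max_right _ _)⟩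
      exact ⟨_, mem_nhdsWithin_of_mem_nhds h3, _, fun s hs => hs⟩
  obtain ⟨C, hC⟩ := hK
  refine ⟨C, fun s => ?_⟩
  rw [γ.frozen s]
  exact hC _ ⟨le_max_left _ _, max_le γ.time_mem.1 (min_le_right _ _)⟩

/-- The norm `‖γ_t‖₀ = sup_{0 ≤ s ≤ t} |γ_t(s)|`. -/
def supNorm (γ : CadlagPath T d) : ℝ := ⨆ s : ℝ, ‖γ s‖

/-- `sup_{0 ≤ s ≤ T} |γ_t(s ∧ t) - η_r(s ∧ r)|`; if `t = r`, this is `‖γ_t - η_t‖₀`. -/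
def supDist (γ η : CadlagPath T d) : ℝ := ⨆ s : ℝ, ‖γ s - η s‖

theorem bddAbove_sub (γ η : CadlagPath T d) : BddAbove (range fun s : ℝ => ‖γ s - η s‖) := by
  obtain ⟨C, hC⟩ := γ.exists_bound
  obtain ⟨C', hC'⟩ := η.exists_bound
  refine ⟨C + C', ?_⟩
  rintro _ ⟨s, rfl⟩
  exact (norm_sub_le _ _).trans (add_le_add (hC s) (hC' s))

theorem le_supDist (γ η : CadlagPath T d) (s : ℝ) : ‖γ s - η s‖ ≤ supDist γ η :=
  le_ciSup (bddAbove_sub γ η) s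

/-- The metric `d_∞(γ_t, η_r) = |t - r| + sup_s |γ_t(s ∧ t) - η_r(s ∧ r)|`. -/
instance : MetricSpace (CadlagPath T d) where
  dist γ η := |γ.time - η.time| + supDist γ η
  dist_self γ := by simp [supDist]
  dist_comm γ η := by simp [supDist, abs_sub_comm, norm_sub_rev]
  dist_triangle γ η ζ := by
    have h1 : |γ.time - ζ.time| ≤ |γ.time - η.time| + |η.time - ζ.time| := abs_sub_le _ _ _
    have h2 : supDist γ ζ ≤ supDist γ η + supDist η ζ :=
      ciSup_le fun s => (norm_sub_le_norm_sub_add_norm_sub _ (η s) _).trans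
        (add_le_add (le_supDist γ η s) (le_supDist η ζ s))
    linarith
  eq_of_dist_eq_zero := by
    intro γ η h
    have h : |γ.time - η.time| + supDist γ η = 0 := h
    have h0 : 0 ≤ supDist γ η := (norm_nonneg _).trans (le_supDist γ η 0)
    have h1 := abs_nonneg (γ.time - η.time)
    refine ext' (sub_eq_zero.1 (abs_eq_zero.1 (by linarith))) (funext fun s => ?_)
    have h2 := le_supDist γ η s
    exact sub_eq_zero.1 (norm_le_zero_iff.1 (by linarith))

theorem dist_def (γ η : CadlagPath T d) : dist γ η = |γ.time - η.time| + supDist γ η := rfl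

/-- The restriction `γ_t|_[0,s]`, for `0 ≤ s ≤ t` (other values of `s` are clamped to `[0,t]`). -/
def restrict (γ : CadlagPath T d) (s : ℝ) : CadlagPath T d where
  time := max 0 (min s γ.time)
  time_mem := ⟨le_max_left _ _,
    max_le (γ.time_mem.1.trans γ.time_mem.2) ((min_le_right _ _).trans γ.time_mem.2)⟩
  toFun r := γ (min r (max 0 (min s γ.time)))
  frozen r := by
    rw [γ.frozen, γ.frozen (min (max 0 _) _)]
    congr 1
    have := γ.time_mem.1
    grind
  right_cont r := by
    rcases lt_or_ge r (max 0 (min s γ.time)) with h | h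
    · refine (γ.right_cont r).congr_of_eventuallyEq ?_ (by rw [min_eq_left h.le])
      filter_upwards [mem_nhdsWithin_of_mem_nhds (Iio_mem_nhds h)] with x hx
      rw [min_eq_left (le_of_lt hx)]
    · refine (continuousWithinAt_const (b := γ (max 0 (min s γ.time)))).congr
        (fun x hx => ?_) ?_
      · exact congrArg γ.toFun (min_eq_right (h.trans hx))
      · exact congrArg γ.toFun (min_eq_right h)
  left_lim r := by
    rcases le_or_gt r (max 0 (min s γ.time)) with h | h
    · obtain ⟨l, hl⟩ := γ.left_lim r
      refine ⟨l, hl.congr' ?_⟩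
      filter_upwards [self_mem_nhdsWithin] with x hx
      rw [min_eq_left ((le_of_lt hx).trans h)]
    · refine ⟨γ (max 0 (min s γ.time)), tendsto_const_nhds.congr' ?_⟩
      filter_upwards [mem_nhdsWithin_of_mem_nhds (Ioi_mem_nhds h)] with x hx
      rw [min_eq_right (le_of_lt (mem_Ioi.1 hx))]

/-- The path `γ_{t,s}` on `[0,s]`, for `t ≤ s ≤ T`: it is `γ_t` on `[0,t]` and `γ_t(t)` on `(t,s]`
(other values of `s` are clamped to `[t,T]`). -/
def extend (γ : CadlagPath T d) (s : ℝ) : CadlagPath T d where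
  time := max γ.time (min s T)
  time_mem := ⟨γ.time_mem.1.trans (le_max_left _ _), max_le γ.time_mem.2 (min_le_right _ _)⟩
  toFun := γ.toFun
  frozen r := by
    rw [γ.frozen r, γ.frozen (max 0 (min r (max γ.time (min s T))))]
    congr 1
    have := γ.time_mem.1
    grind
  right_cont := γ.right_cont
  left_lim := γ.left_lim

/-- The path `γ_t^x` on `[0,t]`: it is `γ_t` on `[0,t)` and its value at `t` is `γ_t(t) + x`. -/
def bump (γ : CadlagPath T d) (x : EuclideanSpace ℝ (Fin d)) : CadlagPath T d where
  time := γ.time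
  time_mem := γ.time_mem
  toFun s := if max 0 s < γ.time then γ s else γ s + x
  frozen s := by
    have h : (max 0 (max 0 (min s γ.time)) < γ.time) ↔ max 0 s < γ.time := by
      have := γ.time_mem.1
      grind
    simp only [h, ← γ.frozen s]
  right_cont s := by
    by_cases h : max 0 s < γ.time
    · refine (γ.right_cont s).congr_of_eventuallyEq ?_ (by rw [if_pos h])
      have h' : ∀ᶠ x in 𝓝 s, max 0 x < γ.time :=
        (continuous_const.max continuous_id).continuousAt.eventually (Iio_mem_nhds h)
      filter_upwards [mem_nhdsWithin_of_mem_nhds h'] with x hx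
      rw [if_pos hx]
    · refine ((γ.right_cont s).add (continuousWithinAt_const (b := x))).congr (fun y hy => ?_) ?_
      · have : ¬ max 0 y < γ.time := fun hlt =>
          h ((max_le_max le_rfl (show s ≤ y from hy)).trans_lt hlt)
        exact if_neg this
      · exact if_neg h
  left_lim s := by
    obtain ⟨l, hl⟩ := γ.left_lim s
    by_cases h : ∀ y < s, max 0 y < γ.time
    · refine ⟨l, hl.congr' ?_⟩
      filter_upwards [self_mem_nhdsWithin] with y hy
      rw [if_pos (h y hy)]
    · push Not at h
      obtain ⟨y, hy, hy'⟩ := h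
      refine ⟨l + x, (hl.add_const x).congr' ?_⟩
      filter_upwards [mem_nhdsWithin_of_mem_nhds (Ioi_mem_nhds hy)] with z hz
      rw [if_neg (not_lt.2 (hy'.trans (max_le_max le_rfl (le_of_lt hz))))]

end CadlagPath

/-- The space `Λ` of continuous paths `γ_t`, `t ∈ [0,T]`, with the metric `d_∞`. -/
abbrev ContPath (T : ℝ) (d : ℕ) := {γ : CadlagPath T d // Continuous γ.toFun}

/-- The space `Λ_T` of continuous paths with final time `T`. -/
abbrev TerminalPath (T : ℝ) (d : ℕ) := {γ : ContPath T d // γ.1.time = T}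

/-- The restriction `γ_t|_[0,s]` of a continuous path. -/
def ContPath.restrict {T : ℝ} {d : ℕ} (γ : ContPath T d) (s : ℝ) : ContPath T d :=
  ⟨γ.1.restrict s, γ.2.comp (continuous_id.min continuous_const)⟩

/-- The set `C^μ_{t,M₀}` of continuous paths with final time at least `t` that are bounded by `M₀`
and Lipschitz with constant `μ (1 + M₀)`. -/
def lipPaths (T : ℝ) (d : ℕ) (μ t M₀ : ℝ) : Set (ContPath T d) :=
  {γ | t ≤ γ.1.time ∧ γ.1.supNorm ≤ M₀ ∧
    ∀ l r, 0 ≤ l → l < r → r ≤ γ.1.time → ‖γ.1 l - γ.1 r‖ ≤ μ * (1 + M₀) * |l - r|}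

/-- Functionals of class `C¹` on the set of càdlàg paths with final time in `[t,T]`, with their
horizontal derivative `dt` and vertical derivative `dx`. The values at paths with final time
smaller than `t` play no role. -/
structure C1Functional (T : ℝ) (d : ℕ) (t : ℝ) where
  toFun : CadlagPath T d → ℝ
  dt : CadlagPath T d → ℝ
  dx : CadlagPath T d → EuclideanSpace ℝ (Fin d)
  continuousOn_toFun : ContinuousOn toFun {γ | t ≤ γ.time}
  horizontal : ∀ γ, t ≤ γ.time → γ.time < T →
    Tendsto (fun h : ℝ => (1 / h) * (toFun (γ.extend (γ.time + h)) - toFun γ)) (𝓝[>] 0) (𝓝 (dt γ))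
  horizontal_final : ∀ γ, γ.time = T → Tendsto (fun s : ℝ => dt (γ.restrict s)) (𝓝[<] T) (𝓝 (dt γ))
  vertical : ∀ γ, t ≤ γ.time → ∀ i, Tendsto
    (fun h : ℝ => (1 / h) * (toFun (γ.bump (h • EuclideanSpace.single i (1 : ℝ))) - toFun γ))
    (𝓝[≠] 0) (𝓝 (dx γ i))
  continuousOn_dt : ContinuousOn dt {γ | t ≤ γ.time}
  continuousOn_dx : ContinuousOn dx {γ | t ≤ γ.time}

section Control

variable {T : ℝ} {d : ℕ} {U : Type*}

/-- The standing assumptions on the coefficients: continuity (in the path variable, uniformly in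
the control), Lipschitz continuity in the path under the supremum norm, and linear growth. -/
structure StandingHypothesis [TopologicalSpace U] (F : ContPath T d → U → EuclideanSpace ℝ (Fin d))
    (q : ContPath T d → U → ℝ) (φ : TerminalPath T d → ℝ) : Prop where
  continuous_F : Continuous fun p : ContPath T d × U => F p.1 p.2
  continuous_q : Continuous fun p : ContPath T d × U => q p.1 p.2
  continuous_φ : Continuous φ
  uniform_F : ∀ γ, ∀ ε > 0, ∃ δ > 0, ∀ η, dist η γ < δ → ∀ u, ‖F η u - F γ u‖ ≤ ε
  uniform_q : ∀ γ, ∀ ε > 0, ∃ δ > 0, ∀ η, dist η γ < δ → ∀ u, |q η u - q γ u| ≤ ε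
  bounds : ∃ L > 0,
    (∀ γ η : ContPath T d, γ.1.time = η.1.time → ∀ u,
      ‖F γ u - F η u‖ ≤ L * γ.1.supDist η.1 ∧ |q γ u - q η u| ≤ L * γ.1.supDist η.1) ∧
    (∀ (γ : ContPath T d) u,
      ‖F γ u‖ ≤ L * (1 + γ.1.supNorm) ∧ |q γ u| ≤ L * (1 + γ.1.supNorm)) ∧
    (∀ γ η : TerminalPath T d, |φ γ - φ η| ≤ L * γ.1.1.supDist η.1.1) ∧
    (∀ γ : TerminalPath T d, |φ γ| ≤ L * (1 + γ.1.1.supNorm))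

/-- `X` is a solution on `[0,T]` of the controlled equation `X'(s) = F(X_s, u(s))`, `s ∈ [t,T]`,
with `X_t = γ_t`, where `X_s` is the restriction of `X` to `[0,s]`. Since `u` is only measurable,
the equation is understood in integrated form. -/
def IsTrajectory (F : ContPath T d → U → EuclideanSpace ℝ (Fin d)) (γ : ContPath T d) (u : ℝ → U)
    (X : TerminalPath T d) : Prop :=
  (∀ s ∈ Icc 0 γ.1.time, X.1.1 s = γ.1 s) ∧
  ∀ s ∈ Icc γ.1.time T,
    X.1.1 s = γ.1 γ.1.time + ∫ σ in γ.1.time..s, F (X.1.restrict σ) (u σ)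

/-- The cost `∫_t^T q(X_σ, u(σ)) dσ + φ(X_T)` of a control `u` and a path `X`. -/
def cost (q : ContPath T d → U → ℝ) (φ : TerminalPath T d → ℝ) (t : ℝ) (u : ℝ → U)
    (X : TerminalPath T d) : ℝ :=
  (∫ σ in t..T, q (X.1.restrict σ) (u σ)) + φ X

/-- All values of the cost functional `J(γ_t, u)`, for measurable controls `u`. Controls on `[t,T]`
are written as functions on `ℝ`; only their values on `[t,T]` matter. -/
def costs [MeasurableSpace U] (F : ContPath T d → U → EuclideanSpace ℝ (Fin d))
    (q : ContPath T d → U → ℝ) (φ : TerminalPath T d → ℝ) (γ : ContPath T d) : Set ℝ :=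
  {c | ∃ u : ℝ → U, Measurable u ∧ ∃ X, IsTrajectory F γ u X ∧ c = cost q φ γ.1.time u X}

/-- The value functional `V(γ_t) = inf_u J(γ_t, u)`. -/
def valueFunctional [MeasurableSpace U] (F : ContPath T d → U → EuclideanSpace ℝ (Fin d))
    (q : ContPath T d → U → ℝ) (φ : TerminalPath T d → ℝ) (γ : ContPath T d) : ℝ :=
  sInf (costs F q φ γ)

/-- The Hamiltonian `H(γ_t, p) = inf_u [(p, F(γ_t, u)) + q(γ_t, u)]`. -/
def hamiltonian (F : ContPath T d → U → EuclideanSpace ℝ (Fin d)) (q : ContPath T d → U → ℝ)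
    (γ : ContPath T d) (p : EuclideanSpace ℝ (Fin d)) : ℝ :=
  ⨅ u : U, (inner ℝ p (F γ u) + q γ u)

/-- The test functionals `J⁺_{μ,M₀}(γ_t, w)`: `0 = (w - f)(γ_t) = sup (w - f)`, the supremum being
over `C^μ_{t,M₀}`. -/
def testAbove (μ M₀ : ℝ) (γ : ContPath T d) (w : ContPath T d → ℝ) :
    Set (C1Functional T d γ.1.time) :=
  {f | w γ - f.toFun γ.1 = 0 ∧
    IsLUB ((fun η : ContPath T d => w η - f.toFun η.1) '' lipPaths T d μ γ.1.time M₀) 0}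

/-- The test functionals `J⁻_{μ,M₀}(γ_t, w)`: `0 = (w + f)(γ_t) = inf (w + f)`, the infimum being
over `C^μ_{t,M₀}`. -/
def testBelow (μ M₀ : ℝ) (γ : ContPath T d) (w : ContPath T d → ℝ) :
    Set (C1Functional T d γ.1.time) :=
  {f | w γ + f.toFun γ.1 = 0 ∧
    IsGLB ((fun η : ContPath T d => w η + f.toFun η.1) '' lipPaths T d μ γ.1.time M₀) 0}

/-- Viscosity `μ`-subsolutions of `∂_t V + H(γ_t, ∂_x V) = 0`, `V(γ_T) = φ(γ_T)`. -/
def IsMuSubsolution (F : ContPath T d → U → EuclideanSpace ℝ (Fin d)) (q : ContPath T d → U → ℝ)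
    (φ : TerminalPath T d → ℝ) (μ : ℝ) (w : ContPath T d → ℝ) : Prop :=
  (∀ γ : TerminalPath T d, w γ.1 ≤ φ γ) ∧
  ∀ M₀ > 0, ∀ γ ∈ lipPaths T d μ 0 M₀, γ.1.time < T → ‖γ.1 γ.1.time‖ < M₀ →
    ∀ f ∈ testAbove μ M₀ γ w, 0 ≤ f.dt γ.1 + hamiltonian F q γ (f.dx γ.1)

/-- Viscosity `μ`-supersolutions of `∂_t V + H(γ_t, ∂_x V) = 0`, `V(γ_T) = φ(γ_T)`. -/
def IsMuSupersolution (F : ContPath T d → U → EuclideanSpace ℝ (Fin d)) (q : ContPath T d → U → ℝ)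
    (φ : TerminalPath T d → ℝ) (μ : ℝ) (w : ContPath T d → ℝ) : Prop :=
  (∀ γ : TerminalPath T d, φ γ ≤ w γ.1) ∧
  ∀ M₀ > 0, ∀ γ ∈ lipPaths T d μ 0 M₀, γ.1.time < T → ‖γ.1 γ.1.time‖ < M₀ →
    ∀ f ∈ testBelow μ M₀ γ w, -f.dt γ.1 + hamiltonian F q γ (-f.dx γ.1) ≤ 0

/-- Viscosity solutions: continuous functionals that are `μ`-subsolutions for all large `μ` and
`μ`-supersolutions for all large `μ`. -/
structure IsViscositySolution (F : ContPath T d → U → EuclideanSpace ℝ (Fin d))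
    (q : ContPath T d → U → ℝ) (φ : TerminalPath T d → ℝ) (w : ContPath T d → ℝ) : Prop where
  continuous : Continuous w
  subsolution : ∃ μ₀ > 0, ∀ μ ≥ μ₀, IsMuSubsolution F q φ μ w
  supersolution : ∃ μ₀ > 0, ∀ μ ≥ μ₀, IsMuSupersolution F q φ μ w

/-- Functionals of linear growth that are locally Lipschitz in `d_∞`. -/
def InUniquenessClass (w : ContPath T d → ℝ) : Prop :=
  ∃ L > 0, (∀ γ, |w γ| ≤ L * (1 + γ.1.supNorm)) ∧
    ∀ γ η : ContPath T d, |w γ - w η| ≤ L * (1 + max γ.1.supNorm η.1.supNorm) * dist γ η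

end Control

end PHJB

end

set_option linter.unusedSectionVars false

noncomputable section

namespace PHJB

/-! That the value functional V is a solution rests on dynamic programming: V(γ) ≤ ∫ q + V(X_s)
along every trajectory (`valueFunctional_le_integral_add`), with near equality for an almost optimal
control (`exists_integral_add_lt_valueFunctional`). If μ ≥ L and the endpoint of γ lies strictly
inside the ball of radius M₀, all trajectories from γ stay in C^μ for a short time that does not
depend on the control (`exists_restrict_mem_lipPaths`), so the test inequality may be used along
them. A C¹ functional is differentiable only along frozen extensions and endpoint jumps;
`C1Functional.exists_expansion` turns this into a first-order expansion along Lipschitz paths, by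
approximation with step paths. Dividing by the time step gives both viscosity inequalities.

For uniqueness, a solution W is never compared with another viscosity solution, but with the control
problem itself. Suppose that an inequality between W and the problem fails at a Lipschitz path γ₀.
Maximize the gap minus (1/δ)(|γ(t) - η(t)|² + ∫|γ - η|²) over pairs with a common final time, γ in
C^μ and η in a compact set of paths describing the control problem. The maximum exists by
Arzelà–Ascoli (`isCompact_lipPaths`). For Lipschitz paths the penalty controls the cube of the
uniform distance (`penalty_bounds`), which is strong enough to make |p| ‖γ - η‖₀ small for the
penalty gradient p.

At the maximum, η is continued along an explicit path that is differentiable from the right. The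
penalty towards this moving target, plus a function of time, is a C¹ functional
(`Target.functional`) touching W at γ, and no regularity of V is needed. For V ≤ W
(`valueFunctional_le_of_supersolution`), η runs through `reachSet` and is continued with a constant
control that nearly attains the Hamiltonian; dynamic programming replaces V along it by an integral.
For W ≤ V (`le_cost_of_subsolution`), W is compared with the cost of each control separately. Since
the control is only measurable, its velocity and running cost are averaged over a short time window;
the Hamiltonian, being an infimum over controls, stays below such averages up to a small error.

Lipschitz paths are dense and both functionals are continuous, which gives equality everywhere. -/

variable {T : ℝ} {d : ℕ} {U : Type*}

/-- The Euclidean space `ℝ^d`. -/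
abbrev Vec (d : ℕ) := EuclideanSpace ℝ (Fin d)

/-! ### Elementary estimates for paths, restrictions and the metric. -/

namespace CadlagPath

theorem apply_of_time_le (γ : CadlagPath T d) {s : ℝ} (h : γ.time ≤ s) : γ s = γ γ.time := by
  rw [γ.frozen s, min_eq_right h, max_eq_right γ.time_mem.1]

theorem apply_of_nonpos (γ : CadlagPath T d) {s : ℝ} (h : s ≤ 0) : γ s = γ 0 := by
  rw [γ.frozen s, min_eq_left (h.trans γ.time_mem.1), max_eq_left h]

theorem norm_le_supNorm (γ : CadlagPath T d) (s : ℝ) : ‖γ s‖ ≤ γ.supNorm := by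
  obtain ⟨C, hC⟩ := γ.exists_bound
  exact le_ciSup (f := fun s => ‖γ s‖) ⟨C, by rintro _ ⟨s, rfl⟩; exact hC s⟩ s

theorem supNorm_le (γ : CadlagPath T d) {C : ℝ} (h : ∀ s ∈ Icc 0 γ.time, ‖γ s‖ ≤ C) :
    γ.supNorm ≤ C := by
  refine ciSup_le fun s => ?_
  rw [γ.frozen s]
  exact h _ ⟨le_max_left _ _, max_le γ.time_mem.1 (min_le_right _ _)⟩

theorem supNorm_nonneg (γ : CadlagPath T d) : 0 ≤ γ.supNorm :=
  (norm_nonneg _).trans (γ.norm_le_supNorm 0)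

theorem supDist_nonneg (γ η : CadlagPath T d) : 0 ≤ γ.supDist η :=
  (norm_nonneg _).trans (γ.le_supDist η 0)

theorem supDist_comm (γ η : CadlagPath T d) : γ.supDist η = η.supDist γ := by
  simp [supDist, norm_sub_rev]

theorem apply_clamp (γ : CadlagPath T d) {t : ℝ} (ht : γ.time ≤ t) (s : ℝ) :
    γ (max 0 (min s t)) = γ s := by
  rw [γ.frozen, γ.frozen s]
  congr 1
  have := γ.time_mem.1
  grind

theorem supDist_le_of_time_le {γ η : CadlagPath T d} {C t : ℝ} (hγ : γ.time ≤ t) (hη : η.time ≤ t)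
    (h : ∀ s ∈ Icc 0 t, ‖γ s - η s‖ ≤ C) : γ.supDist η ≤ C := by
  refine ciSup_le fun s => ?_
  rw [← γ.apply_clamp hγ s, ← η.apply_clamp hη s]
  exact h _ ⟨le_max_left _ _, max_le (γ.time_mem.1.trans hγ) (min_le_right _ _)⟩

theorem supDist_le {γ η : CadlagPath T d} {C : ℝ} (h : ∀ s ∈ Icc 0 T, ‖γ s - η s‖ ≤ C) :
    γ.supDist η ≤ C :=
  supDist_le_of_time_le γ.time_mem.2 η.time_mem.2 h

theorem supDist_triangle (γ η ζ : CadlagPath T d) :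
    γ.supDist ζ ≤ γ.supDist η + η.supDist ζ :=
  supDist_le fun s _ => (norm_sub_le_norm_sub_add_norm_sub _ (η s) _).trans
    (add_le_add (le_supDist γ η s) (le_supDist η ζ s))

theorem supDist_le_dist (γ η : CadlagPath T d) : γ.supDist η ≤ dist γ η := by
  rw [dist_def]; linarith [abs_nonneg (γ.time - η.time)]

theorem abs_time_sub_le_dist (γ η : CadlagPath T d) : |γ.time - η.time| ≤ dist γ η := by
  rw [dist_def]; linarith [γ.supDist_nonneg η]

theorem norm_sub_le_dist (γ η : CadlagPath T d) (s : ℝ) : ‖γ s - η s‖ ≤ dist γ η :=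
  (γ.le_supDist η s).trans (γ.supDist_le_dist η)

theorem dist_of_time_eq {γ η : CadlagPath T d} (h : γ.time = η.time) :
    dist γ η = γ.supDist η := by
  rw [dist_def, h]; simp

theorem supNorm_le_add (γ η : CadlagPath T d) : γ.supNorm ≤ η.supNorm + γ.supDist η :=
  γ.supNorm_le fun s _ => by
    have h1 := η.norm_le_supNorm s
    have h2 := γ.le_supDist η s
    have h3 := norm_le_norm_add_norm_sub (η s) (γ s)
    rw [norm_sub_rev] at h3
    linarith

theorem continuous_supNorm : Continuous (supNorm : CadlagPath T d → ℝ) := by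
  refine (LipschitzWith.of_dist_le_mul (K := 1) fun γ η => ?_).continuous
  rw [NNReal.coe_one, one_mul, Real.dist_eq, abs_sub_le_iff]
  have h1 := γ.supNorm_le_add η
  have h2 := η.supNorm_le_add γ
  have h3 := γ.supDist_le_dist η
  rw [supDist_comm] at h2
  constructor <;> linarith

theorem continuous_time : Continuous (time : CadlagPath T d → ℝ) := by
  refine (LipschitzWith.of_dist_le_mul (K := 1) fun γ η => ?_).continuous
  rw [NNReal.coe_one, one_mul, Real.dist_eq]
  exact γ.abs_time_sub_le_dist η

theorem continuous_eval (s : ℝ) : Continuous fun γ : CadlagPath T d => γ s := by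
  refine (LipschitzWith.of_dist_le_mul (K := 1) fun γ η => ?_).continuous
  rw [NNReal.coe_one, one_mul, dist_eq_norm]
  exact γ.norm_sub_le_dist η s

theorem time_le (γ : CadlagPath T d) : γ.time ≤ T := γ.time_mem.2
theorem time_nonneg (γ : CadlagPath T d) : 0 ≤ γ.time := γ.time_mem.1

theorem ext_of_Icc {γ η : CadlagPath T d} (h : γ.time = η.time)
    (h' : ∀ s ∈ Icc 0 γ.time, γ s = η s) : γ = η := by
  refine ext' h (funext fun s => ?_)
  have := γ.time_nonneg
  rw [γ.frozen, η.frozen, ← h]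
  exact h' _ ⟨le_max_left _ _, max_le γ.time_mem.1 (min_le_right _ _)⟩

end CadlagPath

theorem abs_clamp_sub_le (r s t : ℝ) : |max 0 (min r t) - max 0 (min s t)| ≤ |r - s| := by
  grind

namespace ContPath

theorem restrict_time (γ : ContPath T d) {s : ℝ} (hs : s ∈ Icc 0 γ.1.time) :
    (γ.restrict s).1.time = s := by
  change max 0 (min s γ.1.time) = s
  rw [min_eq_left hs.2, max_eq_right hs.1]

theorem restrict_apply (γ : ContPath T d) {s : ℝ} (hs : s ∈ Icc 0 γ.1.time) (r : ℝ) :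
    (γ.restrict s).1 r = γ.1 (min r s) := by
  change γ.1 (min r (max 0 (min s γ.1.time))) = _
  rw [min_eq_left hs.2, max_eq_right hs.1]

theorem restrict_apply_of_le (γ : ContPath T d) {s r : ℝ} (hs : s ∈ Icc 0 γ.1.time) (hr : r ≤ s) :
    (γ.restrict s).1 r = γ.1 r := by
  rw [restrict_apply γ hs, min_eq_left hr]

theorem restrict_of_time_le (γ : ContPath T d) {s : ℝ} (hs : γ.1.time ≤ s) :
    γ.restrict s = γ := by
  have h0 := γ.1.time_nonneg
  have h : max 0 (min s γ.1.time) = γ.1.time := by rw [min_eq_right hs, max_eq_right h0]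
  refine Subtype.ext (CadlagPath.ext_of_Icc h fun r hr => ?_)
  change γ.1 (min r (max 0 (min s γ.1.time))) = _
  rw [h, min_eq_left (hr.2.trans h.le)]

theorem restrict_restrict (γ : ContPath T d) {s r : ℝ} (hs : s ∈ Icc 0 γ.1.time)
    (hr : r ≤ s) : (γ.restrict s).restrict r = γ.restrict r := by
  have h0 := γ.1.time_nonneg
  have h : max 0 (min r (max 0 (min s γ.1.time))) = max 0 (min r γ.1.time) := by
    have := hs.1; have := hs.2; grind
  refine Subtype.ext (CadlagPath.ext' h (funext fun x => ?_))
  change γ.1 (min (min x (max 0 (min r (max 0 (min s γ.1.time))))) (max 0 (min s γ.1.time))) =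
    γ.1 (min x (max 0 (min r γ.1.time)))
  congr 1
  rw [h]
  have := hs.1; have := hs.2; grind

theorem supNorm_restrict_le (γ : ContPath T d) (s : ℝ) :
    (γ.restrict s).1.supNorm ≤ γ.1.supNorm :=
  CadlagPath.supNorm_le _ fun _ _ => γ.1.norm_le_supNorm _

theorem supDist_restrict_le (γ η : ContPath T d) (h : γ.1.time = η.1.time) (s : ℝ) :
    (γ.restrict s).1.supDist (η.restrict s).1 ≤ γ.1.supDist η.1 :=
  CadlagPath.supDist_le fun r _ => by
    change ‖γ.1 (min r (max 0 (min s γ.1.time))) - η.1 (min r (max 0 (min s η.1.time)))‖ ≤ _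
    rw [h]
    exact γ.1.le_supDist η.1 _

theorem time_restrict_eq {γ η : ContPath T d} (h : γ.1.time = η.1.time) (s : ℝ) :
    (γ.restrict s).1.time = (η.restrict s).1.time := by
  change max 0 (min s γ.1.time) = max 0 (min s η.1.time)
  rw [h]

theorem uniformContinuous (γ : ContPath T d) : UniformContinuous γ.1.toFun := by
  have h1 : UniformContinuous fun x : Icc (0 : ℝ) γ.1.time => γ.1 x :=
    CompactSpace.uniformContinuous_of_continuous (γ.2.comp continuous_subtype_val)
  have h2 : UniformContinuous (projIcc (0 : ℝ) γ.1.time γ.1.time_nonneg) :=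
    (LipschitzWith.projIcc _).uniformContinuous
  convert h1.comp h2 using 1
  funext s
  change γ.1 s = γ.1 (max 0 (min γ.1.time s))
  rw [min_comm, ← γ.1.frozen]

theorem continuous_restrict (γ : ContPath T d) : Continuous fun s => γ.restrict s := by
  rw [Metric.continuous_iff]
  intro s ε hε
  obtain ⟨δ, hδ, h⟩ := Metric.uniformContinuous_iff.1 γ.uniformContinuous (ε / 3) (by positivity)
  refine ⟨min δ (ε / 3), by positivity, fun r hr => ?_⟩
  have hc : |max 0 (min r γ.1.time) - max 0 (min s γ.1.time)| ≤ |r - s| :=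
    abs_clamp_sub_le _ _ _
  have h1 : |r - s| < δ := hr.trans_le (min_le_left _ _)
  have h2 : |r - s| < ε / 3 := hr.trans_le (min_le_right _ _)
  change dist (γ.restrict r).1 (γ.restrict s).1 < ε
  rw [CadlagPath.dist_def]
  have h3 : (γ.restrict r).1.supDist (γ.restrict s).1 ≤ ε / 3 := by
    refine CadlagPath.supDist_le fun x _ => ?_
    have := h (a := min x (max 0 (min r γ.1.time))) (b := min x (max 0 (min s γ.1.time))) ?_
    · rw [dist_eq_norm] at this
      exact this.le
    · rw [Real.dist_eq]
      have : |min x (max 0 (min r γ.1.time)) - min x (max 0 (min s γ.1.time))| ≤ 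
        |max 0 (min r γ.1.time) - max 0 (min s γ.1.time)| := by
        grind
      linarith
  have h4 : |(γ.restrict r).1.time - (γ.restrict s).1.time| ≤ |r - s| := hc
  linarith

/-- The path with final time `t` given by a continuous function. -/
def ofFun (t : ℝ) (ht : t ∈ Icc 0 T) (g : ℝ → Vec d) (hg : Continuous g) : ContPath T d :=
  have h : Continuous fun s => g (max 0 (min s t)) := by fun_prop
  ⟨{  time := t
      time_mem := ht
      toFun := fun s => g (max 0 (min s t))
      frozen := fun s => by
        congr 1
        have := ht.1
        grind
      right_cont := fun _ => h.continuousWithinAt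
      left_lim := fun s => ⟨_, h.continuousAt.continuousWithinAt.tendsto⟩ }, h⟩

theorem ofFun_apply {t : ℝ} (ht : t ∈ Icc 0 T) {g : ℝ → Vec d} (hg : Continuous g) {s : ℝ}
    (hs : s ∈ Icc 0 t) : (ofFun t ht g hg).1 s = g s := by
  change g (max 0 (min s t)) = g s
  rw [min_eq_left hs.2, max_eq_right hs.1]

theorem ext_of_Icc {γ η : ContPath T d} (h : γ.1.time = η.1.time)
    (h' : ∀ s ∈ Icc 0 γ.1.time, γ.1 s = η.1 s) : γ = η :=
  Subtype.ext (CadlagPath.ext_of_Icc h h')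

end ContPath

/-! ### Coefficients along a path and Gronwall's inequality. -/

/-- The regularity of the coefficients `F` and `q`, with constant `L`. -/
structure IsCoefficient {E : Type*} [NormedAddCommGroup E] [TopologicalSpace U] (L : ℝ)
    (G : ContPath T d → U → E) : Prop where
  nonneg : 0 < L
  continuous : Continuous fun p : ContPath T d × U => G p.1 p.2
  uniform : ∀ γ, ∀ ε > 0, ∃ δ > 0, ∀ η, dist η γ < δ → ∀ u, ‖G η u - G γ u‖ ≤ ε
  lipschitz : ∀ γ η : ContPath T d, γ.1.time = η.1.time → ∀ u,
    ‖G γ u - G η u‖ ≤ L * γ.1.supDist η.1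
  growth : ∀ (γ : ContPath T d) u, ‖G γ u‖ ≤ L * (1 + γ.1.supNorm)

/-- The function (a + L ∫ m) exp(-L(s - t)) has nonpositive derivative, because the hypothesis
bounds m by the bracket. -/
theorem gronwall_of_integral_le {m : ℝ → ℝ} (hm : Continuous m) {a L t T : ℝ} (hL : 0 ≤ L)
    (h : ∀ s ∈ Icc t T, m s ≤ a + L * ∫ σ in t..s, m σ) {s : ℝ} (hs : s ∈ Icc t T) :
    m s ≤ a * Real.exp (L * (s - t)) := by
  have hd : ∀ x, HasDerivAt (fun s => (a + L * ∫ σ in t..s, m σ) * Real.exp (-(L * (s - t))))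
      ((L * m x) * Real.exp (-(L * (x - t))) +
        (a + L * ∫ σ in t..x, m σ) * (Real.exp (-(L * (x - t))) * (-(L * 1)))) x := fun x =>
    (((hm.integral_hasStrictDerivAt t x).hasDerivAt.const_mul L).const_add a).mul
      ((((hasDerivAt_id x).sub_const t).const_mul L).neg.exp)
  have hanti : AntitoneOn (fun s => (a + L * ∫ σ in t..s, m σ) * Real.exp (-(L * (s - t))))
      (Icc t T) := by
    refine antitoneOn_of_deriv_nonpos (convex_Icc _ _)
      (fun x _ => (hd x).continuousAt.continuousWithinAt)
      (fun x _ => (hd x).differentiableAt.differentiableWithinAt) fun x hx => ?_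
    rw [interior_Icc] at hx
    rw [(hd x).deriv]
    have h1 := h x ⟨hx.1.le, hx.2.le⟩
    have h2 := mul_le_mul_of_nonneg_left h1
      (mul_nonneg hL (Real.exp_pos (-(L * (x - t)))).le)
    linarith
  have h1 := hanti (left_mem_Icc.2 (hs.1.trans hs.2)) hs hs.1
  simp only [intervalIntegral.integral_same, mul_zero, add_zero, sub_self, neg_zero, Real.exp_zero,
    mul_one] at h1
  rw [Real.exp_neg, ← div_eq_mul_inv, div_le_iff₀ (Real.exp_pos _)] at h1
  exact (h s hs).trans h1

section Coefficient

variable {E : Type*} [NormedAddCommGroup E] [NormedSpace ℝ E] [SecondCountableTopology E]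
  [MeasurableSpace E] [BorelSpace E]
  [TopologicalSpace U] [MeasurableSpace U] [BorelSpace U]
  {L : ℝ} {G : ContPath T d → U → E}

namespace IsCoefficient

-- The map (s, σ) ↦ G(X_s, u(σ)) is continuous in s and measurable in σ, hence jointly measurable;
-- the integrand is its restriction to the diagonal.
omit [NormedSpace ℝ E] in
theorem stronglyMeasurable (hG : IsCoefficient L G) (X : ContPath T d) {u : ℝ → U}
    (hu : Measurable u) : StronglyMeasurable fun σ => G (X.restrict σ) (u σ) := by
  have h1 : StronglyMeasurable (Function.uncurry fun s σ => G (X.restrict s) (u σ)) := by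
    refine stronglyMeasurable_uncurry_of_continuous_of_stronglyMeasurable (fun σ => ?_) fun s => ?_
    · exact hG.continuous.comp (X.continuous_restrict.prodMk continuous_const)
    · have : Continuous fun v => G (X.restrict s) v :=
        hG.continuous.comp (continuous_const.prodMk continuous_id)
      exact (this.measurable.comp hu).stronglyMeasurable
  exact h1.comp_measurable (measurable_id.prodMk measurable_id)

omit [NormedSpace ℝ E] [SecondCountableTopology E] [MeasurableSpace E] [BorelSpace E]
  [MeasurableSpace U] [BorelSpace U] in
theorem norm_restrict_le (hG : IsCoefficient L G) (X : ContPath T d) (s : ℝ) (v : U) :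
    ‖G (X.restrict s) v‖ ≤ L * (1 + X.1.supNorm) :=
  (hG.growth _ _).trans <| mul_le_mul_of_nonneg_left
    (by linarith [X.supNorm_restrict_le s]) hG.nonneg.le

omit [NormedSpace ℝ E] in
theorem intervalIntegrable (hG : IsCoefficient L G) (X : ContPath T d) {u : ℝ → U}
    (hu : Measurable u) (a b : ℝ) :
    IntervalIntegrable (fun σ => G (X.restrict σ) (u σ)) volume a b := by
  refine (intervalIntegrable_const (c := L * (1 + X.1.supNorm))).mono_fun
    (hG.stronglyMeasurable X hu).aestronglyMeasurable (Eventually.of_forall fun σ => ?_)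
  exact (hG.norm_restrict_le X σ _).trans (le_abs_self _)

omit [SecondCountableTopology E] [MeasurableSpace E] [BorelSpace E]
  [MeasurableSpace U] [BorelSpace U] in
theorem norm_integral_le (hG : IsCoefficient L G) (X : ContPath T d) (u : ℝ → U) (a b : ℝ) :
    ‖∫ σ in a..b, G (X.restrict σ) (u σ)‖ ≤ L * (1 + X.1.supNorm) * |b - a| :=
  intervalIntegral.norm_integral_le_of_norm_le_const fun _ _ => hG.norm_restrict_le X _ _

end IsCoefficient
end Coefficient

theorem TerminalPath.mem_Icc (X : TerminalPath T d) {s : ℝ} (hs : s ∈ Icc 0 T) :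
    s ∈ Icc 0 X.1.1.time := by rwa [X.2]

theorem TerminalPath.nonneg (X : TerminalPath T d) : 0 ≤ T := X.2 ▸ X.1.1.time_nonneg

theorem CadlagPath.supDist_restrict_le_of_le {γ η : ContPath T d} (h : γ.1.time = η.1.time) {s C : ℝ}
    (hs : s ∈ Icc 0 γ.1.time) (hC : ∀ r ∈ Icc 0 s, ‖γ.1 r - η.1 r‖ ≤ C) :
    (γ.restrict s).1.supDist (η.restrict s).1 ≤ C := by
  have hs' : s ∈ Icc 0 η.1.time := h ▸ hs
  refine CadlagPath.supDist_le_of_time_le (ContPath.restrict_time γ hs).le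
    (ContPath.restrict_time η hs').le fun r hr => ?_
  rw [ContPath.restrict_apply_of_le γ hs hr.2, ContPath.restrict_apply_of_le η hs' hr.2]
  exact hC r hr

theorem CadlagPath.supNorm_restrict_le_of_le {γ : ContPath T d} {s C : ℝ}
    (hs : s ∈ Icc 0 γ.1.time) (hC : ∀ r ∈ Icc 0 s, ‖γ.1 r‖ ≤ C) :
    (γ.restrict s).1.supNorm ≤ C := by
  refine CadlagPath.supNorm_le _ fun r hr => ?_
  rw [ContPath.restrict_time γ hs] at hr
  rw [ContPath.restrict_apply_of_le γ hs hr.2]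
  exact hC r hr

theorem ContPath.norm_sub_le_supDist_restrict {γ η : ContPath T d} (h : γ.1.time = η.1.time)
    {s r : ℝ} (hs : s ∈ Icc 0 γ.1.time) (hr : r ≤ s) :
    ‖γ.1 r - η.1 r‖ ≤ (γ.restrict s).1.supDist (η.restrict s).1 := by
  rw [← ContPath.restrict_apply_of_le γ hs hr, ← ContPath.restrict_apply_of_le η (h ▸ hs) hr]
  exact CadlagPath.le_supDist _ _ _

theorem ContPath.continuous_supDist_restrict (γ η : ContPath T d) (h : γ.1.time = η.1.time) :
    Continuous fun s => (γ.restrict s).1.supDist (η.restrict s).1 := by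
  have h1 : (fun s => (γ.restrict s).1.supDist (η.restrict s).1) =
      fun s => dist (γ.restrict s) (η.restrict s) := by
    funext s
    exact (CadlagPath.dist_of_time_eq (time_restrict_eq h s)).symm
  rw [h1]
  exact γ.continuous_restrict.dist η.continuous_restrict

theorem ContPath.continuous_supNorm_restrict (γ : ContPath T d) :
    Continuous fun s => (γ.restrict s).1.supNorm :=
  CadlagPath.continuous_supNorm.comp (continuous_subtype_val.comp γ.continuous_restrict)

/-! ### Existence, uniqueness and growth of trajectories. -/

section Trajectory

variable [TopologicalSpace U] [MeasurableSpace U] [BorelSpace U]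
  {F : ContPath T d → U → EuclideanSpace ℝ (Fin d)} {L : ℝ}

/-- Trajectories of two initial paths stay close, from any time `s` on. -/
theorem IsTrajectory.gronwall (hF : IsCoefficient L F) {X Y : TerminalPath T d} {u : ℝ → U}
    (hu : Measurable u) {s a : ℝ} (hs : s ∈ Icc 0 T) {x y : Vec d}
    (hX : ∀ r ∈ Icc s T, X.1.1 r = x + ∫ σ in s..r, F (X.1.restrict σ) (u σ))
    (hY : ∀ r ∈ Icc s T, Y.1.1 r = y + ∫ σ in s..r, F (Y.1.restrict σ) (u σ))
    (hxy : ∀ r ∈ Icc 0 s, ‖X.1.1 r - Y.1.1 r‖ ≤ a) {r : ℝ} (hr : r ∈ Icc s T) :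
    (X.1.restrict r).1.supDist (Y.1.restrict r).1 ≤ a * Real.exp (L * (r - s)) := by
  have ht : X.1.1.time = Y.1.1.time := X.2.trans Y.2.symm
  have hL := hF.nonneg
  have hxy0 : ‖x - y‖ ≤ a := by
    have h1 := hxy s (right_mem_Icc.2 hs.1)
    rw [hX s (left_mem_Icc.2 hs.2), hY s (left_mem_Icc.2 hs.2)] at h1
    simpa using h1
  have hcont := ContPath.continuous_supDist_restrict X.1 Y.1 ht
  have hnn : ∀ σ, 0 ≤ (X.1.restrict σ).1.supDist (Y.1.restrict σ).1 :=
    fun σ => CadlagPath.supDist_nonneg _ _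
  refine gronwall_of_integral_le (T := T) hcont hL.le (fun r hr => ?_) hr
  refine CadlagPath.supDist_restrict_le_of_le ht (X.mem_Icc ⟨hs.1.trans hr.1, hr.2⟩) fun ρ hρ => ?_
  have hmono : ∀ ρ ∈ Icc s r, (∫ σ in s..ρ, (X.1.restrict σ).1.supDist (Y.1.restrict σ).1) ≤
      ∫ σ in s..r, (X.1.restrict σ).1.supDist (Y.1.restrict σ).1 := fun ρ hρ =>
    intervalIntegral.integral_mono_interval le_rfl hρ.1 hρ.2 (Eventually.of_forall hnn)
      (hcont.intervalIntegrable _ _)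
  rcases le_total ρ s with h | h
  · have h1 := hmono s (left_mem_Icc.2 hr.1)
    rw [intervalIntegral.integral_same] at h1
    have := mul_nonneg hL.le h1
    linarith [hxy ρ ⟨hρ.1, h⟩]
  · have hρT : ρ ∈ Icc s T := ⟨h, hρ.2.trans hr.2⟩
    rw [hX ρ hρT, hY ρ hρT, add_sub_add_comm, ← intervalIntegral.integral_sub
      (hF.intervalIntegrable _ hu _ _) (hF.intervalIntegrable _ hu _ _)]
    refine (norm_add_le _ _).trans (add_le_add hxy0 ?_)
    refine le_trans ?_ (mul_le_mul_of_nonneg_left (hmono ρ ⟨h, hρ.2⟩) hL.le)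
    rw [← intervalIntegral.integral_const_mul]
    refine intervalIntegral.norm_integral_le_of_norm_le h (Eventually.of_forall fun σ _ => ?_)
      ((hcont.const_mul L).intervalIntegrable _ _)
    exact hF.lipschitz _ _ (ContPath.time_restrict_eq ht σ) _

theorem IsTrajectory.unique (hF : IsCoefficient L F) {γ : ContPath T d} {X Y : TerminalPath T d}
    {u : ℝ → U} (hu : Measurable u) (hX : IsTrajectory F γ u X) (hY : IsTrajectory F γ u Y) :
    X = Y := by
  have h := IsTrajectory.gronwall hF hu γ.1.time_mem (a := 0) hX.2 hY.2
    (fun r hr => by rw [hX.1 r hr, hY.1 r hr]; simp) (right_mem_Icc.2 γ.1.time_le)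
  have ht : X.1.1.time = Y.1.1.time := X.2.trans Y.2.symm
  refine Subtype.ext (ContPath.ext_of_Icc ht fun s hs => ?_)
  rw [X.2] at hs
  have h1 := ContPath.norm_sub_le_supDist_restrict ht
    (X.mem_Icc (right_mem_Icc.2 X.nonneg)) hs.2
  rw [zero_mul] at h
  exact sub_eq_zero.1 (norm_le_zero_iff.1 (h1.trans h))

-- The quantity 1 + ‖X_s‖₀ grows at rate at most L. The exponent keeps the elapsed time instead of
-- T, so that successive bounds multiply correctly; the invariance of `reachSet` uses this.
omit [MeasurableSpace U] [BorelSpace U] in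
theorem IsTrajectory.growth (hF : IsCoefficient L F) {γ : ContPath T d} {X : TerminalPath T d}
    {u : ℝ → U} (hX : IsTrajectory F γ u X) {s : ℝ}
    (hs : s ∈ Icc γ.1.time T) :
    1 + (X.1.restrict s).1.supNorm ≤ (1 + γ.1.supNorm) * Real.exp (L * (s - γ.1.time)) := by
  have hL := hF.nonneg
  have hcont := X.1.continuous_supNorm_restrict
  have hnn : ∀ σ, 0 ≤ 1 + (X.1.restrict σ).1.supNorm :=
    fun σ => by linarith [(X.1.restrict σ).1.supNorm_nonneg]
  have hcont' : Continuous fun s => 1 + (X.1.restrict s).1.supNorm := by fun_prop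
  refine gronwall_of_integral_le (T := T) hcont' hL.le (fun r hr => ?_) hs
  have hmono : ∀ ρ ∈ Icc γ.1.time r, (∫ σ in γ.1.time..ρ, (1 + (X.1.restrict σ).1.supNorm)) ≤
      ∫ σ in γ.1.time..r, (1 + (X.1.restrict σ).1.supNorm) := fun ρ hρ =>
    intervalIntegral.integral_mono_interval le_rfl hρ.1 hρ.2 (Eventually.of_forall hnn)
      (hcont'.intervalIntegrable _ _)
  rw [add_assoc]
  refine add_le_add le_rfl
    (CadlagPath.supNorm_restrict_le_of_le
    (X.mem_Icc ⟨γ.1.time_nonneg.trans hr.1, hr.2⟩) fun ρ hρ => ?_)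
  rcases le_total ρ γ.1.time with h | h
  · have h1 := hmono γ.1.time (left_mem_Icc.2 hr.1)
    rw [intervalIntegral.integral_same] at h1
    have := mul_nonneg hL.le h1
    rw [hX.1 ρ ⟨hρ.1, h⟩]
    linarith [γ.1.norm_le_supNorm ρ]
  · rw [hX.2 ρ ⟨h, hρ.2.trans hr.2⟩]
    refine (norm_add_le _ _).trans (add_le_add (γ.1.norm_le_supNorm _) ?_)
    refine le_trans ?_ (mul_le_mul_of_nonneg_left (hmono ρ ⟨h, hρ.2⟩) hL.le)
    rw [← intervalIntegral.integral_const_mul]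
    refine intervalIntegral.norm_integral_le_of_norm_le h (Eventually.of_forall fun σ _ => ?_)
      ((hcont'.const_mul L).intervalIntegrable _ _)
    exact hF.growth _ _

/-- Banach's fixed point theorem on the whole of [0,T] at once. The unknown is z(s) = exp(-λs) X(s),
which amounts to an exponentially weighted supremum norm and avoids gluing solutions on short
intervals. The maps s ∧ t and s ∨ t build the initial condition into the fixed point equation. -/
theorem exists_isTrajectory (hF : IsCoefficient L F) (γ : ContPath T d) {u : ℝ → U}
    (hu : Measurable u) : ∃ X, IsTrajectory F γ u X := by
  have hL := hF.nonneg
  have hT : 0 ≤ T := γ.1.time_nonneg.trans γ.1.time_le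
  set t := γ.1.time with htdef
  -- Since L ∫_t^s exp(2Lσ) dσ ≤ exp(2Ls)/2, this weight gives the contraction constant 1/2.
  set lam := 2 * L with hlam
  have hTm : T ∈ Icc 0 T := right_mem_Icc.2 hT
  obtain ⟨lift, hlt, hlift⟩ : ∃ lift : C(Icc (0 : ℝ) T, Vec d) → ContPath T d,
      (∀ z, (lift z).1.time = T) ∧
      ∀ z (s : ℝ) (hs : s ∈ Icc 0 T), (lift z).1 s = Real.exp (lam * s) • z ⟨s, hs⟩ :=
    ⟨fun z => ContPath.ofFun T hTm
      (fun s => Real.exp (lam * s) • z (projIcc 0 T hT s)) (by fun_prop),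
      fun z => rfl, fun z s hs => by rw [ContPath.ofFun_apply hTm _ hs, projIcc_of_mem hT hs]⟩
  have hint : ∀ z a b, IntervalIntegrable (fun σ => F ((lift z).restrict σ) (u σ)) volume a b :=
    fun z a b => hF.intervalIntegrable _ hu a b
  have hprim : ∀ z, Continuous fun s => ∫ σ in t..s, F ((lift z).restrict σ) (u σ) := fun z =>
    intervalIntegral.continuous_primitive (hint z) t
  obtain ⟨step, hstep⟩ : ∃ step : C(Icc (0 : ℝ) T, Vec d) → C(Icc (0 : ℝ) T, Vec d),
      ∀ z (s : Icc (0 : ℝ) T), step z s = Real.exp (-(lam * s)) • (γ.1 (min s t) +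
        ∫ σ in t..(max (s : ℝ) t), F ((lift z).restrict σ) (u σ)) := by
    refine ⟨fun z => ⟨_, ?_⟩, fun z s => rfl⟩
    have h1 : Continuous fun s : Icc (0 : ℝ) T => γ.1 (min s t) :=
      γ.2.comp (continuous_subtype_val.min continuous_const)
    have h2 : Continuous fun s : Icc (0 : ℝ) T =>
        ∫ σ in t..(max (s : ℝ) t), F ((lift z).restrict σ) (u σ) :=
      (hprim z).comp (continuous_subtype_val.max continuous_const)
    have h3 : Continuous fun s : Icc (0 : ℝ) T => Real.exp (-(lam * s)) := by fun_prop
    exact h3.smul (h1.add h2)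
  have hcontr : ContractingWith (1 / 2) step := by
    refine ⟨by rw [div_lt_one] <;> norm_num, LipschitzWith.of_dist_le_mul fun x y => ?_⟩
    rw [ContinuousMap.dist_le (by positivity)]
    intro s
    have hb : ∀ σ ∈ Icc 0 T, ‖F ((lift x).restrict σ) (u σ) - F ((lift y).restrict σ) (u σ)‖ ≤
        L * (Real.exp (lam * σ) * dist x y) := by
      intro σ hσ
      refine (hF.lipschitz _ _ (ContPath.time_restrict_eq ((hlt x).trans (hlt y).symm) σ) _).trans
        (mul_le_mul_of_nonneg_left ?_ hL.le)
      refine CadlagPath.supDist_restrict_le_of_le ((hlt x).trans (hlt y).symm)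
        ((hlt x).symm ▸ hσ) fun r hr => ?_
      have hr' : r ∈ Icc 0 T := ⟨hr.1, hr.2.trans hσ.2⟩
      rw [hlift x r hr', hlift y r hr', ← smul_sub, norm_smul, Real.norm_eq_abs, Real.abs_exp,
        ← dist_eq_norm]
      have : lam * r ≤ lam * σ := mul_le_mul_of_nonneg_left hr.2 (by positivity)
      exact mul_le_mul (Real.exp_le_exp.2 this) (ContinuousMap.dist_apply_le_dist _) dist_nonneg
        (Real.exp_pos _).le
    have hm : max (s : ℝ) t ∈ Icc 0 T := ⟨s.2.1.trans (le_max_left _ _), max_le s.2.2 γ.1.time_le⟩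
    rw [hstep, hstep, dist_eq_norm, ← smul_sub, add_sub_add_left_eq_sub, ← intervalIntegral.integral_sub
      (hint _ _ _) (hint _ _ _), norm_smul, Real.norm_eq_abs, Real.abs_exp, Real.exp_neg,
      inv_mul_le_iff₀ (Real.exp_pos _)]
    have h0 : 0 ≤ Real.exp (lam * s) * (1 / 2 * dist x y) := by positivity
    rcases le_total (s : ℝ) t with h | h
    · rw [max_eq_right h]
      simpa using h0
    · rw [max_eq_left h]
      have hce : Continuous fun σ : ℝ => L * (Real.exp (lam * σ) * dist x y) := by fun_prop
      have h1 := intervalIntegral.norm_integral_le_of_norm_le h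
        (f := fun σ => F ((lift x).restrict σ) (u σ) - F ((lift y).restrict σ) (u σ))
        (Eventually.of_forall fun σ hσ => hb σ ⟨γ.1.time_nonneg.trans hσ.1.le, hσ.2.trans s.2.2⟩)
        (hce.intervalIntegrable (μ := volume) _ _)
      have h2 : ∫ σ in t..(s : ℝ), L * (Real.exp (lam * σ) * dist x y) =
          1 / 2 * dist x y * Real.exp (lam * s) - 1 / 2 * dist x y * Real.exp (lam * t) := by
        refine intervalIntegral.integral_eq_sub_of_hasDerivAt
          (f := fun σ => 1 / 2 * dist x y * Real.exp (lam * σ)) (fun σ _ => ?_)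
          (hce.intervalIntegrable _ _)
        have := (((hasDerivAt_id σ).const_mul lam).exp).const_mul (1 / 2 * dist x y)
        refine this.congr_deriv ?_
        simp only [id, hlam]
        ring
      have h3 : 0 ≤ 1 / 2 * dist x y * Real.exp (lam * t) := by positivity
      refine h1.trans ?_
      rw [h2, NNReal.coe_div, NNReal.coe_one, NNReal.coe_ofNat]
      linarith
  obtain ⟨z, hz⟩ : ∃ z, step z = z := ⟨_, hcontr.fixedPoint_isFixedPt⟩
  have key : ∀ s ∈ Icc 0 T, (lift z).1 s = γ.1 (min s t) +
      ∫ σ in t..(max s t), F ((lift z).restrict σ) (u σ) := fun s hs => by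
    rw [hlift z s hs]
    conv_lhs => rw [← hz]
    rw [hstep, smul_smul, ← Real.exp_add, add_neg_cancel, Real.exp_zero, one_smul]
  refine ⟨⟨lift z, hlt z⟩, fun s hs => ?_, fun s hs => ?_⟩
  · have := key s ⟨hs.1, hs.2.trans γ.1.time_le⟩
    rwa [min_eq_left hs.2, max_eq_right hs.2, intervalIntegral.integral_same, add_zero] at this
  · have := key s ⟨γ.1.time_nonneg.trans hs.1, hs.2⟩
    rwa [min_eq_right hs.1, max_eq_left hs.1] at this

end Trajectory

/-! ### The cost and the value functional: growth and Lipschitz bounds. -/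

/-- The regularity of the terminal cost `φ`, with constant `L`. -/
structure IsTerminalCost (L : ℝ) (φ : TerminalPath T d → ℝ) : Prop where
  lipschitz : ∀ γ η : TerminalPath T d, |φ γ - φ η| ≤ L * γ.1.1.supDist η.1.1
  growth : ∀ γ : TerminalPath T d, |φ γ| ≤ L * (1 + γ.1.1.supNorm)

theorem StandingHypothesis.exists_constant [TopologicalSpace U]
    {F : ContPath T d → U → EuclideanSpace ℝ (Fin d)} {q : ContPath T d → U → ℝ}
    {φ : TerminalPath T d → ℝ} (h : StandingHypothesis F q φ) :
    ∃ L, IsCoefficient L F ∧ IsCoefficient L q ∧ IsTerminalCost L φ := by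
  obtain ⟨L, hL, h1, h2, h3, h4⟩ := h.bounds
  exact ⟨L, ⟨hL, h.continuous_F, h.uniform_F, fun γ η e u => (h1 γ η e u).1, fun γ u => (h2 γ u).1⟩,
    ⟨hL, h.continuous_q, h.uniform_q, fun γ η e u => (h1 γ η e u).2, fun γ u => (h2 γ u).2⟩,
    ⟨h3, h4⟩⟩

theorem TerminalPath.restrict_final (X : TerminalPath T d) : X.1.restrict T = X.1 :=
  X.1.restrict_of_time_le X.2.le

theorem TerminalPath.restrict_time (X : TerminalPath T d) {s : ℝ} (hs : s ∈ Icc 0 T) :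
    (X.1.restrict s).1.time = s := ContPath.restrict_time X.1 (X.mem_Icc hs)

theorem TerminalPath.restrict_apply_of_le (X : TerminalPath T d) {s r : ℝ} (hs : s ∈ Icc 0 T)
    (hr : r ≤ s) : (X.1.restrict s).1 r = X.1.1 r :=
  ContPath.restrict_apply_of_le X.1 (X.mem_Icc hs) hr

section

variable [TopologicalSpace U] {F : ContPath T d → U → EuclideanSpace ℝ (Fin d)}
  {q : ContPath T d → U → ℝ} {φ : TerminalPath T d → ℝ} {L : ℝ}

theorem IsTrajectory.restrict_initial {γ : ContPath T d} {X : TerminalPath T d} {u : ℝ → U}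
    (hX : IsTrajectory F γ u X) : X.1.restrict γ.1.time = γ :=
  ContPath.ext_of_Icc (X.restrict_time γ.1.time_mem) fun s hs => by
    rw [X.restrict_time γ.1.time_mem] at hs
    rw [X.restrict_apply_of_le γ.1.time_mem hs.2, hX.1 s hs]

theorem IsTrajectory.eq_add_integral [MeasurableSpace U] [BorelSpace U] (hF : IsCoefficient L F)
    {γ : ContPath T d} {X : TerminalPath T d} {u : ℝ → U}
    (hu : Measurable u) (hX : IsTrajectory F γ u X) {s r : ℝ} (hs : s ∈ Icc γ.1.time T)
    (hr : r ∈ Icc γ.1.time T) :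
    X.1.1 r = X.1.1 s + ∫ σ in s..r, F (X.1.restrict σ) (u σ) := by
  have hi := hF.intervalIntegrable X.1 hu
  rw [hX.2 r hr, hX.2 s hs, ← intervalIntegral.integral_interval_sub_left (hi γ.1.time r)
    (hi γ.1.time s)]
  abel

theorem IsTrajectory.norm_bound (hF : IsCoefficient L F) {γ : ContPath T d} {X : TerminalPath T d}
    {u : ℝ → U} (hX : IsTrajectory F γ u X) :
    1 + X.1.1.supNorm ≤ (1 + γ.1.supNorm) * Real.exp (L * T) := by
  have h := hX.growth hF (right_mem_Icc.2 γ.1.time_le)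
  rw [X.restrict_final] at h
  refine h.trans (mul_le_mul_of_nonneg_left (Real.exp_le_exp.2 ?_)
    (by linarith [γ.1.supNorm_nonneg]))
  exact mul_le_mul_of_nonneg_left (by linarith [γ.1.time_nonneg]) hF.nonneg.le

theorem IsTrajectory.norm_sub_le [MeasurableSpace U] [BorelSpace U] (hF : IsCoefficient L F)
    {γ : ContPath T d} {X : TerminalPath T d} {u : ℝ → U}
    (hu : Measurable u) (hX : IsTrajectory F γ u X) {s r : ℝ} (hs : s ∈ Icc γ.1.time T)
    (hr : r ∈ Icc γ.1.time T) :
    ‖X.1.1 r - X.1.1 s‖ ≤ L * ((1 + γ.1.supNorm) * Real.exp (L * T)) * |r - s| := by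
  rw [hX.eq_add_integral hF hu hs hr, add_sub_cancel_left]
  refine (hF.norm_integral_le X.1 u s r).trans (mul_le_mul_of_nonneg_right
    (mul_le_mul_of_nonneg_left (hX.norm_bound hF) hF.nonneg.le) (abs_nonneg _))

theorem IsTrajectory.restrict [MeasurableSpace U] [BorelSpace U] (hF : IsCoefficient L F)
    {γ : ContPath T d} {X : TerminalPath T d} {u : ℝ → U}
    (hu : Measurable u) (hX : IsTrajectory F γ u X) {s : ℝ} (hs : s ∈ Icc γ.1.time T) :
    IsTrajectory F (X.1.restrict s) u X := by
  have hs0 : s ∈ Icc 0 T := ⟨γ.1.time_nonneg.trans hs.1, hs.2⟩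
  rw [IsTrajectory, X.restrict_time hs0]
  refine ⟨fun r hr => (X.restrict_apply_of_le hs0 hr.2).symm, fun r hr => ?_⟩
  rw [X.restrict_apply_of_le hs0 le_rfl]
  exact hX.eq_add_integral hF hu hs ⟨hs.1.trans hr.1, hr.2⟩

theorem cost_split [MeasurableSpace U] [BorelSpace U] (hq : IsCoefficient L q)
    {u : ℝ → U} (hu : Measurable u) (X : TerminalPath T d) (t s : ℝ) :
    cost q φ t u X = (∫ σ in t..s, q (X.1.restrict σ) (u σ)) + cost q φ s u X := by
  have hi := hq.intervalIntegrable X.1 hu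
  rw [cost, cost, ← intervalIntegral.integral_add_adjacent_intervals (hi t s) (hi s T), add_assoc]

theorem IsTrajectory.abs_cost_le (hF : IsCoefficient L F) (hq : IsCoefficient L q)
    (hφ : IsTerminalCost L φ) {γ : ContPath T d} {X : TerminalPath T d} {u : ℝ → U}
    (hX : IsTrajectory F γ u X) :
    |cost q φ γ.1.time u X| ≤ L * (T + 1) * Real.exp (L * T) * (1 + γ.1.supNorm) := by
  have hL := hF.nonneg
  have hb := hX.norm_bound hF
  have h1 := hq.norm_integral_le X.1 u γ.1.time T
  have h2 := hφ.growth X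
  have h3 : |T - γ.1.time| ≤ T := by
    rw [abs_of_nonneg (by linarith [γ.1.time_le])]
    linarith [γ.1.time_nonneg]
  have h0 : 0 ≤ L * (1 + X.1.1.supNorm) := mul_nonneg hL.le (by linarith [X.1.1.supNorm_nonneg])
  have h4 : L * (1 + X.1.1.supNorm) * (T + 1) ≤
      L * ((1 + γ.1.supNorm) * Real.exp (L * T)) * (T + 1) :=
    mul_le_mul_of_nonneg_right (mul_le_mul_of_nonneg_left hb hL.le) (by linarith [X.nonneg])
  have h5 := mul_le_mul_of_nonneg_left h3 h0
  rw [Real.norm_eq_abs] at h1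
  calc |cost q φ γ.1.time u X| ≤ _ := abs_add_le _ _
    _ ≤ L * (1 + X.1.1.supNorm) * T + L * (1 + X.1.1.supNorm) := by linarith
    _ ≤ _ := by linarith

/-- Both initial paths are driven by the same control. Until the later starting time, Y still
follows η while X moves with bounded speed during a time of at most d_∞(γ, η); afterwards Gronwall
propagates the difference. -/
theorem abs_cost_sub_cost_le [MeasurableSpace U] [BorelSpace U] (hF : IsCoefficient L F)
    (hq : IsCoefficient L q) (hφ : IsTerminalCost L φ) {γ η : ContPath T d}
    {X Y : TerminalPath T d} {u : ℝ → U} (hu : Measurable u) (hX : IsTrajectory F γ u X)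
    (hY : IsTrajectory F η u Y) (ht : γ.1.time ≤ η.1.time) :
    |cost q φ γ.1.time u X - cost q φ η.1.time u Y| ≤
      L * Real.exp (L * T) * (1 + (T + 1) * (1 + L * Real.exp (L * T))) *
        (1 + max γ.1.supNorm η.1.supNorm) * dist γ η := by
  have hL := hF.nonneg
  have hT := X.nonneg
  set N := 1 + max γ.1.supNorm η.1.supNorm with hN
  set E := Real.exp (L * T) with hE
  have hE0 : 0 < E := Real.exp_pos _
  set D := dist γ η with hD
  have hD0 : 0 ≤ D := dist_nonneg
  have hγN : 1 + γ.1.supNorm ≤ N := by linarith [le_max_left γ.1.supNorm η.1.supNorm]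
  have hN1 : 1 ≤ N := by linarith [γ.1.supNorm_nonneg]
  have hDN : D ≤ N * D := le_mul_of_one_le_left hD0 hN1
  have htD : |η.1.time - γ.1.time| ≤ D := by
    rw [abs_sub_comm]; exact CadlagPath.abs_time_sub_le_dist γ.1 η.1
  have hXN : L * (1 + X.1.1.supNorm) ≤ L * (N * E) :=
    mul_le_mul_of_nonneg_left ((hX.norm_bound hF).trans
      (mul_le_mul_of_nonneg_right hγN hE0.le)) hL.le
  have hLNE : 0 ≤ L * (N * E) := by positivity
  -- Bound on |X - Y| before the later starting time: D for |γ - η|, and L N E D for the motion of X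
  -- away from the frozen γ.
  set a := N * D * (1 + L * E) with ha
  have hclose : ∀ r ∈ Icc 0 η.1.time, ‖X.1.1 r - Y.1.1 r‖ ≤ a := by
    intro r hr
    have hγη : ‖γ.1 r - η.1 r‖ ≤ D := CadlagPath.norm_sub_le_dist _ _ _
    rw [hY.1 r hr]
    have h1 : ‖X.1.1 r - γ.1 r‖ ≤ L * (N * E) * D := by
      rcases le_total r γ.1.time with h | h
      · rw [hX.1 r ⟨hr.1, h⟩, sub_self, norm_zero]
        positivity
      · rw [γ.1.apply_of_time_le h, hX.2 r ⟨h, hr.2.trans η.1.time_le⟩, add_sub_cancel_left]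
        refine (hF.norm_integral_le X.1 u _ _).trans (mul_le_mul hXN ?_ (abs_nonneg _) hLNE)
        refine le_trans ?_ htD
        rw [abs_of_nonneg (by linarith), abs_of_nonneg (by linarith)]
        linarith [hr.2]
    have h2 := norm_sub_le_norm_sub_add_norm_sub (X.1.1 r) (γ.1 r) (η.1 r)
    have : a = N * D + L * (N * E) * D := by rw [ha]; ring
    linarith
  have ha0 : 0 ≤ a := (norm_nonneg _).trans (hclose 0 ⟨le_rfl, η.1.time_nonneg⟩)
  have hdist : X.1.1.supDist Y.1.1 ≤ a * E := by
    have h := IsTrajectory.gronwall hF hu η.1.time_mem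
      (fun r hr => hX.eq_add_integral hF hu ⟨ht, η.1.time_le⟩ ⟨ht.trans hr.1, hr.2⟩)
      (fun r hr => hY.eq_add_integral hF hu (left_mem_Icc.2 η.1.time_le) hr) hclose
      (right_mem_Icc.2 η.1.time_le)
    rw [X.restrict_final, Y.restrict_final] at h
    refine h.trans (mul_le_mul_of_nonneg_left (Real.exp_le_exp.2 ?_) ha0)
    exact mul_le_mul_of_nonneg_left (by linarith [η.1.time_nonneg]) hL.le
  have hφd : |φ X - φ Y| ≤ L * (a * E) :=
    (hφ.lipschitz X Y).trans (mul_le_mul_of_nonneg_left hdist hL.le)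
  have hq1 : |∫ σ in γ.1.time..η.1.time, q (X.1.restrict σ) (u σ)| ≤ L * (N * E) * D :=
    (hq.norm_integral_le X.1 u _ _).trans (mul_le_mul hXN htD (abs_nonneg _) hLNE)
  have htime : X.1.1.time = Y.1.1.time := X.2.trans Y.2.symm
  have hq2 : |(∫ σ in η.1.time..T, q (X.1.restrict σ) (u σ)) -
      ∫ σ in η.1.time..T, q (Y.1.restrict σ) (u σ)| ≤ L * (a * E) * T := by
    rw [← intervalIntegral.integral_sub (hq.intervalIntegrable _ hu _ _)
      (hq.intervalIntegrable _ hu _ _)]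
    rw [← Real.norm_eq_abs]
    refine (intervalIntegral.norm_integral_le_of_norm_le_const (C := L * (a * E))
      fun σ _ => ?_).trans ?_
    · refine (hq.lipschitz _ _ (ContPath.time_restrict_eq htime σ) _).trans
        (mul_le_mul_of_nonneg_left ?_ hL.le)
      exact (ContPath.supDist_restrict_le _ _ htime σ).trans hdist
    · refine mul_le_mul_of_nonneg_left ?_ (by positivity)
      rw [abs_of_nonneg (by linarith [η.1.time_le])]
      linarith [η.1.time_nonneg]
  rw [cost_split hq hu X γ.1.time η.1.time]
  simp only [cost]
  calc _ = |(∫ σ in γ.1.time..η.1.time, q (X.1.restrict σ) (u σ)) +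
        ((∫ σ in η.1.time..T, q (X.1.restrict σ) (u σ)) -
        ∫ σ in η.1.time..T, q (Y.1.restrict σ) (u σ)) + (φ X - φ Y)| := by congr 1; ring
    _ ≤ _ := abs_add_three _ _ _
    _ ≤ L * (N * E) * D + L * (a * E) * T + L * (a * E) := by linarith
    _ = _ := by rw [ha]; ring

variable [Nonempty U] [MeasurableSpace U] [BorelSpace U]

theorem costs_nonempty (hF : IsCoefficient L F) (γ : ContPath T d) :
    (costs F q φ γ).Nonempty := by
  obtain ⟨v⟩ := ‹Nonempty U›
  obtain ⟨X, hX⟩ := exists_isTrajectory hF γ (measurable_const (a := v))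
  exact ⟨_, _, measurable_const, X, hX, rfl⟩

theorem bddBelow_costs (hF : IsCoefficient L F) (hq : IsCoefficient L q)
    (hφ : IsTerminalCost L φ) (γ : ContPath T d) : BddBelow (costs F q φ γ) := by
  refine ⟨-(L * (T + 1) * Real.exp (L * T) * (1 + γ.1.supNorm)), ?_⟩
  rintro _ ⟨u, hu, X, hX, rfl⟩
  exact (abs_le.1 (hX.abs_cost_le hF hq hφ)).1

theorem isGLB_valueFunctional (hF : IsCoefficient L F) (hq : IsCoefficient L q)
    (hφ : IsTerminalCost L φ) (γ : ContPath T d) :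
    IsGLB (costs F q φ γ) (valueFunctional F q φ γ) :=
  isGLB_csInf (costs_nonempty hF γ) (bddBelow_costs hF hq hφ γ)

theorem valueFunctional_le_cost (hF : IsCoefficient L F) (hq : IsCoefficient L q)
    (hφ : IsTerminalCost L φ) {γ : ContPath T d} {u : ℝ → U} (hu : Measurable u)
    {X : TerminalPath T d} (hX : IsTrajectory F γ u X) :
    valueFunctional F q φ γ ≤ cost q φ γ.1.time u X :=
  (isGLB_valueFunctional hF hq hφ γ).1 ⟨u, hu, X, hX, rfl⟩

theorem exists_cost_lt (hF : IsCoefficient L F) (γ : ContPath T d) {ε : ℝ} (hε : 0 < ε) :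
    ∃ u : ℝ → U, Measurable u ∧ ∃ X, IsTrajectory F γ u X ∧
      cost q φ γ.1.time u X < valueFunctional F q φ γ + ε := by
  obtain ⟨_, ⟨u, hu, X, hX, rfl⟩, h⟩ := exists_lt_of_csInf_lt (costs_nonempty hF γ)
    (lt_add_of_pos_right (valueFunctional F q φ γ) hε)
  exact ⟨u, hu, X, hX, h⟩

theorem abs_valueFunctional_le (hF : IsCoefficient L F) (hq : IsCoefficient L q)
    (hφ : IsTerminalCost L φ) (γ : ContPath T d) :
    |valueFunctional F q φ γ| ≤ L * (T + 1) * Real.exp (L * T) * (1 + γ.1.supNorm) := by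
  refine abs_le.2 ⟨le_csInf (costs_nonempty hF γ) ?_, ?_⟩
  · rintro _ ⟨u, hu, X, hX, rfl⟩
    exact (abs_le.1 (hX.abs_cost_le hF hq hφ)).1
  · obtain ⟨_, ⟨u, hu, X, hX, rfl⟩⟩ := costs_nonempty (q := q) (φ := φ) hF γ
    exact (valueFunctional_le_cost hF hq hφ hu hX).trans (abs_le.1 (hX.abs_cost_le hF hq hφ)).2

theorem abs_valueFunctional_sub_le (hF : IsCoefficient L F) (hq : IsCoefficient L q)
    (hφ : IsTerminalCost L φ) (γ η : ContPath T d) :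
    |valueFunctional F q φ γ - valueFunctional F q φ η| ≤
      L * Real.exp (L * T) * (1 + (T + 1) * (1 + L * Real.exp (L * T))) *
        (1 + max γ.1.supNorm η.1.supNorm) * dist γ η := by
  wlog h : γ.1.time ≤ η.1.time generalizing γ η
  · rw [abs_sub_comm, max_comm, dist_comm]
    exact this η γ (le_of_not_ge h)
  rw [abs_sub_le_iff]
  constructor <;> refine le_of_forall_pos_le_add fun ε hε => ?_
  · obtain ⟨u, hu, Y, hY, hYc⟩ := exists_cost_lt (q := q) (φ := φ) hF η hε
    obtain ⟨X, hX⟩ := exists_isTrajectory hF γ hu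
    have h1 := (abs_le.1 (abs_cost_sub_cost_le hF hq hφ hu hX hY h)).2
    have h2 := valueFunctional_le_cost hF hq hφ hu hX
    linarith
  · obtain ⟨u, hu, X, hX, hXc⟩ := exists_cost_lt (q := q) (φ := φ) hF γ hε
    obtain ⟨Y, hY⟩ := exists_isTrajectory hF η hu
    have h1 := (abs_le.1 (abs_cost_sub_cost_le hF hq hφ hu hX hY h)).1
    have h2 := valueFunctional_le_cost hF hq hφ hu hY
    linarith

theorem inUniquenessClass_valueFunctional (hF : IsCoefficient L F) (hq : IsCoefficient L q)
    (hφ : IsTerminalCost L φ) (hT : 0 < T) : InUniquenessClass (valueFunctional F q φ) := by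
  have hL := hF.nonneg
  have h1 : 0 < L * (T + 1) * Real.exp (L * T) := by positivity
  have h2 : 0 < L * Real.exp (L * T) * (1 + (T + 1) * (1 + L * Real.exp (L * T))) := by positivity
  refine ⟨L * (T + 1) * Real.exp (L * T) +
    L * Real.exp (L * T) * (1 + (T + 1) * (1 + L * Real.exp (L * T))), by positivity,
    fun γ => (abs_valueFunctional_le hF hq hφ γ).trans ?_,
    fun γ η => (abs_valueFunctional_sub_le hF hq hφ γ η).trans ?_⟩
  · exact mul_le_mul_of_nonneg_right (by linarith) (by linarith [γ.1.supNorm_nonneg])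
  · refine mul_le_mul_of_nonneg_right (mul_le_mul_of_nonneg_right (by linarith) ?_) dist_nonneg
    linarith [le_max_left γ.1.supNorm η.1.supNorm, γ.1.supNorm_nonneg]

theorem InUniquenessClass.continuous {w : ContPath T d → ℝ} (hw : InUniquenessClass w) :
    Continuous w := by
  obtain ⟨L, -, -, h⟩ := hw
  rw [continuous_iff_continuousAt]
  intro γ
  rw [ContinuousAt, tendsto_iff_dist_tendsto_zero]
  have hc : Continuous fun η : ContPath T d =>
      L * (1 + max η.1.supNorm γ.1.supNorm) * dist η γ := by
    have : Continuous fun η : ContPath T d => η.1.supNorm :=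
      CadlagPath.continuous_supNorm.comp continuous_subtype_val
    fun_prop
  refine squeeze_zero (fun _ => dist_nonneg) (fun η => h η γ) ?_
  simpa using hc.tendsto γ

/-- From a path that already lasts until T there is only one trajectory, so every control has the
same cost. -/
theorem valueFunctional_terminal (hF : IsCoefficient L F) (γ : TerminalPath T d) : valueFunctional F q φ γ.1 = φ γ := by
  have key : ∀ u X, IsTrajectory F γ.1 u X → cost q φ γ.1.1.time u X = φ γ := fun u X hX => by
    have : X = γ := by
      have := hX.restrict_initial
      rw [γ.2, X.restrict_final] at this
      exact Subtype.ext this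
    rw [cost, γ.2, intervalIntegral.integral_same, zero_add, this]
  have : costs F q φ γ.1 = {φ γ} := by
    refine (costs_nonempty hF γ.1).subset_singleton_iff.1 ?_
    rintro _ ⟨u, hu, X, hX, rfl⟩
    exact key u X hX
  rw [valueFunctional, this, csInf_singleton]

/-! ### Concatenation of controls and dynamic programming. -/

/-- The coefficients see only the past of the path, so up to time s the new trajectory cannot differ
from X, and after s it solves the equation of X'. -/
theorem IsTrajectory.concat (hF : IsCoefficient L F) {γ : ContPath T d} {u u' : ℝ → U}
    {X X' : TerminalPath T d} {s : ℝ}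
    (hs : s ∈ Icc γ.1.time T) (hX : IsTrajectory F γ u X)
    (hu' : Measurable u) (hX' : IsTrajectory F (X.1.restrict s) u' X') (hv : Measurable u') :
    IsTrajectory F γ (fun σ => if σ ≤ s then u σ else u' σ) X' ∧
      X'.1.restrict s = X.1.restrict s := by
  have hs0 : s ∈ Icc 0 T := ⟨γ.1.time_nonneg.trans hs.1, hs.2⟩
  have hmeas : Measurable fun σ => if σ ≤ s then u σ else u' σ :=
    Measurable.ite measurableSet_Iic hu' hv
  have hst := X.restrict_time hs0
  have hres : X'.1.restrict s = X.1.restrict s := by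
    have := hX'.restrict_initial
    rwa [hst] at this
  have hres' : ∀ σ ≤ s, X'.1.restrict σ = X.1.restrict σ := fun σ hσ => by
    rw [← ContPath.restrict_restrict X'.1 (X'.mem_Icc hs0) hσ, hres,
      ContPath.restrict_restrict X.1 (X.mem_Icc hs0) hσ]
  have hval : ∀ r ≤ s, X'.1.1 r = X.1.1 r := fun r hr => by
    rw [← X'.restrict_apply_of_le hs0 hr, hres, X.restrict_apply_of_le hs0 hr]
  refine ⟨⟨fun r hr => by rw [hval r (hr.2.trans hs.1), hX.1 r hr], fun r hr => ?_⟩, hres⟩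
  have hfirst : ∀ r ∈ Icc γ.1.time s, X'.1.1 r = γ.1 γ.1.time + ∫ σ in γ.1.time..r,
      F (X'.1.restrict σ) (if σ ≤ s then u σ else u' σ) := fun r hr => by
    rw [hval r hr.2, hX.2 r ⟨hr.1, hr.2.trans hs.2⟩]
    congr 1
    refine intervalIntegral.integral_congr fun σ hσ => ?_
    rw [uIcc_of_le hr.1] at hσ
    have h1 : σ ≤ s := hσ.2.trans hr.2
    simp only [if_pos h1, hres' σ h1]
  rcases le_total r s with h | h
  · exact hfirst r ⟨hr.1, h⟩
  · have h1 := hX'.2 r (by rw [hst]; exact ⟨h, hr.2⟩)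
    rw [hst, X.restrict_apply_of_le hs0 le_rfl, ← hval s le_rfl,
      hfirst s (right_mem_Icc.2 hs.1)] at h1
    have hi := hF.intervalIntegrable X'.1 hmeas
    rw [h1, ← intervalIntegral.integral_add_adjacent_intervals (hi γ.1.time s) (hi s r), add_assoc]
    congr 2
    -- At σ = s the concatenated control is still u; the half-open interval leaves this point out.
    rw [intervalIntegral.integral_of_le h, intervalIntegral.integral_of_le h]
    refine setIntegral_congr_fun measurableSet_Ioc fun σ hσ => ?_
    simp only [if_neg (not_le.2 hσ.1)]

/-- Dynamic programming: the upper bound. -/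
theorem valueFunctional_le_integral_add (hF : IsCoefficient L F) (hq : IsCoefficient L q)
    (hφ : IsTerminalCost L φ) {γ : ContPath T d} {u : ℝ → U} (hu : Measurable u)
    {X : TerminalPath T d} (hX : IsTrajectory F γ u X) {s : ℝ} (hs : s ∈ Icc γ.1.time T) :
    valueFunctional F q φ γ ≤
      (∫ σ in γ.1.time..s, q (X.1.restrict σ) (u σ)) + valueFunctional F q φ (X.1.restrict s) := by
  refine le_of_forall_pos_le_add fun ε hε => ?_
  have hs0 : s ∈ Icc 0 T := ⟨γ.1.time_nonneg.trans hs.1, hs.2⟩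
  obtain ⟨u', hu', X', hX', hc⟩ := exists_cost_lt (q := q) (φ := φ) hF (X.1.restrict s) hε
  obtain ⟨hX'', hres⟩ := hX.concat hF hs hu hX' hu'
  have hmeas : Measurable fun σ => if σ ≤ s then u σ else u' σ :=
    Measurable.ite measurableSet_Iic hu hu'
  have h1 := valueFunctional_le_cost hF hq hφ hmeas hX''
  rw [cost_split hq hmeas X' γ.1.time s] at h1
  rw [X.restrict_time hs0] at hc
  have h2 : ∫ σ in γ.1.time..s, q (X'.1.restrict σ) (if σ ≤ s then u σ else u' σ) =
      ∫ σ in γ.1.time..s, q (X.1.restrict σ) (u σ) := by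
    refine intervalIntegral.integral_congr fun σ hσ => ?_
    rw [uIcc_of_le hs.1] at hσ
    have : X'.1.restrict σ = X.1.restrict σ := by
      rw [← ContPath.restrict_restrict X'.1 (X'.mem_Icc hs0) hσ.2, hres,
        ContPath.restrict_restrict X.1 (X.mem_Icc hs0) hσ.2]
    simp only [if_pos hσ.2, this]
  have h3 : cost q φ s (fun σ => if σ ≤ s then u σ else u' σ) X' = cost q φ s u' X' := by
    simp only [cost]
    congr 1
    rw [intervalIntegral.integral_of_le hs.2, intervalIntegral.integral_of_le hs.2]
    refine setIntegral_congr_fun measurableSet_Ioc fun σ hσ => ?_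
    simp only [if_neg (not_le.2 hσ.1)]
  rw [h2, h3] at h1
  linarith

/-- Dynamic programming: nearly optimal controls. -/
theorem exists_integral_add_lt_valueFunctional (hF : IsCoefficient L F) (hq : IsCoefficient L q)
    (hφ : IsTerminalCost L φ) (γ : ContPath T d) {ε : ℝ} (hε : 0 < ε) :
    ∃ u : ℝ → U, Measurable u ∧ ∃ X, IsTrajectory F γ u X ∧ ∀ s ∈ Icc γ.1.time T,
      (∫ σ in γ.1.time..s, q (X.1.restrict σ) (u σ)) + valueFunctional F q φ (X.1.restrict s) <
        valueFunctional F q φ γ + ε := by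
  obtain ⟨u, hu, X, hX, hc⟩ := exists_cost_lt (q := q) (φ := φ) hF γ hε
  refine ⟨u, hu, X, hX, fun s hs => ?_⟩
  -- The tail of u is admissible from X_s for each s, so a single nearly optimal control serves all
  -- intermediate times.
  have h1 := valueFunctional_le_cost hF hq hφ hu (hX.restrict hF hu hs)
  rw [X.restrict_time ⟨γ.1.time_nonneg.trans hs.1, hs.2⟩] at h1
  rw [cost_split hq hu X γ.1.time s] at hc
  linarith

end

/-! ### First-order expansion of C¹ functionals along Lipschitz paths. -/

namespace CadlagPath

theorem extend_time (γ : CadlagPath T d) {s : ℝ} (hs : s ∈ Icc γ.time T) :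
    (γ.extend s).time = s := by
  change max γ.time (min s T) = s
  rw [min_eq_left hs.2, max_eq_right hs.1]

theorem extend_extend (γ : CadlagPath T d) {r s : ℝ} (hr : r ∈ Icc γ.time T) (hs : s ∈ Icc r T) :
    (γ.extend r).extend s = γ.extend s := by
  refine ext' ?_ rfl
  rw [extend_time _ (by rw [extend_time _ hr]; exact hs),
    extend_time _ ⟨hr.1.trans hs.1, hs.2⟩]

theorem extend_self (γ : CadlagPath T d) : γ.extend γ.time = γ :=
  ext' (extend_time γ ⟨le_rfl, γ.time_le⟩) rfl

theorem dist_extend (γ : CadlagPath T d) {r s : ℝ} (hr : r ∈ Icc γ.time T)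
    (hs : s ∈ Icc γ.time T) : dist (γ.extend r) (γ.extend s) = |r - s| := by
  rw [dist_def, extend_time _ hr, extend_time _ hs]
  have : (γ.extend r).supDist (γ.extend s) = 0 := by
    simp [supDist, extend]
  rw [this, add_zero]

theorem bump_apply (γ : CadlagPath T d) (x : Vec d) (s : ℝ) :
    γ.bump x s = if max 0 s < γ.time then γ s else γ s + x := rfl

theorem bump_bump (γ : CadlagPath T d) (x y : Vec d) : (γ.bump x).bump y = γ.bump (x + y) := by
  refine ext' rfl (funext fun s => ?_)
  change (if max 0 s < γ.time then (γ.bump x) s else (γ.bump x) s + y) = _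
  simp only [bump_apply]
  split_ifs
  · rfl
  · rw [add_assoc]

theorem bump_zero (γ : CadlagPath T d) : γ.bump 0 = γ := by
  refine ext' rfl (funext fun s => ?_)
  rw [bump_apply]
  simp

theorem norm_bump_sub_le (γ : CadlagPath T d) (x : Vec d) (s : ℝ) : ‖γ.bump x s - γ s‖ ≤ ‖x‖ := by
  rw [bump_apply]
  split_ifs <;> simp

end CadlagPath

namespace C1Functional

variable {t₀ : ℝ}

/-- Extending an extension is extending once, so `dt` is the right derivative of r ↦ f(γ_{t,r}).
Only one-sided derivatives are available; the mean value inequality for continuous functions with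
right derivatives applies. -/
theorem abs_extend_sub_le (f : C1Functional T d t₀) {γ : CadlagPath T d} (hγ : t₀ ≤ γ.time)
    {s a ε : ℝ} (hs : s ∈ Icc γ.time T) (h : ∀ r ∈ Ico γ.time s, |f.dt (γ.extend r) - a| ≤ ε) :
    |f.toFun (γ.extend s) - f.toFun γ - a * (s - γ.time)| ≤ ε * (s - γ.time) := by
  have hmem : ∀ r ∈ Icc γ.time s, r ∈ Icc γ.time T := fun r hr => ⟨hr.1, hr.2.trans hs.2⟩
  have hc : ContinuousOn (fun r => f.toFun (γ.extend r)) (Icc γ.time s) := by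
    refine f.continuousOn_toFun.comp ?_ fun r hr => ?_
    · refine (LipschitzOnWith.of_dist_le_mul (K := 1) fun r hr r' hr' => ?_).continuousOn
      rw [CadlagPath.dist_extend γ (hmem r hr) (hmem r' hr'), Real.dist_eq]
      simp
    · rw [mem_ofPred_eq, CadlagPath.extend_time γ (hmem r hr)]
      exact hγ.trans hr.1
  have hd : ∀ r ∈ Ico γ.time s, HasDerivWithinAt (fun r => f.toFun (γ.extend r) - a * r)
      (f.dt (γ.extend r) - a) (Ici r) r := by
    intro r hr
    have hr' := hmem r (Ico_subset_Icc_self hr)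
    have ht := CadlagPath.extend_time γ hr'
    have hrT : r < T := hr.2.trans_le hs.2
    have h1 := f.horizontal (γ.extend r) (by rw [ht]; exact hγ.trans hr.1) (by rw [ht]; exact hrT)
    rw [ht] at h1
    have h2 : HasDerivWithinAt (fun r => f.toFun (γ.extend r)) (f.dt (γ.extend r)) (Ici r) r := by
      rw [← hasDerivWithinAt_Ioi_iff_Ici, hasDerivWithinAt_iff_tendsto_slope' (by simp)]
      have hsh : Tendsto (fun x => x - r) (𝓝[>] r) (𝓝[>] 0) := by
        refine tendsto_nhdsWithin_iff.2 ⟨?_, ?_⟩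
        · have : Tendsto (fun x : ℝ => x - r) (𝓝 r) (𝓝 (r - r)) := by
            exact (continuous_sub_right r).tendsto r
          rw [sub_self] at this
          exact this.mono_left nhdsWithin_le_nhds
        · filter_upwards [self_mem_nhdsWithin] with x hx
          exact sub_pos.2 (mem_Ioi.1 hx)
      refine (h1.comp hsh).congr' ?_
      filter_upwards [Ioo_mem_nhdsGT hrT] with x hx
      rw [Function.comp_apply, add_sub_cancel, slope_def_field, one_div, inv_mul_eq_div,
        CadlagPath.extend_extend γ hr' ⟨hx.1.le, hx.2.le⟩]
    exact (h2.fun_sub ((hasDerivWithinAt_id r (Ici r)).const_mul a)).congr_deriv (by simp)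
  have := norm_image_sub_le_of_norm_deriv_right_le_segment
    (hc.fun_sub (by fun_prop : ContinuousOn (fun r => a * r) _)) hd h s (right_mem_Icc.2 hs.1)
  rw [CadlagPath.extend_self] at this
  rw [Real.norm_eq_abs] at this
  convert this using 2
  ring

/-- Only partial vertical derivatives are given, so the jump is made one coordinate at a time, with
the mean value inequality on each segment. All intermediate jumps have norm at most ∑|v_i|, whence
the radius in the hypothesis. -/
theorem abs_bump_sub_le (f : C1Functional T d t₀) {γ : CadlagPath T d} (hγ : t₀ ≤ γ.time)
    {v p : Vec d} {ε : ℝ}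
    (h : ∀ y : Vec d, ‖y‖ ≤ ∑ i, |v i| → ‖f.dx (γ.bump y) - p‖ ≤ ε) :
    |f.toFun (γ.bump v) - f.toFun γ - inner ℝ p v| ≤ ε * ∑ i, |v i| := by
  classical
  have key : ∀ S : Finset (Fin d),
      |f.toFun (γ.bump (∑ i ∈ S, v i • EuclideanSpace.single i (1 : ℝ))) - f.toFun γ -
        ∑ i ∈ S, p i * v i| ≤ ε * ∑ i ∈ S, |v i| := by
    intro S
    induction S using Finset.induction_on with
    | empty => simp [CadlagPath.bump_zero]
    | insert i S hi ih =>
      set x := ∑ i ∈ S, v i • EuclideanSpace.single i (1 : ℝ) with hx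
      set e : Vec d := EuclideanSpace.single i (1 : ℝ) with he
      have he1 : ‖e‖ = 1 := by simp [he]
      have hd : ∀ c : ℝ, HasDerivAt (fun c => f.toFun (γ.bump (x + c • e)) - p i * c)
          (f.dx (γ.bump (x + c • e)) i - p i) c := by
        intro c
        have h1 : HasDerivAt (fun c => f.toFun (γ.bump (x + c • e)))
            (f.dx (γ.bump (x + c • e)) i) c := by
          rw [hasDerivAt_iff_tendsto_slope_zero]
          refine (f.vertical (γ.bump (x + c • e)) hγ i).congr fun h => ?_
          rw [CadlagPath.bump_bump, one_div, smul_eq_mul, add_assoc, ← add_smul]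
        exact (h1.fun_sub ((hasDerivAt_id c).const_mul (p i))).congr_deriv (by simp)
      have hb : ∀ c ∈ uIcc 0 (v i), ‖f.dx (γ.bump (x + c • e)) i - p i‖ ≤ ε := by
        intro c hc
        have hc' : |c| ≤ |v i| := by simpa using abs_sub_left_of_mem_uIcc hc
        refine le_trans ?_ (h (x + c • e) ?_)
        · exact PiLp.norm_apply_le (f.dx (γ.bump (x + c • e)) - p) i
        · calc ‖x + c • e‖ ≤ ‖x‖ + ‖c • e‖ := norm_add_le _ _
            _ ≤ (∑ j ∈ S, |v j|) + |v i| := by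
              refine add_le_add ((norm_sum_le _ _).trans (Finset.sum_le_sum fun j _ => ?_)) ?_
              · simp [norm_smul]
              · simpa [norm_smul, he1] using hc'
            _ = ∑ j ∈ insert i S, |v j| := by rw [Finset.sum_insert hi, add_comm]
            _ ≤ ∑ j, |v j| := Finset.sum_le_sum_of_subset_of_nonneg (Finset.subset_univ _)
              fun _ _ _ => abs_nonneg _
      have h2 := (convex_uIcc (0 : ℝ) (v i)).norm_image_sub_le_of_norm_hasDerivWithin_le
        (fun c _ => (hd c).hasDerivWithinAt) hb left_mem_uIcc right_mem_uIcc
      simp only [zero_smul, add_zero, mul_zero, sub_zero, Real.norm_eq_abs] at h2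
      rw [Finset.sum_insert hi, Finset.sum_insert hi, Finset.sum_insert hi, ← hx, add_comm _ x]
      rw [abs_le] at h2 ih ⊢
      constructor <;> linarith [h2.1, h2.2, ih.1, ih.2]
  have h1 := key Finset.univ
  have h2 : ∑ i, v i • EuclideanSpace.single i (1 : ℝ) = v := by
    ext j
    simp [Finset.sum_apply, Pi.single_apply]
  have h3 : ∑ i, p i * v i = inner ℝ p v := by
    simp [PiLp.inner_apply, mul_comm]
  rwa [h2, h3] at h1

/-- One step of a piecewise constant path: wait until time `s`, then jump by `v`. -/
theorem abs_extend_bump_sub_le (f : C1Functional T d t₀) {γ : CadlagPath T d} (hγ : t₀ ≤ γ.time)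
    {s a ε : ℝ} {v p : Vec d} (hs : s ∈ Icc γ.time T)
    (h : ∀ r ∈ Ico γ.time s, |f.dt (γ.extend r) - a| ≤ ε)
    (h' : ∀ y : Vec d, ‖y‖ ≤ ∑ i, |v i| → ‖f.dx ((γ.extend s).bump y) - p‖ ≤ ε) :
    |f.toFun ((γ.extend s).bump v) - f.toFun γ - (a * (s - γ.time) + inner ℝ p v)| ≤
      ε * (s - γ.time + ∑ i, |v i|) := by
  have h1 := f.abs_extend_sub_le hγ hs h
  have h2 := f.abs_bump_sub_le (γ := γ.extend s)
    (by rw [CadlagPath.extend_time _ hs]; exact hγ.trans hs.1) h'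
  rw [abs_le] at h1 h2 ⊢
  constructor <;> linarith [h1.1, h1.2, h2.1, h2.2]

/-- The piecewise constant approximation, with time step `τ`, of the increments of `X` after the
end of the path `γ`. -/
def stepPath (γ : CadlagPath T d) (X : ℝ → Vec d) (τ : ℝ) : ℕ → CadlagPath T d
  | 0 => γ
  | k + 1 => ((stepPath γ X τ k).extend (γ.time + (k + 1) * τ)).bump
      (X (γ.time + (k + 1) * τ) - X (γ.time + k * τ))

/-- Between grid times the step path waits at the last grid value of X, which moves by at most Kτ in
the meantime. The uniform distance to the stopped path X is therefore of order τ, including at the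
jumps. -/
theorem stepPath_spec {γ : CadlagPath T d} {X : ℝ → Vec d} {τ K : ℝ} (hτ : 0 < τ) (hK : 0 ≤ K)
    (hX : ∀ s ≤ γ.time, X s = γ s)
    (hlip : ∀ s ∈ Icc γ.time T, ∀ r ∈ Icc γ.time T, ‖X s - X r‖ ≤ K * |s - r|) {k : ℕ}
    (hk : γ.time + k * τ ≤ T) :
    (stepPath γ X τ k).time = γ.time + k * τ ∧
      (∀ r, γ.time + k * τ ≤ r → stepPath γ X τ k r = X (γ.time + k * τ)) ∧
      ∀ r, ‖stepPath γ X τ k r - X (min r (γ.time + k * τ))‖ ≤ K * τ := by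
  have h0 := γ.time_nonneg
  induction k with
  | zero =>
    refine ⟨by simp [stepPath], fun r hr => ?_, fun r => ?_⟩
    · simp only [stepPath, Nat.cast_zero, zero_mul, add_zero] at hr ⊢
      rw [hX _ le_rfl, γ.apply_of_time_le hr]
    · have h1 : γ r = γ (min r γ.time) := by
        rcases le_total r γ.time with h | h
        · rw [min_eq_left h]
        · rw [min_eq_right h, γ.apply_of_time_le h]
      simp only [stepPath, Nat.cast_zero, zero_mul, add_zero]
      rw [hX _ (min_le_right _ _), ← h1, sub_self, norm_zero]
      positivity
  | succ k ih =>
    push_cast at hk ⊢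
    have hkτ : 0 ≤ (k : ℝ) * τ := by positivity
    have hk1 : γ.time + k * τ ≤ T := by linarith
    obtain ⟨iht, ihv, ihd⟩ := ih hk1
    have hmem : γ.time + (k + 1) * τ ∈ Icc (stepPath γ X τ k).time T := by
      rw [iht]; exact ⟨by linarith, hk⟩
    have ht : ((stepPath γ X τ k).extend (γ.time + (k + 1) * τ)).time =
      γ.time + (k + 1) * τ := CadlagPath.extend_time _ hmem
    have hval : ∀ r, stepPath γ X τ (k + 1) r = if max 0 r < γ.time + (k + 1) * τ then
        stepPath γ X τ k r else
        stepPath γ X τ k r + (X (γ.time + (k + 1) * τ) - X (γ.time + k * τ)) := fun r => by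
      have h1 : stepPath γ X τ (k + 1) r =
          if max 0 r < ((stepPath γ X τ k).extend (γ.time + (k + 1) * τ)).time then
            stepPath γ X τ k r
          else stepPath γ X τ k r + (X (γ.time + (k + 1) * τ) - X (γ.time + k * τ)) := rfl
      rw [h1, ht]
    have hlate : ∀ r, γ.time + (k + 1) * τ ≤ r →
        stepPath γ X τ (k + 1) r = X (γ.time + (k + 1) * τ) := fun r hr => by
      rw [hval, if_neg (not_lt.2 (hr.trans (le_max_right _ _))), ihv r (by linarith)]
      abel
    refine ⟨ht, hlate, fun r => ?_⟩
    rcases lt_or_ge r (γ.time + (k + 1) * τ) with h | h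
    · rw [hval, if_pos (max_lt (by linarith) h), min_eq_left h.le]
      rcases le_total r (γ.time + k * τ) with h' | h'
      · have := ihd r
        rwa [min_eq_left h'] at this
      · rw [ihv r h']
        refine (hlip _ ⟨by linarith, hk1⟩ _ ⟨by linarith, by linarith⟩).trans
          (mul_le_mul_of_nonneg_left ?_ hK)
        rw [abs_sub_comm, abs_of_nonneg (by linarith)]
        linarith
    · rw [hlate r h, min_eq_right h, sub_self, norm_zero]
      positivity

theorem sum_abs_le (v : Vec d) : ∑ i, |v i| ≤ d * ‖v‖ := by
  calc ∑ i, |v i| ≤ ∑ _i : Fin d, ‖v‖ := Finset.sum_le_sum fun i _ => PiLp.norm_apply_le v i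
    _ = d * ‖v‖ := by simp

/-- The first-order expansion of a `C¹` functional along Lipschitz extensions of a path. -/
theorem exists_expansion (f : C1Functional T d t₀) {γ : ContPath T d} (hγ : t₀ ≤ γ.1.time)
    (hγT : γ.1.time < T) {K ε : ℝ} (hK : 0 ≤ K) (hε : 0 < ε) :
    ∃ h₀ > 0, ∀ X : TerminalPath T d, (∀ s ≤ γ.1.time, X.1.1 s = γ.1 s) →
      (∀ s ∈ Icc γ.1.time T, ∀ r ∈ Icc γ.1.time T, ‖X.1.1 s - X.1.1 r‖ ≤ K * |s - r|) →
      ∀ h ∈ Ioc 0 h₀, |f.toFun (X.1.restrict (γ.1.time + h)).1 - f.toFun γ.1 -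
        (f.dt γ.1 * h + inner ℝ (f.dx γ.1) (X.1.1 (γ.1.time + h) - X.1.1 γ.1.time))| ≤ ε * h := by
  set t := γ.1.time with ht
  have hγ0 : 0 ≤ t := γ.1.time_nonneg
  -- A step of length τ contributes an error ε₁(τ + ∑|v_i|) ≤ ε₁(1 + dK)τ, because ∑|v_i| ≤ d‖v‖ ≤
  -- dKτ.
  set ε₁ := ε / (1 + d * K) with hε₁
  have hε₁0 : 0 < ε₁ := by positivity
  obtain ⟨δ₁, hδ₁, hdt⟩ := Metric.continuousOn_iff.1 f.continuousOn_dt γ.1 hγ ε₁ hε₁0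
  obtain ⟨δ₂, hδ₂, hdx⟩ := Metric.continuousOn_iff.1 f.continuousOn_dx γ.1 hγ ε₁ hε₁0
  -- Every intermediate path is within Ah of γ in d_∞: h for the final time, Kτ + Kh for the step
  -- path, dKτ for a partial jump, where τ ≤ h.
  set A := 1 + 2 * K + d * K with hA
  have hA0 : 0 < A := by positivity
  refine ⟨min (T - t) (min δ₁ δ₂ / (2 * A)), lt_min (by linarith) (by positivity),
    fun X hX hlip h hh => ?_⟩
  have hh0 : 0 < h := hh.1
  have hhT : t + h ≤ T := by linarith [hh.2.trans (min_le_left _ _)]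
  have hhA : h * A < min δ₁ δ₂ := by
    have h1 := hh.2.trans (min_le_right _ _)
    rw [le_div_iff₀ (by positivity)] at h1
    have : 0 < h * A := by positivity
    linarith
  have hthm : t + h ∈ Icc 0 T := ⟨by linarith, hhT⟩
  have hXt : ∀ s ∈ Icc t (t + h), ‖X.1.1 s - γ.1 s‖ ≤ K * h := fun s hs => by
    rw [γ.1.apply_of_time_le hs.1, ← hX t le_rfl]
    refine (hlip s ⟨hs.1, hs.2.trans hhT⟩ t ⟨le_rfl, hγT.le⟩).trans
      (mul_le_mul_of_nonneg_left ?_ hK)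
    rw [abs_of_nonneg (by linarith [hs.1])]
    linarith [hs.2]
  have hXγ : ∀ s, ∀ r ∈ Icc t (t + h), ‖X.1.1 (min s r) - γ.1 s‖ ≤ K * h := by
    intro s r hr
    rcases le_total s t with hs | hs
    · rw [min_eq_left (hs.trans hr.1), hX s hs, sub_self, norm_zero]
      positivity
    · have := hXt (min s r) ⟨le_min hs hr.1, (min_le_right _ _).trans hr.2⟩
      rwa [γ.1.apply_of_time_le (le_min hs hr.1), ← γ.1.apply_of_time_le hs] at this
  -- The errors of the steps add up to a bound proportional to the elapsed time, uniformly in the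
  -- number n of steps.
  have key : ∀ n : ℕ, 0 < n → ∀ k ≤ n,
      |f.toFun (stepPath γ.1 X.1.1 (h / n) k) - f.toFun γ.1 - (f.dt γ.1 * (k * (h / n)) +
        inner ℝ (f.dx γ.1) (X.1.1 (t + k * (h / n)) - X.1.1 t))| ≤
        ε₁ * (1 + d * K) * (k * (h / n)) := by
    intro n hn k hk
    set τ := h / n with hτ
    have hn0 : (0 : ℝ) < n := Nat.cast_pos.2 hn
    have hτ0 : 0 < τ := by positivity
    have hτh : τ ≤ h := div_le_self hh0.le (by exact_mod_cast hn)
    have hkh : ∀ k ≤ n, (k : ℝ) * τ ≤ h := fun k hk => by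
      rw [hτ, ← mul_div_assoc, div_le_iff₀ hn0, mul_comm]
      exact mul_le_mul_of_nonneg_left (by exact_mod_cast hk) hh0.le
    induction k with
    | zero => simp [stepPath]
    | succ k ih =>
      have ih := ih (by omega)
      have hk1 := hkh (k + 1) hk
      push_cast at hk1 ⊢
      have hkτ : 0 ≤ (k : ℝ) * τ := by positivity
      obtain ⟨st, sv, sd⟩ := stepPath_spec hτ0 hK hX hlip (k := k) (by linarith)
      set ζ := stepPath γ.1 X.1.1 τ k with hζ
      rw [← ht] at st sv sd
      have hζγ : ∀ s, ‖ζ s - γ.1 s‖ ≤ K * τ + K * h := fun s =>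
        (norm_sub_le_norm_sub_add_norm_sub _ _ _).trans
          (add_le_add (sd s) (hXγ s _ ⟨by linarith, by linarith⟩))
      have hstep : t + (k + 1) * τ ∈ Icc ζ.time T := ⟨by linarith, by linarith⟩
      set v := X.1.1 (t + (k + 1) * τ) - X.1.1 (t + k * τ) with hv
      have hvn : ‖v‖ ≤ K * τ := by
        refine (hlip _ ⟨by linarith, by linarith⟩ _ ⟨by linarith, by linarith⟩).trans_eq ?_
        rw [show t + (k + 1) * τ - (t + k * τ) = τ by ring, abs_of_pos hτ0]
      have hvs : ∑ i, |v i| ≤ d * K * τ := by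
        rw [mul_assoc]
        exact (sum_abs_le v).trans (mul_le_mul_of_nonneg_left hvn (Nat.cast_nonneg d))
      have hτK := mul_le_mul_of_nonneg_left hτh hK
      have hτdK := mul_le_mul_of_nonneg_left hτh (show 0 ≤ d * K by positivity)
      have hAh : h * A = h + 2 * (K * h) + d * K * h := by rw [hA]; ring
      have hdK : 0 ≤ d * K * h := by positivity
      have hfar : ∀ r ∈ Icc ζ.time (t + (k + 1) * τ), ∀ y : Vec d, ‖y‖ ≤ ∑ i, |v i| →
          dist ((ζ.extend r).bump y) γ.1 < min δ₁ δ₂ := by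
        intro r hr y hy
        have hrm : r ∈ Icc ζ.time T := ⟨hr.1, hr.2.trans hstep.2⟩
        rw [CadlagPath.dist_def]
        have h1 : |((ζ.extend r).bump y).time - γ.1.time| ≤ h := by
          change |(ζ.extend r).time - t| ≤ h
          rw [CadlagPath.extend_time _ hrm, abs_of_nonneg (by linarith [hr.1])]
          linarith [hr.2]
        have h2 : ((ζ.extend r).bump y).supDist γ.1 ≤ d * K * τ + (K * τ + K * h) :=
          CadlagPath.supDist_le fun s _ => (norm_sub_le_norm_sub_add_norm_sub _ (ζ s) _).trans
            (add_le_add (((ζ.extend r).norm_bump_sub_le y s).trans (hy.trans hvs)) (hζγ s))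
        linarith
      have hsum0 : (0 : ℝ) ≤ ∑ i, |v i| := Finset.sum_nonneg fun _ _ => abs_nonneg _
      have hone := f.abs_extend_bump_sub_le (γ := ζ) (s := t + (k + 1) * τ) (a := f.dt γ.1)
        (ε := ε₁) (v := v) (p := f.dx γ.1) (by rw [st]; linarith) hstep (fun r hr => by
          have hrm : r ∈ Icc ζ.time T := ⟨hr.1, hr.2.le.trans hstep.2⟩
          have h1 := hfar r ⟨hr.1, hr.2.le⟩ 0 (by simpa using hsum0)
          rw [CadlagPath.bump_zero] at h1
          have h2 := hdt (ζ.extend r) (by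
            rw [mem_ofPred_eq, CadlagPath.extend_time _ hrm]; linarith [hr.1])
            (h1.trans_le (min_le_left _ _))
          rw [Real.dist_eq] at h2
          exact h2.le) (fun y hy => by
          have h1 := hfar _ ⟨hstep.1, le_rfl⟩ y hy
          have h2 := hdx ((ζ.extend (t + (k + 1) * τ)).bump y) (by
            change t₀ ≤ (ζ.extend _).time
            rw [CadlagPath.extend_time _ hstep]; linarith [hstep.1])
            (h1.trans_le (min_le_right _ _))
          rw [dist_eq_norm] at h2
          exact h2.le)
      have hnext : stepPath γ.1 X.1.1 τ (k + 1) = (ζ.extend (t + (k + 1) * τ)).bump v := rfl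
      rw [hnext]
      have hinner : inner ℝ (f.dx γ.1) (X.1.1 (t + (k + 1) * τ) - X.1.1 t) =
          inner ℝ (f.dx γ.1) (X.1.1 (t + k * τ) - X.1.1 t) + inner ℝ (f.dx γ.1) v := by
        rw [← inner_add_right, hv]
        congr 1
        abel
      have hmul : ε₁ * (t + (k + 1) * τ - ζ.time + ∑ i, |v i|) ≤ ε₁ * (1 + d * K) * τ := by
        rw [mul_assoc]
        refine mul_le_mul_of_nonneg_left ?_ hε₁0.le
        rw [st]
        linarith
      rw [hinner]
      rw [st] at hone
      rw [st] at hmul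
      rw [abs_le] at hone ih ⊢
      constructor <;> linarith [hone.1, hone.2, ih.1, ih.2]
  -- As n → ∞ the step paths, which end at the same time as X restricted to t + h, converge to it in
  -- d_∞, and f is continuous.
  have hlim : Tendsto (fun n : ℕ => f.toFun (stepPath γ.1 X.1.1 (h / n) n)) atTop
      (𝓝 (f.toFun (X.1.restrict (t + h)).1)) := by
    have hXth := X.restrict_time hthm
    have hcw := f.continuousOn_toFun (X.1.restrict (t + h)).1
      (by rw [mem_ofPred_eq, hXth]; linarith)
    refine hcw.tendsto.comp (tendsto_nhdsWithin_iff.2 ⟨?_, ?_⟩)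
    · rw [tendsto_iff_dist_tendsto_zero]
      have hz : Tendsto (fun n : ℕ => K * (h / n)) atTop (𝓝 0) := by
        simpa using (tendsto_const_div_atTop_nhds_zero_nat h).const_mul K
      refine squeeze_zero' (Eventually.of_forall fun _ => dist_nonneg) ?_ hz
      filter_upwards [eventually_gt_atTop 0] with n hn
      have hn0 : (0 : ℝ) < n := Nat.cast_pos.2 hn
      have hnh : (n : ℝ) * (h / n) = h := by field_simp
      obtain ⟨st, -, sd⟩ := stepPath_spec (τ := h / n) (by positivity) hK hX hlip (k := n)
        (by rw [hnh]; exact hhT)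
      rw [hnh] at st sd
      rw [CadlagPath.dist_of_time_eq (st.trans hXth.symm)]
      refine CadlagPath.supDist_le fun s _ => ?_
      rw [ContPath.restrict_apply X.1 (X.mem_Icc hthm)]
      exact sd s
    · filter_upwards [eventually_gt_atTop 0] with n hn
      have hn0 : (0 : ℝ) < n := Nat.cast_pos.2 hn
      have hnh : (n : ℝ) * (h / n) = h := by field_simp
      obtain ⟨st, -, -⟩ := stepPath_spec (τ := h / n) (by positivity) hK hX hlip (k := n)
        (by rw [hnh]; exact hhT)
      rw [st, hnh]
      linarith
  refine le_of_tendsto ((hlim.sub_const _).sub_const _).abs ?_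
  filter_upwards [eventually_gt_atTop 0] with n hn
  have hn0 : (0 : ℝ) < n := Nat.cast_pos.2 hn
  have hnh : (n : ℝ) * (h / n) = h := by field_simp
  have h1 := key n hn n le_rfl
  rw [hnh] at h1
  refine h1.trans_eq ?_
  rw [hε₁, div_mul_cancel₀ _ (by positivity)]

end C1Functional

/-! ### The value functional is a viscosity solution. -/

section

variable [TopologicalSpace U] {F : ContPath T d → U → EuclideanSpace ℝ (Fin d)}
  {q : ContPath T d → U → ℝ} {φ : TerminalPath T d → ℝ} {L : ℝ}

theorem IsCoefficient.inner_add (hF : IsCoefficient L F) (hq : IsCoefficient L q) (p : Vec d) :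
    IsCoefficient ((‖p‖ + 1) * L) fun γ u => inner ℝ p (F γ u) + q γ u := by
  have hL := hF.nonneg
  have hp := norm_nonneg p
  have hsub : ∀ γ η u, ‖(inner ℝ p (F γ u) + q γ u) - (inner ℝ p (F η u) + q η u)‖ ≤
      ‖p‖ * ‖F γ u - F η u‖ + ‖q γ u - q η u‖ := fun γ η u => by
    rw [add_sub_add_comm, ← inner_sub_right]
    exact (norm_add_le _ _).trans (add_le_add (norm_inner_le_norm _ _) le_rfl)
  refine ⟨by positivity, (continuous_const.inner hF.continuous).add hq.continuous,
    fun γ ε hε => ?_, fun γ η h u => ?_, fun γ u => ?_⟩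
  · obtain ⟨δ₁, h1, h1'⟩ := hF.uniform γ (ε / (‖p‖ + 1)) (by positivity)
    obtain ⟨δ₂, h2, h2'⟩ := hq.uniform γ (ε / (‖p‖ + 1)) (by positivity)
    refine ⟨min δ₁ δ₂, lt_min h1 h2, fun η hη u => (hsub η γ u).trans ?_⟩
    have h3 := h1' η (hη.trans_le (min_le_left _ _)) u
    have h4 := h2' η (hη.trans_le (min_le_right _ _)) u
    calc _ ≤ ‖p‖ * (ε / (‖p‖ + 1)) + ε / (‖p‖ + 1) :=
          add_le_add (mul_le_mul_of_nonneg_left h3 hp) h4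
      _ = ε := by field_simp
  · refine (hsub γ η u).trans ?_
    have h3 := mul_le_mul_of_nonneg_left (hF.lipschitz γ η h u) hp
    have h4 := hq.lipschitz γ η h u
    linarith
  · have h3 := mul_le_mul_of_nonneg_left (hF.growth γ u) hp
    have h4 := hq.growth γ u
    calc _ ≤ ‖inner ℝ p (F γ u)‖ + ‖q γ u‖ := norm_add_le _ _
      _ ≤ ‖p‖ * ‖F γ u‖ + ‖q γ u‖ := add_le_add (norm_inner_le_norm _ _) le_rfl
      _ ≤ _ := by linarith

theorem hamiltonian_le (hF : IsCoefficient L F) (hq : IsCoefficient L q) (γ : ContPath T d)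
    (p : Vec d) (v : U) : hamiltonian F q γ p ≤ inner ℝ p (F γ v) + q γ v := by
  refine ciInf_le ⟨-((‖p‖ + 1) * L * (1 + γ.1.supNorm)), ?_⟩ v
  rintro _ ⟨u, rfl⟩
  exact (abs_le.1 ((hF.inner_add hq p).growth γ u)).1

variable [MeasurableSpace U] [BorelSpace U]

theorem IsTrajectory.inner_sub (hF : IsCoefficient L F) {γ : ContPath T d} {X : TerminalPath T d}
    {u : ℝ → U} (hu : Measurable u) (hX : IsTrajectory F γ u X) (p : Vec d) {s r : ℝ}
    (hs : s ∈ Icc γ.1.time T) (hr : r ∈ Icc γ.1.time T) :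
    inner ℝ p (X.1.1 r - X.1.1 s) = ∫ σ in s..r, inner ℝ p (F (X.1.restrict σ) (u σ)) := by
  rw [hX.eq_add_integral hF hu hs hr, add_sub_cancel_left]
  exact ((innerSL ℝ p).intervalIntegral_comp_comm (hF.intervalIntegrable X.1 hu s r)).symm

theorem IsTrajectory.integral_add_inner (hF : IsCoefficient L F) (hq : IsCoefficient L q)
    {γ : ContPath T d} {X : TerminalPath T d} {u : ℝ → U} (hu : Measurable u)
    (hX : IsTrajectory F γ u X) (p : Vec d) {s r : ℝ} (hs : s ∈ Icc γ.1.time T)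
    (hr : r ∈ Icc γ.1.time T) :
    (∫ σ in s..r, (inner ℝ p (F (X.1.restrict σ) (u σ)) + q (X.1.restrict σ) (u σ))) =
      inner ℝ p (X.1.1 r - X.1.1 s) + ∫ σ in s..r, q (X.1.restrict σ) (u σ) := by
  rw [hX.inner_sub hF hu p hs hr, intervalIntegral.integral_add _ (hq.intervalIntegrable X.1 hu s r)]
  have h := hF.intervalIntegrable X.1 hu s r
  exact ⟨h.1.const_inner p, h.2.const_inner p⟩

theorem IsTrajectory.dist_restrict_le (hF : IsCoefficient L F) {γ : ContPath T d}
    {X : TerminalPath T d} {u : ℝ → U} (hu : Measurable u) (hX : IsTrajectory F γ u X) {s : ℝ}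
    (hs : s ∈ Icc γ.1.time T) :
    dist (X.1.restrict s) γ ≤
      (1 + L * ((1 + γ.1.supNorm) * Real.exp (L * T))) * (s - γ.1.time) := by
  have hs0 : s ∈ Icc 0 T := ⟨γ.1.time_nonneg.trans hs.1, hs.2⟩
  have hL := hF.nonneg
  have hγ0 := γ.1.supNorm_nonneg
  have hst : 0 ≤ s - γ.1.time := by linarith [hs.1]
  change dist (X.1.restrict s).1 γ.1 ≤ _
  rw [CadlagPath.dist_def, X.restrict_time hs0, abs_of_nonneg hst, add_mul, one_mul]
  refine add_le_add le_rfl (CadlagPath.supDist_le fun r hr => ?_)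
  rw [ContPath.restrict_apply X.1 (X.mem_Icc hs0)]
  rcases le_total r γ.1.time with h | h
  · rw [min_eq_left (h.trans hs.1), hX.1 r ⟨hr.1, h⟩, sub_self, norm_zero]
    positivity
  · rw [γ.1.apply_of_time_le h, ← hX.1 γ.1.time (right_mem_Icc.2 γ.1.time_nonneg)]
    refine (hX.norm_sub_le hF hu (left_mem_Icc.2 γ.1.time_le)
      ⟨le_min h hs.1, (min_le_right _ _).trans hs.2⟩).trans
      (mul_le_mul_of_nonneg_left ?_ (by positivity))
    rw [abs_of_nonneg (by linarith [le_min h hs.1])]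
    linarith [min_le_right r s]

/-- Along all trajectories, a coefficient is close to its initial value for a short time. -/
theorem exists_uniform_time {g : ContPath T d → U → ℝ} {L' : ℝ} (hF : IsCoefficient L F)
    (hg : IsCoefficient L' g) (γ : ContPath T d) {ε : ℝ} (hε : 0 < ε) :
    ∃ h₀ > 0, ∀ u : ℝ → U, Measurable u → ∀ X, IsTrajectory F γ u X → ∀ s ∈ Icc γ.1.time T,
      s ≤ γ.1.time + h₀ → ∀ v, |g (X.1.restrict s) v - g γ v| ≤ ε := by
  obtain ⟨δ, hδ, h⟩ := hg.uniform γ ε hε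
  have hL := hF.nonneg
  have hγ0 := γ.1.supNorm_nonneg
  set A := 1 + L * ((1 + γ.1.supNorm) * Real.exp (L * T)) with hA
  have hA0 : 0 < A := by positivity
  refine ⟨δ / (2 * A), by positivity, fun u hu X hX s hs hsh v => h _ ?_ v⟩
  refine (hX.dist_restrict_le hF hu hs).trans_lt ?_
  have h1 : A * (s - γ.1.time) ≤ A * (δ / (2 * A)) :=
    mul_le_mul_of_nonneg_left (by linarith) hA0.le
  have h2 : A * (δ / (2 * A)) = δ / 2 := by field_simp
  linarith

theorem norm_sub_le_of_glue {E : Type*} [NormedAddCommGroup E] {f : ℝ → E} {K a b t : ℝ}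
    (h1 : ∀ l r, a ≤ l → l < r → r ≤ t → ‖f l - f r‖ ≤ K * |l - r|)
    (h2 : ∀ l r, t ≤ l → l < r → r ≤ b → ‖f l - f r‖ ≤ K * |l - r|) :
    ∀ l r, a ≤ l → l < r → r ≤ b → ‖f l - f r‖ ≤ K * |l - r| := by
  intro l r hl hlr hr
  rcases le_or_gt r t with hrt | hrt
  · exact h1 l r hl hlr hrt
  rcases le_or_gt t l with hlt | hlt
  · exact h2 l r hlt hlr hr
  have h3 := h1 l t hl hlt le_rfl
  have h4 := h2 t r le_rfl hrt hr
  have h5 := norm_sub_le_norm_sub_add_norm_sub (f l) (f t) (f r)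
  rw [abs_sub_comm, abs_of_pos (by linarith)] at h3 h4 ⊢
  linarith

theorem restrict_mem_lipPaths {μ M₀ : ℝ} {γ : ContPath T d} (hγ : γ ∈ lipPaths T d μ 0 M₀)
    {X : TerminalPath T d} (hX : ∀ r ∈ Icc 0 γ.1.time, X.1.1 r = γ.1 r) {s : ℝ}
    (hs : s ∈ Icc γ.1.time T) (hb : ∀ r ∈ Icc γ.1.time s, ‖X.1.1 r‖ ≤ M₀)
    (hl : ∀ l r, γ.1.time ≤ l → l < r → r ≤ s → ‖X.1.1 l - X.1.1 r‖ ≤ μ * (1 + M₀) * |l - r|) :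
    X.1.restrict s ∈ lipPaths T d μ γ.1.time M₀ := by
  have hs0 : s ∈ Icc 0 T := ⟨γ.1.time_nonneg.trans hs.1, hs.2⟩
  obtain ⟨-, hγ2, hγ3⟩ := hγ
  refine ⟨by rw [X.restrict_time hs0]; exact hs.1, ?_, ?_⟩
  · refine CadlagPath.supNorm_restrict_le_of_le (X.mem_Icc hs0) fun r hr => ?_
    rcases le_total r γ.1.time with h | h
    · rw [hX r ⟨hr.1, h⟩]
      exact (γ.1.norm_le_supNorm r).trans hγ2
    · exact hb r ⟨h, hr.2⟩
  · intro l r hl0 hlr hr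
    rw [X.restrict_time hs0] at hr
    rw [X.restrict_apply_of_le hs0 (hlr.le.trans hr), X.restrict_apply_of_le hs0 hr]
    refine norm_sub_le_of_glue (fun l r h0 h1 h2 => ?_) hl l r hl0 hlr hr
    rw [hX l ⟨h0, h1.le.trans h2⟩, hX r ⟨h0.trans h1.le, h2⟩]
    exact hγ3 l r h0 h1 h2

/-- The strict inequality at the endpoint leaves room to move for a time governed by a speed bound
common to all controls. As long as the path is bounded by M₀, its speed is at most L(1 + M₀) ≤ μ(1 +
M₀), so the Lipschitz constraint is respected too. -/
theorem exists_restrict_mem_lipPaths (hF : IsCoefficient L F) {μ M₀ : ℝ} (hμ : L ≤ μ)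
    {γ : ContPath T d} (hγ : γ ∈ lipPaths T d μ 0 M₀) (hγM : ‖γ.1 γ.1.time‖ < M₀) :
    ∃ h₀ > 0, ∀ u : ℝ → U, Measurable u → ∀ X, IsTrajectory F γ u X → ∀ s ∈ Icc γ.1.time T,
      s ≤ γ.1.time + h₀ → X.1.restrict s ∈ lipPaths T d μ γ.1.time M₀ := by
  have hL := hF.nonneg
  have hγ0 := γ.1.supNorm_nonneg
  have hM0 : 0 ≤ M₀ := (norm_nonneg _).trans hγM.le
  set K := L * ((1 + γ.1.supNorm) * Real.exp (L * T)) with hK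
  have hK0 : 0 < K := by positivity
  refine ⟨(M₀ - ‖γ.1 γ.1.time‖) / K, div_pos (by linarith) hK0, fun u hu X hX s hs hsh => ?_⟩
  have hb : ∀ r ∈ Icc γ.1.time s, ‖X.1.1 r‖ ≤ M₀ := fun r hr => by
    have h1 := hX.norm_sub_le hF hu (left_mem_Icc.2 γ.1.time_le) ⟨hr.1, hr.2.trans hs.2⟩
    rw [hX.1 γ.1.time (right_mem_Icc.2 γ.1.time_nonneg), abs_of_nonneg (by linarith [hr.1])] at h1
    have h2 : K * (r - γ.1.time) ≤ M₀ - ‖γ.1 γ.1.time‖ := by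
      have h4 : r - γ.1.time ≤ (M₀ - ‖γ.1 γ.1.time‖) / K := by linarith [hr.2]
      rw [le_div_iff₀ hK0] at h4
      linarith
    have h3 := norm_le_norm_add_norm_sub (γ.1 γ.1.time) (X.1.1 r)
    rw [norm_sub_rev] at h3
    linarith
  refine restrict_mem_lipPaths hγ hX.1 hs hb fun l r hl hlr hr => ?_
  rw [norm_sub_rev, hX.eq_add_integral hF hu ⟨hl, (hlr.le.trans hr).trans hs.2⟩
    ⟨hl.trans hlr.le, hr.trans hs.2⟩, add_sub_cancel_left, abs_sub_comm l r]
  refine intervalIntegral.norm_integral_le_of_norm_le_const fun σ hσ => (hF.growth _ _).trans ?_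
  rw [uIoc_of_le hlr.le] at hσ
  have hσs : σ ≤ s := hσ.2.trans hr
  have h5 : (X.1.restrict σ).1.supNorm ≤ M₀ := by
    refine CadlagPath.supNorm_restrict_le_of_le
      (X.mem_Icc ⟨γ.1.time_nonneg.trans (hl.trans hσ.1.le), hσs.trans hs.2⟩) fun ρ hρ => ?_
    rcases le_total ρ γ.1.time with h | h
    · rw [hX.1 ρ ⟨hρ.1, h⟩]
      exact (γ.1.norm_le_supNorm ρ).trans hγ.2.1
    · exact hb ρ ⟨h, hρ.2.trans hσs⟩
  exact mul_le_mul hμ (by linarith) (by linarith [(X.1.restrict σ).1.supNorm_nonneg])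
    (hL.le.trans hμ)

variable [Nonempty U]

/-- For a constant control v, dynamic programming and f ≥ V on C^μ, with equality at γ, give 0 ≤ ∫ q
+ f(X_{t+h}) - f(γ). The expansion of f turns the right side into h(∂_t f + (∂_x f, F(γ,v)) +
q(γ,v)) up to εh. -/
theorem isMuSubsolution_valueFunctional (hF : IsCoefficient L F) (hq : IsCoefficient L q)
    (hφ : IsTerminalCost L φ) {μ : ℝ} (hμ : L ≤ μ) :
    IsMuSubsolution F q φ μ (valueFunctional F q φ) := by
  refine ⟨fun γ => (valueFunctional_terminal hF γ).le, fun M₀ _ γ hγ hγT hγM f hf => ?_⟩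
  obtain ⟨hf0, hflub⟩ := hf
  have hL := hF.nonneg
  have hγ0 := γ.1.supNorm_nonneg
  have hg := hF.inner_add hq (f.dx γ.1)
  suffices h : -f.dt γ.1 ≤ hamiltonian F q γ (f.dx γ.1) by linarith
  refine le_ciInf fun v => le_of_forall_pos_le_add fun ε hε => ?_
  obtain ⟨X, hX⟩ := exists_isTrajectory hF γ (measurable_const (a := v))
  obtain ⟨h₁, hh₁, H₁⟩ := exists_restrict_mem_lipPaths hF hμ hγ hγM
  obtain ⟨h₂, hh₂, H₂⟩ := exists_uniform_time hF hg γ (half_pos hε)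
  obtain ⟨h₃, hh₃, H₃⟩ := f.exists_expansion le_rfl hγT
    (K := L * ((1 + γ.1.supNorm) * Real.exp (L * T))) (by positivity) (half_pos hε)
  set h := min (T - γ.1.time) (min h₁ (min h₂ h₃)) with hh
  have hh0 : 0 < h := by
    have : 0 < T - γ.1.time := by linarith
    positivity
  have hs : γ.1.time + h ∈ Icc γ.1.time T :=
    ⟨by linarith, by linarith [min_le_left (T - γ.1.time) (min h₁ (min h₂ h₃))]⟩
  have hle := min_le_right (T - γ.1.time) (min h₁ (min h₂ h₃))
  have hle1 : h ≤ h₁ := hle.trans (min_le_left _ _)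
  have hle2 : h ≤ h₂ := hle.trans ((min_le_right _ _).trans (min_le_left _ _))
  have hle3 : h ≤ h₃ := hle.trans ((min_le_right _ _).trans (min_le_right _ _))
  have hmem := H₁ _ measurable_const X hX _ hs (by linarith)
  have h1 := hflub.1 ⟨_, hmem, rfl⟩
  have h2 := valueFunctional_le_integral_add hF hq hφ measurable_const hX hs
  have h3 := H₃ X (fun s hs => ?_) (fun s hs r hr => hX.norm_sub_le hF measurable_const hr hs) h
    ⟨hh0, hle3⟩
  · have h4 := hX.integral_add_inner hF hq measurable_const (f.dx γ.1)
      (left_mem_Icc.2 γ.1.time_le) hs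
    have h5 : (∫ σ in γ.1.time..γ.1.time + h,
        (inner ℝ (f.dx γ.1) (F (X.1.restrict σ) v) + q (X.1.restrict σ) v)) ≤
        ∫ _σ in γ.1.time..γ.1.time + h, (inner ℝ (f.dx γ.1) (F γ v) + q γ v + ε / 2) := by
      refine intervalIntegral.integral_mono_on hs.1 (hg.intervalIntegrable X.1 measurable_const _ _)
        intervalIntegrable_const fun σ hσ => ?_
      have := (abs_le.1 (H₂ _ measurable_const X hX σ ⟨hσ.1, hσ.2.trans hs.2⟩
        (by linarith [hσ.2]) v)).2
      linarith
    rw [intervalIntegral.integral_const, smul_eq_mul, add_sub_cancel_left] at h5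
    simp only [] at h1
    have h6 : 0 ≤ h * (f.dt γ.1 + (inner ℝ (f.dx γ.1) (F γ v) + q γ v + ε)) := by
      have := (abs_le.1 h3).2
      linarith
    have := nonneg_of_mul_nonneg_right h6 hh0
    linarith
  · rcases le_total 0 s with h0 | h0
    · exact hX.1 s ⟨h0, hs⟩
    · rw [X.1.1.apply_of_nonpos h0, γ.1.apply_of_nonpos h0,
        hX.1 0 ⟨le_rfl, γ.1.time_nonneg⟩]

/-- The same computation along nearly optimal controls, with the Hamiltonian as a lower bound for
the integrand at each time. -/
theorem isMuSupersolution_valueFunctional (hF : IsCoefficient L F) (hq : IsCoefficient L q)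
    (hφ : IsTerminalCost L φ) {μ : ℝ} (hμ : L ≤ μ) :
    IsMuSupersolution F q φ μ (valueFunctional F q φ) := by
  refine ⟨fun γ => (valueFunctional_terminal hF γ).ge, fun M₀ _ γ hγ hγT hγM f hf => ?_⟩
  obtain ⟨hf0, hfglb⟩ := hf
  have hL := hF.nonneg
  have hγ0 := γ.1.supNorm_nonneg
  have hg := hF.inner_add hq (-f.dx γ.1)
  refine le_of_forall_pos_le_add fun ε hε => ?_
  obtain ⟨h₁, hh₁, H₁⟩ := exists_restrict_mem_lipPaths hF hμ hγ hγM
  obtain ⟨h₂, hh₂, H₂⟩ := exists_uniform_time hF hg γ (show 0 < ε / 3 by positivity)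
  obtain ⟨h₃, hh₃, H₃⟩ := f.exists_expansion le_rfl hγT
    (K := L * ((1 + γ.1.supNorm) * Real.exp (L * T))) (by positivity) (show 0 < ε / 3 by positivity)
  set h := min (T - γ.1.time) (min h₁ (min h₂ h₃)) with hh
  have hh0 : 0 < h := by
    have : 0 < T - γ.1.time := by linarith
    positivity
  have hs : γ.1.time + h ∈ Icc γ.1.time T :=
    ⟨by linarith, by linarith [min_le_left (T - γ.1.time) (min h₁ (min h₂ h₃))]⟩
  have hle := min_le_right (T - γ.1.time) (min h₁ (min h₂ h₃))
  have hle1 : h ≤ h₁ := hle.trans (min_le_left _ _)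
  have hle2 : h ≤ h₂ := hle.trans ((min_le_right _ _).trans (min_le_left _ _))
  have hle3 : h ≤ h₃ := hle.trans ((min_le_right _ _).trans (min_le_right _ _))
  -- The optimality error must be small compared with h, so the control depends on h. This is why h
  -- was fixed beforehand by estimates uniform over all controls.
  obtain ⟨u, hu, X, hX, hopt⟩ := exists_integral_add_lt_valueFunctional hF hq hφ γ
    (show 0 < ε / 3 * h by positivity)
  have hmem := H₁ u hu X hX _ hs (by linarith)
  have h1 := hfglb.1 ⟨_, hmem, rfl⟩
  have h2 := hopt _ hs
  have h3 := H₃ X (fun s hs => ?_) (fun s hs r hr => hX.norm_sub_le hF hu hr hs) h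
    ⟨hh0, hle3⟩
  · have h4 := hX.integral_add_inner hF hq hu (-f.dx γ.1) (left_mem_Icc.2 γ.1.time_le) hs
    have h5 : (∫ _σ in γ.1.time..γ.1.time + h, (hamiltonian F q γ (-f.dx γ.1) - ε / 3)) ≤
        ∫ σ in γ.1.time..γ.1.time + h,
        (inner ℝ (-f.dx γ.1) (F (X.1.restrict σ) (u σ)) + q (X.1.restrict σ) (u σ)) := by
      refine intervalIntegral.integral_mono_on hs.1 intervalIntegrable_const
        (hg.intervalIntegrable X.1 hu _ _) fun σ hσ => ?_
      have h6 := (abs_le.1 (H₂ u hu X hX σ ⟨hσ.1, hσ.2.trans hs.2⟩ (by linarith [hσ.2]) (u σ))).1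
      have h7 := hamiltonian_le hF hq γ (-f.dx γ.1) (u σ)
      linarith
    rw [intervalIntegral.integral_const, smul_eq_mul, add_sub_cancel_left] at h5
    rw [inner_neg_left] at h4
    simp only [] at h1
    have h6 : h * (-f.dt γ.1 + hamiltonian F q γ (-f.dx γ.1)) ≤ h * (0 + ε) := by
      have := (abs_le.1 h3).2
      linarith
    exact le_of_mul_le_mul_left h6 hh0
  · rcases le_total 0 s with h0 | h0
    · exact hX.1 s ⟨h0, hs⟩
    · rw [X.1.1.apply_of_nonpos h0, γ.1.apply_of_nonpos h0,
        hX.1 0 ⟨le_rfl, γ.1.time_nonneg⟩]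

theorem isViscositySolution_valueFunctional (hF : IsCoefficient L F) (hq : IsCoefficient L q)
    (hφ : IsTerminalCost L φ) (hT : 0 < T) :
    IsViscositySolution F q φ (valueFunctional F q φ) :=
  ⟨(inUniquenessClass_valueFunctional hF hq hφ hT).continuous,
    ⟨L, hF.nonneg, fun _ hμ => isMuSubsolution_valueFunctional hF hq hφ hμ⟩,
    ⟨L, hF.nonneg, fun _ hμ => isMuSupersolution_valueFunctional hF hq hφ hμ⟩⟩

end

/-! ### Test functionals that penalize the distance to a moving target. -/

namespace CadlagPath

/-- By right continuity, γ(r) is the limit of γ at the grid points of mesh 1/(n+1) just to the right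
of r; these approximations factor through the integers. -/
theorem measurable (γ : CadlagPath T d) : Measurable γ.toFun := by
  have hlim : ∀ r : ℝ, Tendsto (fun n : ℕ => γ ((⌊(n + 1 : ℝ) * r⌋ + 1) / (n + 1 : ℝ))) atTop
      (𝓝 (γ r)) := by
    intro r
    refine (γ.right_cont r).tendsto.comp (tendsto_nhdsWithin_iff.2 ⟨?_, ?_⟩)
    · have h1 : Tendsto (fun n : ℕ => r + 1 / ((n : ℝ) + 1)) atTop (𝓝 r) := by
        simpa using tendsto_one_div_add_atTop_nhds_zero_nat.const_add r
      refine tendsto_of_tendsto_of_tendsto_of_le_of_le tendsto_const_nhds h1 (fun n => ?_) fun n => ?_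
      · have hn : (0 : ℝ) < n + 1 := by positivity
        change r ≤ _ / _
        rw [le_div_iff₀ hn, mul_comm]
        exact (Int.lt_floor_add_one _).le
      · have hn : (0 : ℝ) < n + 1 := by positivity
        change _ / _ ≤ r + _
        have h2 : (r + 1 / ((n : ℝ) + 1)) * (n + 1) = (n + 1) * r + 1 := by field_simp
        rw [div_le_iff₀ hn, h2]
        linarith [Int.floor_le ((n + 1 : ℝ) * r)]
    · refine Eventually.of_forall fun n => ?_
      have hn : (0 : ℝ) < n + 1 := by positivity
      rw [mem_Ici, le_div_iff₀ hn, mul_comm]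
      exact (Int.lt_floor_add_one _).le
  refine measurable_of_tendsto_metrizable (fun n => ?_) (tendsto_pi_nhds.2 hlim)
  have h1 : Measurable fun k : ℤ => γ (((k : ℝ) + 1) / (n + 1 : ℝ)) := measurable_from_top
  exact h1.comp (Int.measurable_floor.comp (measurable_const_mul _))

/-- The left limit of a path at the final time `T`; it is the final value if `time < T`. -/
def endLimit (γ : CadlagPath T d) : Vec d := (γ.left_lim T).choose

theorem tendsto_endLimit (γ : CadlagPath T d) : Tendsto γ.toFun (𝓝[<] T) (𝓝 γ.endLimit) :=
  (γ.left_lim T).choose_spec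

theorem endLimit_of_time_lt (γ : CadlagPath T d) (h : γ.time < T) : γ.endLimit = γ T := by
  refine tendsto_nhds_unique γ.tendsto_endLimit (tendsto_const_nhds.congr' ?_)
  filter_upwards [Ioo_mem_nhdsLT h] with s hs
  rw [γ.apply_of_time_le h.le, γ.apply_of_time_le hs.1.le]

theorem endLimit_of_continuous (γ : CadlagPath T d) (h : Continuous γ.toFun) :
    γ.endLimit = γ T :=
  tendsto_nhds_unique γ.tendsto_endLimit ((h.tendsto T).mono_left nhdsWithin_le_nhds)

/-- The uniform distance bounds the difference at each time before T, hence also the difference of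
the left limits. -/
theorem continuous_endLimit : Continuous (endLimit : CadlagPath T d → Vec d) := by
  refine (LipschitzWith.of_dist_le_mul (K := 1) fun γ η => ?_).continuous
  rw [NNReal.coe_one, one_mul, dist_eq_norm]
  exact le_of_tendsto (γ.tendsto_endLimit.sub η.tendsto_endLimit).norm
    (Eventually.of_forall fun s => γ.norm_sub_le_dist η s)

theorem intervalIntegrable_sq (γ : CadlagPath T d) {X : ℝ → Vec d} (hX : Continuous X) (a b : ℝ) :
    IntervalIntegrable (fun r => ‖γ r - X r‖ ^ 2) volume a b := by
  have hc : Continuous fun r => (γ.supNorm + ‖X r‖) ^ 2 := by fun_prop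
  refine (hc.intervalIntegrable a b).mono_fun
    ((γ.measurable.sub hX.measurable).norm.pow_const 2).aestronglyMeasurable
    (Eventually.of_forall fun r => ?_)
  change ‖‖γ r - X r‖ ^ 2‖ ≤ ‖(γ.supNorm + ‖X r‖) ^ 2‖
  rw [norm_pow, norm_norm, norm_pow]
  refine pow_le_pow_left₀ (norm_nonneg _) ?_ 2
  rw [Real.norm_of_nonneg (by have := γ.supNorm_nonneg; positivity)]
  exact (norm_sub_le _ _).trans (add_le_add (γ.norm_le_supNorm r) le_rfl)

end CadlagPath

section TestFunctional

/-- The data of a smooth test functional that penalizes the distance to a moving target `X`. -/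
structure Target (T : ℝ) (d : ℕ) (t₀ : ℝ) where
  X : ℝ → Vec d
  g : ℝ → Vec d
  j : ℝ → ℝ
  j' : ℝ → ℝ
  continuous_X : Continuous X
  continuous_g : Continuous g
  continuous_j : Continuous j
  continuous_j' : Continuous j'
  deriv_X : ∀ s ∈ Ico t₀ T, HasDerivWithinAt X (g s) (Ici s) s
  deriv_j : ∀ s ∈ Ico t₀ T, HasDerivWithinAt j (j' s) (Ici s) s

namespace Target

variable {t₀ : ℝ} (D : Target T d t₀) (c : ℝ)

/-- `j(t) + c (|γ_t(t) - X(t)|² + ∫_0^t |γ_t - X|²)`. -/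
def value (γ : CadlagPath T d) : ℝ :=
  D.j γ.time + c * (‖γ T - D.X γ.time‖ ^ 2 + ∫ r in (0 : ℝ)..γ.time, ‖γ r - D.X r‖ ^ 2)

/-- The horizontal derivative of `Target.value`. -/
def dt (γ : CadlagPath T d) : ℝ :=
  D.j' γ.time + c * (‖γ.endLimit - D.X γ.time‖ ^ 2 -
    2 * inner ℝ (γ.endLimit - D.X γ.time) (D.g γ.time))

/-- The vertical derivative of `Target.value`. -/
def dx (γ : CadlagPath T d) : Vec d := (2 * c) • (γ T - D.X γ.time)

theorem integral_split (γ : CadlagPath T d) {s : ℝ} (hs : γ.time ≤ s) :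
    ∫ r in (0 : ℝ)..s, ‖γ r - D.X r‖ ^ 2 =
      (∫ r in (0 : ℝ)..γ.time, ‖γ r - D.X r‖ ^ 2) + ∫ r in γ.time..s, ‖γ T - D.X r‖ ^ 2 := by
  rw [← intervalIntegral.integral_add_adjacent_intervals
    (γ.intervalIntegrable_sq D.continuous_X 0 γ.time)
    (γ.intervalIntegrable_sq D.continuous_X γ.time s)]
  congr 1
  refine intervalIntegral.integral_congr fun r hr => ?_
  rw [uIcc_of_le hs] at hr
  simp only [γ.apply_of_time_le hr.1, γ.apply_of_time_le γ.time_le]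

theorem continuous_value : Continuous (D.value c : CadlagPath T d → ℝ) := by
  have hj := D.continuous_j
  have hX := D.continuous_X
  have ht := CadlagPath.continuous_time (T := T) (d := d)
  have he := CadlagPath.continuous_eval (T := T) (d := d) T
  have h1 : Continuous fun γ : CadlagPath T d => ∫ r in (0 : ℝ)..T, ‖γ r - D.X r‖ ^ 2 := by
    rw [continuous_iff_continuousAt]
    intro γ
    refine intervalIntegral.continuousAt_of_dominated_interval
      (bound := fun r => (γ.supNorm + 1 + ‖D.X r‖) ^ 2) (Eventually.of_forall fun η => ?_) ?_
      ((by fun_prop : Continuous fun r => (γ.supNorm + 1 + ‖D.X r‖) ^ 2).intervalIntegrable _ _)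
      (Eventually.of_forall fun r _ => ?_)
    · exact ((η.measurable.sub hX.measurable).norm.pow_const 2).aestronglyMeasurable
    · filter_upwards [Metric.ball_mem_nhds γ one_pos] with η hη
      refine Eventually.of_forall fun r _ => ?_
      rw [norm_pow, norm_norm]
      refine pow_le_pow_left₀ (norm_nonneg _) ?_ 2
      have h1 := (η.norm_le_supNorm r).trans (η.supNorm_le_add γ)
      have h2 := (η.supDist_le_dist γ).trans (Metric.mem_ball.1 hη).le
      have h3 := norm_sub_le (η r) (D.X r)
      linarith
    · have := CadlagPath.continuous_eval (T := T) (d := d) r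
      fun_prop
  have h2 : Continuous fun γ : CadlagPath T d => ∫ r in T..γ.time, ‖γ T - D.X r‖ ^ 2 := by
    refine intervalIntegral.continuous_parametric_intervalIntegral_of_continuous ?_ ht
    exact ((he.comp continuous_fst).sub (hX.comp continuous_snd)).norm.pow 2
  -- Since γ is constant after its final time, the integral up to that time becomes one over the
  -- fixed interval [0,T], treated by dominated convergence, plus one with a variable endpoint but a
  -- jointly continuous integrand.
  have h3 : (D.value c : CadlagPath T d → ℝ) = fun γ => D.j γ.time +
      c * (‖γ T - D.X γ.time‖ ^ 2 + ((∫ r in (0 : ℝ)..T, ‖γ r - D.X r‖ ^ 2) +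
        ∫ r in T..γ.time, ‖γ T - D.X r‖ ^ 2)) := by
    funext γ
    rw [value, D.integral_split γ γ.time_le, intervalIntegral.integral_symm γ.time T]
    ring
  rw [h3]
  fun_prop

theorem continuous_dt : Continuous (D.dt c : CadlagPath T d → ℝ) := by
  have h1 := D.continuous_j'
  have h2 := D.continuous_X
  have h3 := D.continuous_g
  have ht := CadlagPath.continuous_time (T := T) (d := d)
  have he := CadlagPath.continuous_endLimit (T := T) (d := d)
  unfold dt
  fun_prop

theorem continuous_dx : Continuous (D.dx c : CadlagPath T d → Vec d) := by
  have h2 := D.continuous_X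
  have ht := CadlagPath.continuous_time (T := T) (d := d)
  have he := CadlagPath.continuous_eval (T := T) (d := d) T
  unfold dx
  fun_prop

/-- Along the frozen extension only the target and the length of the integral change. Right
derivatives of the target suffice; a trajectory glued to its initial path may have a kink at t₀. -/
theorem horizontal (γ : CadlagPath T d) (hγ : t₀ ≤ γ.time) (hγT : γ.time < T) :
    Tendsto (fun h : ℝ => (1 / h) * (D.value c (γ.extend (γ.time + h)) - D.value c γ)) (𝓝[>] 0)
      (𝓝 (D.dt c γ)) := by
  set t := γ.time with ht
  have hX := D.continuous_X
  have hI : HasDerivAt (fun s => ∫ r in t..s, ‖γ T - D.X r‖ ^ 2) (‖γ T - D.X t‖ ^ 2) t :=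
    ((by fun_prop : Continuous fun r => ‖γ T - D.X r‖ ^ 2).integral_hasStrictDerivAt t t).hasDerivAt
  have hd : HasDerivWithinAt (fun s => D.j s + c * (‖γ T - D.X s‖ ^ 2 +
      ((∫ r in (0 : ℝ)..t, ‖γ r - D.X r‖ ^ 2) + ∫ r in t..s, ‖γ T - D.X r‖ ^ 2)))
      (D.dt c γ) (Ici t) t := by
    have h1 := ((D.deriv_X t ⟨hγ, hγT⟩).const_sub (γ T)).norm_sq
    refine ((D.deriv_j t ⟨hγ, hγT⟩).fun_add ((h1.fun_add
      (hI.hasDerivWithinAt.const_add _)).const_mul c)).congr_deriv ?_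
    rw [dt, γ.endLimit_of_time_lt hγT, inner_neg_right]
    ring
  rw [← hasDerivWithinAt_Ioi_iff_Ici, hasDerivWithinAt_iff_tendsto_slope' (by simp)] at hd
  have hsh : Tendsto (fun h => t + h) (𝓝[>] 0) (𝓝[>] t) := by
    refine tendsto_nhdsWithin_iff.2 ⟨?_, ?_⟩
    · have : Tendsto (fun h : ℝ => t + h) (𝓝 0) (𝓝 (t + 0)) := (continuous_const_add t).tendsto 0
      rw [add_zero] at this
      exact this.mono_left nhdsWithin_le_nhds
    · filter_upwards [self_mem_nhdsWithin] with x hx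
      exact lt_add_of_pos_right t (mem_Ioi.1 hx)
  refine (hd.comp hsh).congr' ?_
  filter_upwards [Ioo_mem_nhdsGT (sub_pos.2 hγT)] with h hh
  have hext : (γ.extend (t + h)).time = t + h :=
    γ.extend_time ⟨by linarith [hh.1], by linarith [hh.2]⟩
  rw [Function.comp_apply, slope_def_field, add_sub_cancel_left, div_eq_inv_mul, one_div]
  congr 2
  · rw [value, hext]
    change _ = D.j (t + h) + c * (‖γ T - D.X (t + h)‖ ^ 2 + ∫ r in (0 : ℝ)..t + h, ‖γ r - D.X r‖ ^ 2)
    rw [D.integral_split γ (show γ.time ≤ t + h by linarith [hh.1])]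
  · rw [value, intervalIntegral.integral_same, add_zero]

theorem vertical (γ : CadlagPath T d) (i : Fin d) :
    Tendsto (fun h : ℝ => (1 / h) *
      (D.value c (γ.bump (h • EuclideanSpace.single i (1 : ℝ))) - D.value c γ)) (𝓝[≠] 0)
      (𝓝 (D.dx c γ i)) := by
  set y := γ T - D.X γ.time with hy
  have hlim : Tendsto (fun h : ℝ => c * (2 * y i + h)) (𝓝[≠] 0) (𝓝 (D.dx c γ i)) := by
    have : Tendsto (fun h : ℝ => c * (2 * y i + h)) (𝓝 0) (𝓝 (c * (2 * y i + 0))) :=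
      (by fun_prop : Continuous fun h : ℝ => c * (2 * y i + h)).tendsto 0
    have h2 : D.dx c γ i = c * (2 * y i + 0) := by
      simp only [dx, PiLp.smul_apply, smul_eq_mul, hy]; ring
    rw [h2]
    exact this.mono_left nhdsWithin_le_nhds
  refine hlim.congr' ?_
  filter_upwards [self_mem_nhdsWithin] with h hh
  have hh : h ≠ 0 := hh
  -- The jump changes the integrand only at the final time, a null set.
  have hint : ∫ r in (0 : ℝ)..γ.time,
      ‖γ.bump (h • EuclideanSpace.single i (1 : ℝ)) r - D.X r‖ ^ 2 =
      ∫ r in (0 : ℝ)..γ.time, ‖γ r - D.X r‖ ^ 2 := by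
    rw [intervalIntegral.integral_of_le γ.time_nonneg, intervalIntegral.integral_of_le γ.time_nonneg,
      integral_Ioc_eq_integral_Ioo, integral_Ioc_eq_integral_Ioo]
    refine setIntegral_congr_fun measurableSet_Ioo fun r hr => ?_
    simp only [CadlagPath.bump_apply, if_pos (max_lt (hr.1.trans hr.2) hr.2)]
  have hend : γ.bump (h • EuclideanSpace.single i (1 : ℝ)) T =
      γ T + h • EuclideanSpace.single i (1 : ℝ) := by
    rw [CadlagPath.bump_apply, if_neg (not_lt.2 (γ.time_le.trans (le_max_right _ _)))]
  have hval : D.value c (γ.bump (h • EuclideanSpace.single i (1 : ℝ))) =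
      D.j γ.time + c * (‖y + h • EuclideanSpace.single i (1 : ℝ)‖ ^ 2 +
        ∫ r in (0 : ℝ)..γ.time, ‖γ r - D.X r‖ ^ 2) := by
    rw [← hint, hy, sub_add_eq_add_sub, ← hend]
    rfl
  rw [hval, value, ← hy, norm_add_sq_real]
  simp only [norm_smul, inner_smul_right, EuclideanSpace.inner_single_right]
  simp
  field_simp
  ring

/-- The `C¹` functional `j(t) + c (|γ_t(t) - X(t)|² + ∫_0^t |γ_t - X|²)`. -/
def functional (hT : 0 < T) : C1Functional T d t₀ where
  toFun := D.value c
  dt := D.dt c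
  dx := D.dx c
  continuousOn_toFun := (D.continuous_value c).continuousOn
  horizontal := D.horizontal c
  horizontal_final γ hγ := by
    -- Restrictions to s < T do not see a jump at T, so the limit of the horizontal derivatives
    -- involves the left limit there; for this reason `Target.dt` is built on `endLimit` and not on
    -- γ(T).
    have hlim : Tendsto (fun s => D.j' s + c * (‖γ s - D.X s‖ ^ 2 - 2 * inner ℝ (γ s - D.X s) (D.g s)))
        (𝓝[<] T) (𝓝 (D.dt c γ)) := by
      have h1 := (D.continuous_j'.tendsto T).mono_left (nhdsWithin_le_nhds (s := Iio T))
      have h2 := (D.continuous_X.tendsto T).mono_left (nhdsWithin_le_nhds (s := Iio T))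
      have h3 := (D.continuous_g.tendsto T).mono_left (nhdsWithin_le_nhds (s := Iio T))
      have h4 := γ.tendsto_endLimit.sub h2
      have h5 := h1.add (((h4.norm.pow 2).sub ((h4.inner h3).const_mul 2)).const_mul c)
      rw [dt, hγ]
      exact h5
    refine hlim.congr' ?_
    filter_upwards [Ioo_mem_nhdsLT hT] with s hs
    have ht : (γ.restrict s).time = s := by
      change max 0 (min s γ.time) = s
      rw [hγ, min_eq_left hs.2.le, max_eq_right hs.1.le]
    have hv : (γ.restrict s).endLimit = γ s := by
      rw [CadlagPath.endLimit_of_time_lt _ (ht.trans_lt hs.2)]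
      change γ (min T (γ.restrict s).time) = γ s
      rw [ht, min_eq_right hs.2.le]
    rw [dt, ht, hv]
  vertical γ _ i := D.vertical c γ i
  continuousOn_dt := (D.continuous_dt c).continuousOn
  continuousOn_dx := (D.continuous_dx c).continuousOn

end Target
end TestFunctional

/-! ### Compactness of the sets of Lipschitz paths. -/

section Compactness

theorem lipPaths_lipschitz {μ t M₀ : ℝ} {γ : ContPath T d} (hγ : γ ∈ lipPaths T d μ t M₀)
    (hK : 0 ≤ μ * (1 + M₀)) (l r : ℝ) : ‖γ.1 l - γ.1 r‖ ≤ μ * (1 + M₀) * |l - r| := by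
  have h0 := γ.1.time_nonneg
  wlog hlr : max 0 (min l γ.1.time) < max 0 (min r γ.1.time) generalizing l r
  · rcases (not_lt.1 hlr).eq_or_lt with h | h
    · rw [γ.1.frozen l, γ.1.frozen r, h, sub_self, norm_zero]
      positivity
    · rw [norm_sub_rev, abs_sub_comm]
      exact this r l h
  rw [γ.1.frozen l, γ.1.frozen r]
  exact (hγ.2.2 _ _ (le_max_left _ _) hlr (max_le h0 (min_le_right _ _))).trans
    (mul_le_mul_of_nonneg_left (abs_clamp_sub_le _ _ _) hK)

/-- Arzelà–Ascoli gives compactness of the equi-Lipschitz bounded functions on [0,T]. Stopping such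
a function at a time s is jointly Lipschitz in s and the function, since the functions share a
Lipschitz constant, and every path of the set arises in this way. -/
theorem isCompact_lipPaths (hT : 0 ≤ T) {μ t M₀ : ℝ} (hK : 0 ≤ μ * (1 + M₀)) :
    IsCompact (lipPaths T d μ t M₀) := by
  set K := μ * (1 + M₀) with hKdef
  let A : Set (BoundedContinuousFunction (Icc (0 : ℝ) T) (Vec d)) :=
    {x | (∀ s, ‖x s‖ ≤ M₀) ∧ ∀ s r, ‖x s - x r‖ ≤ K * |(s : ℝ) - r|}
  have hev : ∀ s, Continuous fun x : BoundedContinuousFunction (Icc (0 : ℝ) T) (Vec d) => x s :=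
    fun s => (BoundedContinuousFunction.lipschitz_eval_const s).continuous
  have hA : IsCompact A := by
    refine BoundedContinuousFunction.arzela_ascoli₂ (Metric.closedBall 0 M₀)
      (isCompact_closedBall _ _) A ?_ (fun x s hx => by simpa using hx.1 s) ?_
    · have hAeq : A = (⋂ s, {x | ‖x s‖ ≤ M₀}) ∩ ⋂ s : Icc (0 : ℝ) T, ⋂ r : Icc (0 : ℝ) T,
          {x | ‖x s - x r‖ ≤ K * |(s : ℝ) - r|} := by
        ext x
        simp only [A, mem_inter_iff, mem_iInter, mem_ofPred_eq]
      rw [hAeq]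
      refine IsClosed.inter (isClosed_iInter fun s => ?_)
        (isClosed_iInter fun s => isClosed_iInter fun r => ?_)
      · exact isClosed_le (hev s).norm continuous_const
      · exact isClosed_le ((hev s).sub (hev r)).norm continuous_const
    · refine (LipschitzWith.uniformEquicontinuous _ ⟨K, hK⟩ fun x =>
        LipschitzWith.of_dist_le_mul fun s r => ?_).equicontinuous
      rw [dist_eq_norm, Subtype.dist_eq, Real.dist_eq]
      exact x.2.2 s r
  obtain ⟨ι, hιt, hι⟩ : ∃ ι : Icc (0 : ℝ) T × BoundedContinuousFunction (Icc (0 : ℝ) T) (Vec d) →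
      ContPath T d, (∀ p, (ι p).1.time = p.1) ∧
      ∀ p s, (ι p).1 s = p.2 (projIcc 0 T hT (max 0 (min s p.1))) :=
    ⟨fun p => ContPath.ofFun p.1 p.1.2 (fun s => p.2 (projIcc 0 T hT s)) (by fun_prop),
      fun p => rfl, fun p s => rfl⟩
  have hproj : ∀ s r : ℝ, |(projIcc 0 T hT s : ℝ) - projIcc 0 T hT r| ≤ |s - r| := fun s r => by
    have := (LipschitzWith.projIcc hT).dist_le_mul s r
    rwa [NNReal.coe_one, one_mul, Subtype.dist_eq, Real.dist_eq, Real.dist_eq] at this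
  have himage : lipPaths T d μ t M₀ = ι '' (({s | t ≤ (s : ℝ)} : Set (Icc (0 : ℝ) T)) ×ˢ A) := by
    ext γ
    constructor
    · intro hγ
      have hl := lipPaths_lipschitz hγ hK
      let x : BoundedContinuousFunction (Icc (0 : ℝ) T) (Vec d) :=
        BoundedContinuousFunction.mkOfCompact ⟨fun s => γ.1 s, γ.2.comp continuous_subtype_val⟩
      refine ⟨⟨⟨γ.1.time, γ.1.time_mem⟩, x⟩, ⟨hγ.1,
        fun s => (γ.1.norm_le_supNorm s).trans hγ.2.1, fun s r => hl s r⟩, ?_⟩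
      refine ContPath.ext_of_Icc (hιt _) fun s hs => ?_
      rw [hιt] at hs
      rw [hι]
      change γ.1 (projIcc 0 T hT (max 0 (min s γ.1.time))) = γ.1 s
      have hs : s ∈ Icc 0 γ.1.time := hs
      rw [min_eq_left hs.2, max_eq_right hs.1, projIcc_of_mem hT ⟨hs.1, hs.2.trans γ.1.time_le⟩]
    · rintro ⟨p, ⟨hp1, hp2⟩, rfl⟩
      refine ⟨(hιt p).symm ▸ hp1, CadlagPath.supNorm_le _ fun s _ => hι p s ▸ hp2.1 _, fun l r _ _ _ => ?_⟩
      rw [hι, hι]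
      exact (hp2.2 _ _).trans (mul_le_mul_of_nonneg_left
        ((hproj _ _).trans (abs_clamp_sub_le _ _ _)) hK)
  rw [himage]
  refine IsCompact.image_of_continuousOn ?_ ?_
  · refine IsCompact.prod (IsClosed.isCompact ?_) hA
    exact isClosed_le continuous_const continuous_subtype_val
  · refine (LipschitzOnWith.of_dist_le_mul (K := ⟨2 + K, by positivity⟩)
      fun p hp p' hp' => ?_).continuousOn
    change dist (ι p).1 (ι p').1 ≤ (2 + K) * _
    rw [CadlagPath.dist_def]
    have h1 : |(p.1 : ℝ) - p'.1| ≤ dist p p' := by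
      rw [← Real.dist_eq, ← Subtype.dist_eq]; exact le_max_left _ _
    have h2 : dist p.2 p'.2 ≤ dist p p' := le_max_right _ _
    have h3 : (ι p).1.supDist (ι p').1 ≤ K * dist p p' + dist p p' := by
      refine CadlagPath.supDist_le fun s _ => ?_
      rw [hι, hι]
      have e1 : |max 0 (min s (p.1 : ℝ)) - max 0 (min s (p'.1 : ℝ))| ≤ |(p.1 : ℝ) - p'.1| := by
        refine (abs_max_sub_max_le_max 0 _ 0 _).trans (max_le (by simp) ?_)
        exact (abs_min_sub_min_le_max s _ s _).trans (max_le (by simp) le_rfl)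
      set a := projIcc 0 T hT (max 0 (min s (p.1 : ℝ))) with ha
      set b := projIcc 0 T hT (max 0 (min s (p'.1 : ℝ))) with hb
      have e2 : |(a : ℝ) - b| ≤ dist p p' := (hproj _ _).trans (e1.trans h1)
      have e3 : ‖p.2 a - p.2 b‖ ≤ K * dist p p' :=
        (hp.2.2 a b).trans (mul_le_mul_of_nonneg_left e2 hK)
      have e4 : ‖p.2 b - p'.2 b‖ ≤ dist p p' := by
        rw [← dist_eq_norm]
        exact (BoundedContinuousFunction.dist_coe_le_dist b).trans h2
      exact (norm_sub_le_norm_sub_add_norm_sub (p.2 a) (p.2 b) (p'.2 b)).trans (add_le_add e3 e4)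
    rw [hιt, hιt]
    linarith

end Compactness

/-! ### The penalty and the penalized maximum. -/

section Doubling

/-- `|γ_t(t) - η_t(t)|² + ∫_0^t |γ_t - η_t|²` -/
def penalty (γ η : ContPath T d) : ℝ :=
  ‖γ.1 T - η.1 T‖ ^ 2 + ∫ r in (0 : ℝ)..γ.1.time, ‖γ.1 r - η.1 r‖ ^ 2

theorem penalty_self (γ : ContPath T d) : penalty γ γ = 0 := by simp [penalty]

theorem continuousOn_penalty :
    ContinuousOn (fun p : ContPath T d × ContPath T d => penalty p.1 p.2)
      {p | p.1.1.time = p.2.1.time} := by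
  have ht : Continuous fun p : ContPath T d × ContPath T d => p.1.1.time :=
    CadlagPath.continuous_time.comp (continuous_subtype_val.comp continuous_fst)
  have he : ∀ s, Continuous fun p : ContPath T d × ContPath T d => ‖p.1.1 s - p.2.1 s‖ ^ 2 :=
    fun s => (((CadlagPath.continuous_eval s).comp (continuous_subtype_val.comp continuous_fst)).sub
      ((CadlagPath.continuous_eval s).comp (continuous_subtype_val.comp continuous_snd))).norm.pow 2
  have hs1 : Continuous fun p : ContPath T d × ContPath T d => p.1.1.supNorm :=
    CadlagPath.continuous_supNorm.comp (continuous_subtype_val.comp continuous_fst)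
  have hs2 : Continuous fun p : ContPath T d × ContPath T d => p.2.1.supNorm :=
    CadlagPath.continuous_supNorm.comp (continuous_subtype_val.comp continuous_snd)
  have hpath : ∀ p : ContPath T d × ContPath T d, Continuous fun r => ‖p.1.1 r - p.2.1 r‖ ^ 2 :=
    fun p => (p.1.2.sub p.2.2).norm.pow 2
  have h1 : Continuous fun p : ContPath T d × ContPath T d =>
      ∫ r in (0 : ℝ)..T, ‖p.1.1 r - p.2.1 r‖ ^ 2 := by
    rw [continuous_iff_continuousAt]
    intro p
    refine intervalIntegral.continuousAt_of_dominated_interval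
      (bound := fun r => (p.1.1.supNorm + 1 + (p.2.1.supNorm + 1)) ^ 2)
      (Eventually.of_forall fun η => (hpath η).aestronglyMeasurable) ?_
      intervalIntegrable_const (Eventually.of_forall fun r _ => (he r).continuousAt)
    have h1 := hs1.continuousAt.eventually (gt_mem_nhds (lt_add_one p.1.1.supNorm))
    have h2 := hs2.continuousAt.eventually (gt_mem_nhds (lt_add_one p.2.1.supNorm))
    filter_upwards [h1, h2] with η h3 h4
    refine Eventually.of_forall fun r _ => ?_
    rw [norm_pow, norm_norm]
    refine pow_le_pow_left₀ (norm_nonneg _) ((norm_sub_le _ _).trans (add_le_add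
      ((η.1.1.norm_le_supNorm r).trans h3.le) ((η.2.1.norm_le_supNorm r).trans h4.le))) 2
  -- With a common final time the difference is constant afterwards, so the integral over [0,t] is
  -- the one over [0,T] minus an explicit term.
  have h2 : Continuous fun p : ContPath T d × ContPath T d => ‖p.1.1 T - p.2.1 T‖ ^ 2 +
      ((∫ r in (0 : ℝ)..T, ‖p.1.1 r - p.2.1 r‖ ^ 2) -
        (T - p.1.1.time) * ‖p.1.1 T - p.2.1 T‖ ^ 2) := by
    have := he T
    fun_prop
  refine h2.continuousOn.congr fun p hp => ?_
  have hp : p.1.1.time = p.2.1.time := hp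
  simp only [penalty]
  congr 1
  rw [eq_sub_iff_add_eq, ← intervalIntegral.integral_add_adjacent_intervals
    ((hpath p).intervalIntegrable 0 p.1.1.time) ((hpath p).intervalIntegrable p.1.1.time T)]
  congr 1
  rw [← smul_eq_mul, ← intervalIntegral.integral_const]
  refine intervalIntegral.integral_congr fun r hr => ?_
  rw [uIcc_of_le p.1.1.time_le] at hr
  simp only [p.1.1.apply_of_time_le hr.1, p.2.1.apply_of_time_le (hp ▸ hr.1),
    p.1.1.apply_of_time_le p.1.1.time_le, p.2.1.apply_of_time_le p.2.1.time_le]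

/-- If |γ - η| attains its supremum m at r₀, then, being Lipschitz with constant 2K, it stays above
m/2 for a time m/(4K), and the integral is at least m³/(16K). If the final time comes first, the
endpoint difference is at least m/2, and m ≤ 2M₀ gives the cubic bound. -/
theorem penalty_bounds {μ t M₀ : ℝ} {γ η : ContPath T d} (hγ : γ ∈ lipPaths T d μ t M₀)
    (hη : η ∈ lipPaths T d μ t M₀) (hK : 0 < μ * (1 + M₀)) (hM : 0 < M₀)
    (ht : γ.1.time = η.1.time) :
    ‖γ.1 T - η.1 T‖ ^ 2 ≤ penalty γ η ∧
      γ.1.supDist η.1 ^ 3 ≤ (16 * (μ * (1 + M₀)) + 8 * M₀) * penalty γ η := by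
  set K := μ * (1 + M₀) with hKdef
  set m := γ.1.supDist η.1 with hm
  have hcont : Continuous fun r => ‖γ.1 r - η.1 r‖ := (γ.2.sub η.2).norm
  have hint : ∀ a b, IntervalIntegrable (fun r => ‖γ.1 r - η.1 r‖ ^ 2) volume a b :=
    fun a b => (hcont.pow 2).intervalIntegrable a b
  have hI0 : 0 ≤ ∫ r in (0 : ℝ)..γ.1.time, ‖γ.1 r - η.1 r‖ ^ 2 :=
    intervalIntegral.integral_nonneg γ.1.time_nonneg fun r _ => by positivity
  have hfst : ‖γ.1 T - η.1 T‖ ^ 2 ≤ penalty γ η := le_add_of_nonneg_right hI0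
  refine ⟨hfst, ?_⟩
  have hm0 : 0 ≤ m := CadlagPath.supDist_nonneg _ _
  have hP0 : 0 ≤ penalty γ η := (sq_nonneg _).trans hfst
  have hm2 : m ≤ 2 * M₀ := CadlagPath.supDist_le fun s _ => (norm_sub_le _ _).trans (by
    linarith [(γ.1.norm_le_supNorm s).trans hγ.2.1, (η.1.norm_le_supNorm s).trans hη.2.1])
  obtain ⟨r₀, hr₀, hmax⟩ := isCompact_Icc.exists_isMaxOn
    (nonempty_Icc.2 γ.1.time_nonneg) hcont.continuousOn
  have hmr : m ≤ ‖γ.1 r₀ - η.1 r₀‖ :=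
    CadlagPath.supDist_le_of_time_le le_rfl ht.symm.le fun s hs => hmax hs
  have hz : ∀ r ∈ Icc r₀ (r₀ + m / (4 * K)), m / 2 ≤ ‖γ.1 r - η.1 r‖ := fun r hr => by
    have h1 := lipPaths_lipschitz hγ hK.le r₀ r
    have h2 := lipPaths_lipschitz hη hK.le r r₀
    rw [abs_sub_comm, abs_of_nonneg (by linarith [hr.1])] at h1
    rw [abs_of_nonneg (by linarith [hr.1])] at h2
    have h3 : K * (r - r₀) ≤ m / 4 := by
      have : K * (r - r₀) ≤ K * (m / (4 * K)) :=
        mul_le_mul_of_nonneg_left (by linarith [hr.2]) hK.le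
      have h4 : K * (m / (4 * K)) = m / 4 := by field_simp
      linarith
    have h4 : γ.1 r₀ - η.1 r₀ = (γ.1 r₀ - γ.1 r) + (γ.1 r - η.1 r) + (η.1 r - η.1 r₀) := by abel
    have h5 : ‖γ.1 r₀ - η.1 r₀‖ ≤ _ := h4 ▸ norm_add₃_le
    linarith
  have hKP : 0 ≤ K * penalty γ η := by positivity
  rcases le_total (r₀ + m / (4 * K)) γ.1.time with h | h
  · have h0 : 0 ≤ m / (4 * K) := by positivity
    have h1 : ∫ _r in r₀..r₀ + m / (4 * K), (m / 2) ^ 2 ≤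
        ∫ r in r₀..r₀ + m / (4 * K), ‖γ.1 r - η.1 r‖ ^ 2 :=
      intervalIntegral.integral_mono_on (by linarith) intervalIntegrable_const (hint _ _)
        fun r hr => pow_le_pow_left₀ (by positivity) (hz r hr) 2
    have h2 : ∫ r in r₀..r₀ + m / (4 * K), ‖γ.1 r - η.1 r‖ ^ 2 ≤
        ∫ r in (0 : ℝ)..γ.1.time, ‖γ.1 r - η.1 r‖ ^ 2 :=
      intervalIntegral.integral_mono_interval hr₀.1 (by linarith) h
        (Eventually.of_forall fun r => by positivity) (hint _ _)
    rw [intervalIntegral.integral_const, smul_eq_mul, add_sub_cancel_left] at h1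
    have h3 : m / (4 * K) * (m / 2) ^ 2 ≤ penalty γ η :=
      h1.trans (h2.trans (le_add_of_nonneg_left (sq_nonneg _)))
    have h4 : m / (4 * K) * (m / 2) ^ 2 = m ^ 3 / (16 * K) := by field_simp; ring
    rw [h4, div_le_iff₀ (by positivity)] at h3
    have : 0 ≤ M₀ * penalty γ η := by positivity
    linarith
  · have h1 := hz γ.1.time ⟨hr₀.2, h⟩
    rw [← γ.1.apply_of_time_le γ.1.time_le, η.1.apply_of_time_le ht.ge,
      ← η.1.apply_of_time_le η.1.time_le] at h1
    have h2 := pow_le_pow_left₀ (by positivity) h1 2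
    have h3 : m * m ^ 2 ≤ 2 * M₀ * (4 * penalty γ η) :=
      mul_le_mul hm2 (by linarith) (by positivity) (by positivity)
    have : m ^ 3 = m * m ^ 2 := by ring
    linarith

/-- Choice of the penalization scale. -/
theorem exists_scale {A C ε : ℝ} (hA : 0 < A) (hC : 0 < C) (hε : 0 < ε) :
    ∃ δ > 0, ∀ m x : ℝ, 0 ≤ m → 0 ≤ x → m ^ 2 ≤ A * δ → x ^ 2 ≤ δ * (C * m) →
      m ≤ ε ∧ x ^ 2 / δ ≤ ε ∧ 2 / δ * x * m ≤ ε := by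
  -- With δ = η²/A one gets m ≤ η. The entries serve the three conclusions: m ≤ ε, x²/δ ≤ Cm ≤ ε,
  -- and (2xm/δ)² ≤ 4CAm ≤ ε².
  set η := min ε (min (ε / C) (ε ^ 2 / (4 * C * A))) with hη
  have hη0 : 0 < η := by positivity
  have h1 : η ≤ ε := min_le_left _ _
  have h2 : η ≤ ε / C := (min_le_right _ _).trans (min_le_left _ _)
  have h3 : η ≤ ε ^ 2 / (4 * C * A) := (min_le_right _ _).trans (min_le_right _ _)
  rw [le_div_iff₀ (by positivity)] at h2 h3
  refine ⟨η ^ 2 / A, by positivity, fun m x hm hx hmA hxm => ?_⟩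
  set δ := η ^ 2 / A with hδ
  have hδ0 : 0 < δ := by positivity
  have hAδ : A * δ = η ^ 2 := by rw [hδ]; field_simp
  have hmη : m ≤ η := by
    rw [hAδ] at hmA
    exact le_of_sq_le_sq hmA hη0.le
  have hCm : C * m ≤ C * η := mul_le_mul_of_nonneg_left hmη hC.le
  refine ⟨hmη.trans h1, ?_, ?_⟩
  · rw [div_le_iff₀ hδ0, mul_comm ε]
    exact hxm.trans (mul_le_mul_of_nonneg_left (by linarith) hδ0.le)
  · refine le_of_sq_le_sq ?_ hε.le
    have h4 : x ^ 2 * m ^ 2 ≤ δ * (C * m) * (A * δ) :=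
      mul_le_mul hxm hmA (by positivity) (by positivity)
    have h5 : (2 / δ * x * m) ^ 2 = 4 * (x ^ 2 * m ^ 2) / δ ^ 2 := by field_simp; ring
    rw [h5, div_le_iff₀ (by positivity)]
    have h6 : 4 * C * A * m ≤ ε ^ 2 := by
      have := mul_le_mul_of_nonneg_left hmη (show 0 ≤ 4 * C * A by positivity)
      linarith
    have h7 := mul_le_mul_of_nonneg_right h6 (sq_nonneg δ)
    linarith

/-- The maximum exists by compactness. Comparing it with the diagonal pair (η, η), admissible
because R lies in the Lipschitz set, gives penalty ≤ δCm; only w needs a Lipschitz bound. -/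
theorem exists_max_penalized (hT : 0 ≤ T) {μ t M₀ C δ : ℝ} (hK : 0 < μ * (1 + M₀)) (hM : 0 < M₀)
    (hC : 0 < C) (hδ : 0 < δ) {w z : ContPath T d → ℝ} (hw : Continuous w) (hz : Continuous z)
    {R : Set (ContPath T d)} (hR : IsCompact R) (hRne : R.Nonempty)
    (hRsub : R ⊆ lipPaths T d μ t M₀)
    (hwl : ∀ γ ∈ lipPaths T d μ t M₀, ∀ η ∈ lipPaths T d μ t M₀, γ.1.time = η.1.time →
      w γ - w η ≤ C * γ.1.supDist η.1) :
    ∃ γ ∈ lipPaths T d μ t M₀, ∃ η ∈ R, γ.1.time = η.1.time ∧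
      (∀ γ' ∈ lipPaths T d μ t M₀, ∀ η' ∈ R, γ'.1.time = η'.1.time →
        w γ' - z η' - 1 / δ * penalty γ' η' ≤ w γ - z η - 1 / δ * penalty γ η) ∧
      γ.1.supDist η.1 ^ 2 ≤ (16 * (μ * (1 + M₀)) + 8 * M₀) * C * δ ∧
      ‖γ.1 T - η.1 T‖ ^ 2 ≤ δ * (C * γ.1.supDist η.1) := by
  have htime : Continuous fun γ : ContPath T d => γ.1.time :=
    CadlagPath.continuous_time.comp continuous_subtype_val
  have hDc : IsClosed {p : ContPath T d × ContPath T d | p.1.1.time = p.2.1.time} :=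
    isClosed_eq (htime.comp continuous_fst) (htime.comp continuous_snd)
  have hcomp := ((isCompact_lipPaths (d := d) hT (t := t) hK.le).prod hR).inter_right hDc
  obtain ⟨η₀, hη₀⟩ := hRne
  obtain ⟨⟨γ, η⟩, ⟨⟨hγ, hη⟩, ht⟩, hmax⟩ := hcomp.exists_isMaxOn
    (f := fun p => w p.1 - z p.2 - 1 / δ * penalty p.1 p.2)
    ⟨(η₀, η₀), ⟨hRsub hη₀, hη₀⟩, rfl⟩
    ((((hw.comp continuous_fst).sub (hz.comp continuous_snd)).continuousOn.sub
      ((continuousOn_penalty.mono inter_subset_right).const_mul (1 / δ))))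
  have hmax' : ∀ γ' ∈ lipPaths T d μ t M₀, ∀ η' ∈ R, γ'.1.time = η'.1.time →
      w γ' - z η' - 1 / δ * penalty γ' η' ≤ w γ - z η - 1 / δ * penalty γ η :=
    fun γ' hγ' η' hη' h => hmax (a := (γ', η')) ⟨⟨hγ', hη'⟩, h⟩
  obtain ⟨hb1, hb2⟩ := penalty_bounds hγ (hRsub hη) hK hM ht
  have h1 := hmax' η (hRsub hη) η hη rfl
  rw [penalty_self] at h1
  have h2 := hwl γ hγ η (hRsub hη) ht
  set m := γ.1.supDist η.1 with hm
  have hm0 : 0 ≤ m := CadlagPath.supDist_nonneg _ _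
  have hP : penalty γ η ≤ δ * (C * m) := by
    have : 1 / δ * penalty γ η ≤ C * m := by linarith
    rw [one_div, inv_mul_le_iff₀ hδ] at this
    exact this
  refine ⟨γ, hγ, η, hη, ht, hmax', ?_, hb1.trans hP⟩
  -- The cubic bound combined with penalty ≤ δCm allows one factor m to be cancelled. Thus m is of
  -- order √δ and the endpoint difference of order δ^{3/4}.
  have h3 : m * m ^ 2 ≤ m * ((16 * (μ * (1 + M₀)) + 8 * M₀) * C * δ) := by
    have := mul_le_mul_of_nonneg_left hP (show 0 ≤ 16 * (μ * (1 + M₀)) + 8 * M₀ by positivity)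
    have h4 : m * m ^ 2 = m ^ 3 := by ring
    linarith
  rcases hm0.eq_or_lt with h0 | h0
  · rw [← hm, ← h0, zero_pow two_ne_zero]
    positivity
  · exact le_of_mul_le_mul_left h3 h0

end Doubling

theorem lipPaths_mono {μ t s M₀ : ℝ} (h : s ≤ t) : lipPaths T d μ t M₀ ⊆ lipPaths T d μ s M₀ :=
  fun _ hγ => ⟨h.trans hγ.1, hγ.2⟩

theorem TerminalPath.restrict_apply_final (X : TerminalPath T d) {s : ℝ} (hs : s ∈ Icc 0 T) :
    (X.1.restrict s).1 T = X.1.1 s := by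
  rw [ContPath.restrict_apply X.1 (X.mem_Icc hs), min_eq_right hs.2]

theorem Target.value_eq_penalty {t₀ : ℝ} (D : Target T d t₀) (c : ℝ) (X : TerminalPath T d)
    (hX : ∀ s ∈ Icc 0 T, D.X s = X.1.1 s) (γ : ContPath T d) :
    D.value c γ.1 = D.j γ.1.time + c * penalty γ (X.1.restrict γ.1.time) := by
  rw [Target.value, penalty, X.restrict_apply_final γ.1.time_mem, hX _ γ.1.time_mem]
  congr 3
  refine intervalIntegral.integral_congr fun r hr => ?_
  rw [uIcc_of_le γ.1.time_nonneg] at hr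
  simp only [X.restrict_apply_of_le γ.1.time_mem hr.2, hX r ⟨hr.1, hr.2.trans γ.1.time_le⟩]

theorem Target.dt_of_continuous {t₀ : ℝ} (D : Target T d t₀) (c : ℝ) (γ : ContPath T d) :
    D.dt c γ.1 = D.j' γ.1.time + c * (‖γ.1 T - D.X γ.1.time‖ ^ 2 -
      2 * inner ℝ (γ.1 T - D.X γ.1.time) (D.g γ.1.time)) := by
  rw [Target.dt, γ.1.endLimit_of_continuous γ.2]

theorem InUniquenessClass.exists_lipschitz {w : ContPath T d → ℝ} (hw : InUniquenessClass w)
    (M₀ : ℝ) (hM : 0 < M₀) : ∃ C > 0, ∀ μ t, ∀ γ ∈ lipPaths T d μ t M₀, ∀ η ∈ lipPaths T d μ t M₀,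
      γ.1.time = η.1.time → |w γ - w η| ≤ C * γ.1.supDist η.1 := by
  obtain ⟨L, hL, -, h⟩ := hw
  refine ⟨L * (1 + M₀), by positivity, fun μ t γ hγ η hη ht => (h γ η).trans ?_⟩
  have h1 : dist γ η = γ.1.supDist η.1 := CadlagPath.dist_of_time_eq ht
  rw [h1]
  refine mul_le_mul_of_nonneg_right (mul_le_mul_of_nonneg_left ?_ hL.le)
    (CadlagPath.supDist_nonneg _ _)
  linarith [max_le hγ.2.1 hη.2.1]

/-! ### A compact set of paths that is invariant under the controlled dynamics. -/

section Reach

/-- A set of extensions of `γ` that contains all trajectories that start from `γ`. -/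
def reachSet (L : ℝ) (γ : ContPath T d) : Set (ContPath T d) :=
  {η | γ.1.time ≤ η.1.time ∧ (∀ s ∈ Icc 0 γ.1.time, η.1 s = γ.1 s) ∧
    ∀ s r, γ.1.time ≤ s → s ≤ r → r ≤ T → ‖η.1 r - η.1 s‖ ≤
      (1 + γ.1.supNorm) * Real.exp (L * (r - γ.1.time)) -
        (1 + γ.1.supNorm) * Real.exp (L * (s - γ.1.time))}

theorem isClosed_reachSet (L : ℝ) (γ : ContPath T d) : IsClosed (reachSet L γ) := by
  have hev : ∀ s, Continuous fun η : ContPath T d => η.1 s :=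
    fun s => (CadlagPath.continuous_eval s).comp continuous_subtype_val
  have htime : Continuous fun γ : ContPath T d => γ.1.time :=
    CadlagPath.continuous_time.comp continuous_subtype_val
  have h : reachSet L γ = {η : ContPath T d | γ.1.time ≤ η.1.time} ∩
      ((⋂ s, ⋂ _ : s ∈ Icc 0 γ.1.time, {η : ContPath T d | η.1 s = γ.1 s}) ∩
      ⋂ s, ⋂ r, ⋂ _ : γ.1.time ≤ s, ⋂ _ : s ≤ r, ⋂ _ : r ≤ T,
        {η : ContPath T d | ‖η.1 r - η.1 s‖ ≤
      (1 + γ.1.supNorm) * Real.exp (L * (r - γ.1.time)) -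
        (1 + γ.1.supNorm) * Real.exp (L * (s - γ.1.time))}) := by
    ext η
    simp only [reachSet, mem_inter_iff, mem_iInter, mem_ofPred_eq]
  rw [h]
  refine (isClosed_le continuous_const htime).inter (IsClosed.inter ?_ ?_)
  · exact isClosed_iInter fun s => isClosed_iInter fun _ => isClosed_eq (hev s) continuous_const
  · exact isClosed_iInter fun s => isClosed_iInter fun r => isClosed_iInter fun _ =>
      isClosed_iInter fun _ => isClosed_iInter fun _ =>
      isClosed_le ((hev r).sub (hev s)).norm continuous_const

theorem exp_growth_mono {L S t r s : ℝ} (hL : 0 ≤ L) (hS : 0 ≤ S) (h : s ≤ r) :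
    S * Real.exp (L * (s - t)) ≤ S * Real.exp (L * (r - t)) :=
  mul_le_mul_of_nonneg_left (Real.exp_le_exp.2 (mul_le_mul_of_nonneg_left (by linarith) hL)) hS

theorem self_mem_reachSet {L : ℝ} (hL : 0 ≤ L) (γ : ContPath T d) : γ ∈ reachSet L γ := by
  refine ⟨le_rfl, fun _ _ => rfl, fun s r hs hsr _ => ?_⟩
  rw [γ.1.apply_of_time_le hs, γ.1.apply_of_time_le (hs.trans hsr), sub_self, norm_zero, sub_nonneg]
  exact exp_growth_mono hL (by linarith [γ.1.supNorm_nonneg]) hsr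

theorem supNorm_of_mem_reachSet {L : ℝ} (hL : 0 ≤ L) {γ η : ContPath T d} (hη : η ∈ reachSet L γ) :
    1 + η.1.supNorm ≤ (1 + γ.1.supNorm) * Real.exp (L * (η.1.time - γ.1.time)) := by
  have hS : 0 ≤ 1 + γ.1.supNorm := by linarith [γ.1.supNorm_nonneg]
  obtain ⟨h1, h2, h3⟩ := hη
  have h4 := exp_growth_mono (t := γ.1.time) hL hS h1
  rw [sub_self, mul_zero, Real.exp_zero, mul_one] at h4
  suffices h : η.1.supNorm ≤ (1 + γ.1.supNorm) * Real.exp (L * (η.1.time - γ.1.time)) - 1 by linarith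
  refine CadlagPath.supNorm_le _ fun s hs => ?_
  rcases le_total s γ.1.time with h | h
  · rw [h2 s ⟨hs.1, h⟩]
    linarith [γ.1.norm_le_supNorm s]
  · have h5 := h3 γ.1.time s le_rfl h (hs.2.trans η.1.time_le)
    rw [h2 _ (right_mem_Icc.2 γ.1.time_nonneg), sub_self, mul_zero, Real.exp_zero, mul_one] at h5
    have h6 := norm_le_norm_add_norm_sub (γ.1 γ.1.time) (η.1 s)
    have h7 := exp_growth_mono (t := γ.1.time) hL hS hs.2
    rw [norm_sub_rev] at h6
    linarith [γ.1.norm_le_supNorm γ.1.time]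

theorem supNorm_le_of_mem_reachSet {L : ℝ} (hL : 0 ≤ L) {γ η : ContPath T d}
    (hη : η ∈ reachSet L γ) : 1 + η.1.supNorm ≤ (1 + γ.1.supNorm) * Real.exp (L * T) := by
  refine (supNorm_of_mem_reachSet hL hη).trans (mul_le_mul_of_nonneg_left (Real.exp_le_exp.2
    (mul_le_mul_of_nonneg_left ?_ hL)) (by linarith [γ.1.supNorm_nonneg]))
  linarith [γ.1.time_nonneg, η.1.time_le]

/-- The growth function (1 + ‖γ‖₀) exp(L(r - t)) has slope at most L(1 + M₀) on [t,T], and it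
dominates the increments. -/
theorem reachSet_subset_lipPaths {L μ M₀ : ℝ} (hL : 0 ≤ L) {γ : ContPath T d}
    (hγ : γ ∈ lipPaths T d μ 0 M₀) (hμ : L ≤ μ)
    (hM : (1 + γ.1.supNorm) * Real.exp (L * T) ≤ 1 + M₀) :
    reachSet L γ ⊆ lipPaths T d μ γ.1.time M₀ := by
  intro η hη
  have hS : 0 ≤ 1 + γ.1.supNorm := by linarith [γ.1.supNorm_nonneg]
  have hn := supNorm_le_of_mem_reachSet hL hη
  obtain ⟨h1, h2, h3⟩ := hη
  refine ⟨h1, by linarith, norm_sub_le_of_glue (t := γ.1.time) (fun l r h0 hlr hr => ?_)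
    fun l r h0 hlr hr => ?_⟩
  · rw [h2 l ⟨h0, hlr.le.trans hr⟩, h2 r ⟨h0.trans hlr.le, hr⟩]
    exact hγ.2.2 l r h0 hlr hr
  · have hrT := hr.trans η.1.time_le
    rw [norm_sub_rev, abs_sub_comm, abs_of_pos (by linarith)]
    refine (h3 l r h0 hlr.le hrT).trans ?_
    have h4 : L * (r - γ.1.time) ≤ L * T :=
      mul_le_mul_of_nonneg_left (by linarith [γ.1.time_nonneg]) hL
    have h5 : Real.exp (L * (l - γ.1.time)) =
        Real.exp (L * (r - γ.1.time)) * Real.exp (-(L * (r - l))) := by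
      rw [← Real.exp_add]
      congr 1
      ring
    have h6 := Real.one_sub_le_exp_neg (L * (r - l))
    have h7 : 0 ≤ L * (r - l) := mul_nonneg hL (by linarith)
    have h8 : (1 + γ.1.supNorm) * Real.exp (L * (r - γ.1.time)) ≤ 1 + M₀ :=
      (mul_le_mul_of_nonneg_left (Real.exp_le_exp.2 h4) hS).trans hM
    have h9 : 0 ≤ (1 + γ.1.supNorm) * Real.exp (L * (r - γ.1.time)) := by positivity
    have h10 : L * (r - l) ≤ μ * (r - l) := mul_le_mul_of_nonneg_right hμ (by linarith)
    rw [h5]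
    calc _ = (1 + γ.1.supNorm) * Real.exp (L * (r - γ.1.time)) *
          (1 - Real.exp (-(L * (r - l)))) := by ring
      _ ≤ (1 + γ.1.supNorm) * Real.exp (L * (r - γ.1.time)) * (L * (r - l)) :=
        mul_le_mul_of_nonneg_left (by linarith) h9
      _ ≤ (1 + M₀) * (μ * (r - l)) := mul_le_mul h8 h10 h7 (h9.trans h8)
      _ = _ := by ring

variable [TopologicalSpace U] [MeasurableSpace U] [BorelSpace U]
  {F : ContPath T d → U → EuclideanSpace ℝ (Fin d)} {L : ℝ}

/-- The defining bound on increments is additive in time and reproduced by the growth estimate, so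
it survives concatenation. This gives invariance up to T; the sets C^μ are preserved only for a
short time. -/
theorem IsTrajectory.restrict_mem_reachSet (hF : IsCoefficient L F) {γ η : ContPath T d}
    (hη : η ∈ reachSet L γ) {u : ℝ → U} (hu : Measurable u) {Y : TerminalPath T d}
    (hY : IsTrajectory F η u Y) {s : ℝ} (hs : s ∈ Icc η.1.time T) :
    Y.1.restrict s ∈ reachSet L γ := by
  have hL := hF.nonneg.le
  have hS : 0 ≤ 1 + γ.1.supNorm := by linarith [γ.1.supNorm_nonneg]
  have hn := supNorm_of_mem_reachSet hL hη
  obtain ⟨h1, h2, h3⟩ := hη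
  have hs0 : s ∈ Icc 0 T := ⟨η.1.time_nonneg.trans hs.1, hs.2⟩
  set e := fun r => (1 + γ.1.supNorm) * Real.exp (L * (r - γ.1.time)) with he
  have hlate : ∀ ρ r, η.1.time ≤ ρ → ρ ≤ r → r ≤ T → ‖Y.1.1 r - Y.1.1 ρ‖ ≤ e r - e ρ := by
    intro ρ r hρ hρr hr
    have hρm : ρ ∈ Icc η.1.time T := ⟨hρ, hρr.trans hr⟩
    rw [hY.eq_add_integral hF hu hρm ⟨hρ.trans hρr, hr⟩, add_sub_cancel_left]
    have hd : ∀ σ, HasDerivAt e (L * e σ) σ := fun σ => by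
      have := ((((hasDerivAt_id σ).sub_const γ.1.time).const_mul L).exp).const_mul
        (1 + γ.1.supNorm)
      refine this.congr_deriv ?_
      simp only [id, he]
      ring
    have hec : Continuous fun σ => L * e σ := by fun_prop
    rw [← intervalIntegral.integral_eq_sub_of_hasDerivAt (fun σ _ => hd σ)
      (hec.intervalIntegrable _ _)]
    refine intervalIntegral.norm_integral_le_of_norm_le hρr (Eventually.of_forall fun σ hσ =>
      (hF.growth _ _).trans (mul_le_mul_of_nonneg_left ?_ hL)) (hec.intervalIntegrable _ _)
    have hσm : σ ∈ Icc η.1.time T := ⟨hρ.trans hσ.1.le, hσ.2.trans hr⟩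
    refine (hY.growth hF hσm).trans ((mul_le_mul_of_nonneg_right hn (Real.exp_pos _).le).trans_eq ?_)
    rw [mul_assoc, ← Real.exp_add]
    simp only [he]
    congr 2
    ring
  have hall : ∀ ρ r, γ.1.time ≤ ρ → ρ ≤ r → r ≤ T → ‖Y.1.1 r - Y.1.1 ρ‖ ≤ e r - e ρ := by
    intro ρ r hρ hρr hr
    have hearly : ∀ r, ρ ≤ r → r ≤ η.1.time → ‖Y.1.1 r - Y.1.1 ρ‖ ≤ e r - e ρ := fun r hρr hr' => by
      have hρ0 := γ.1.time_nonneg.trans hρ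
      rw [hY.1 r ⟨hρ0.trans hρr, hr'⟩, hY.1 ρ ⟨hρ0, hρr.trans hr'⟩]
      exact h3 ρ r hρ hρr (hr'.trans η.1.time_le)
    rcases le_total r η.1.time with h | h
    · exact hearly r hρr h
    rcases le_total η.1.time ρ with h' | h'
    · exact hlate ρ r h' hρr hr
    have h4 := hearly η.1.time h' le_rfl
    have h5 := hlate η.1.time r le_rfl h hr
    have h6 := norm_sub_le_norm_sub_add_norm_sub (Y.1.1 r) (Y.1.1 η.1.time) (Y.1.1 ρ)
    linarith
  refine ⟨by rw [Y.restrict_time hs0]; exact h1.trans hs.1, fun r hr => ?_, fun ρ r hρ hρr hr => ?_⟩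
  · rw [Y.restrict_apply_of_le hs0 (hr.2.trans (h1.trans hs.1)), hY.1 r ⟨hr.1, hr.2.trans h1⟩, h2 r hr]
  · rw [ContPath.restrict_apply Y.1 (Y.mem_Icc hs0), ContPath.restrict_apply Y.1 (Y.mem_Icc hs0)]
    have h4 : ∀ {a b : ℝ}, a ≤ b → e a ≤ e b := fun h => exp_growth_mono hL hS h
    have h5 := hall (min ρ s) (min r s) (le_min hρ (h1.trans hs.1)) (min_le_min_right s hρr)
      ((min_le_right _ _).trans hs.2)
    rcases le_total ρ s with h | h
    · rw [min_eq_left h] at h5 ⊢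
      linarith [h4 (min_le_left r s)]
    · rw [min_eq_right h, min_eq_right (h.trans hρr)] at h5 ⊢
      linarith [h4 hρr]

end Reach

/-! ### The value functional lies below every supersolution of the class. -/

section Supersolution

variable [TopologicalSpace U] [MeasurableSpace U] [BorelSpace U] [Nonempty U]
  {F : ContPath T d → U → EuclideanSpace ℝ (Fin d)} {q : ContPath T d → U → ℝ}
  {φ : TerminalPath T d → ℝ} {L : ℝ}

theorem IsCoefficient.continuous_restrict {E : Type*} [NormedAddCommGroup E]
    {G : ContPath T d → U → E} (hG : IsCoefficient L G) (X : ContPath T d) (v : U) :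
    Continuous fun s => G (X.restrict s) v :=
  hG.continuous.comp (X.continuous_restrict.prodMk continuous_const)

theorem hasDerivWithinAt_of_eq_integral {E : Type*} [NormedAddCommGroup E] [NormedSpace ℝ E]
    [CompleteSpace E] {X g : ℝ → E} {x : E} {a b s : ℝ} (hg : Continuous g)
    (hX : ∀ r ∈ Icc a b, X r = x + ∫ σ in a..r, g σ) (hs : s ∈ Ico a b) :
    HasDerivWithinAt X (g s) (Ici s) s := by
  have h1 : HasDerivAt (fun r => x + ∫ σ in a..r, g σ) (g s) s :=
    (hg.integral_hasStrictDerivAt a s).hasDerivAt.const_add x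
  refine h1.hasDerivWithinAt.congr_of_eventuallyEq ?_ (hX s ⟨hs.1, hs.2.le⟩)
  filter_upwards [self_mem_nhdsWithin, mem_nhdsWithin_of_mem_nhds (Iio_mem_nhds hs.2)] with r h2 h3
  exact hX r ⟨hs.1.trans h2, (mem_Iio.1 h3).le⟩

/-- At a maximum of V(η) - W(γ) - ε₀(T - time) - penalty/δ, continue η by a trajectory Y with
constant control v. Dynamic programming bounds V(Y_s) from below by V(η) - ∫ q, so the penalty
towards Y plus a function of time is an admissible test functional at γ. The supersolution
inequality then contradicts ε₀ > 0. -/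
theorem valueFunctional_le_of_supersolution (hT : 0 < T) (hF : IsCoefficient L F)
    (hq : IsCoefficient L q) (hφ : IsTerminalCost L φ) {W : ContPath T d → ℝ}
    (hWc : InUniquenessClass W) {μ₀ : ℝ} (hW : ∀ μ ≥ μ₀, IsMuSupersolution F q φ μ W)
    {γ₀ : ContPath T d} {K₀ : ℝ}
    (hγ₀ : ∀ l r, 0 ≤ l → l < r → r ≤ γ₀.1.time → ‖γ₀.1 l - γ₀.1 r‖ ≤ K₀ * |l - r|) :
    valueFunctional F q φ γ₀ ≤ W γ₀ := by
  by_contra! hlt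
  have hL := hF.nonneg
  have hγ0 := γ₀.1.supNorm_nonneg
  set V := valueFunctional F q φ with hV
  set t := γ₀.1.time with ht
  set B := (1 + γ₀.1.supNorm) * Real.exp (L * T) with hB
  have hB1 : 1 + γ₀.1.supNorm ≤ B :=
    le_mul_of_one_le_right (by linarith) (Real.one_le_exp (by positivity))
  -- Paths of the reach set are bounded by B - 1 and γ is within 1/2 of η, so the endpoint of γ is
  -- strictly inside the ball of radius M₀.
  set M₀ := B + 1 with hM₀
  have hM0 : 0 < M₀ := by linarith
  set μ := max μ₀ (max L K₀) with hμ
  have hμL : L ≤ μ := (le_max_left _ _).trans (le_max_right _ _)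
  have hμK : K₀ ≤ μ := (le_max_right _ _).trans (le_max_right _ _)
  have hμ0 : 0 < μ := hL.trans_le hμL
  have hK : 0 < μ * (1 + M₀) := by positivity
  have hγmem : γ₀ ∈ lipPaths T d μ 0 M₀ := by
    refine ⟨γ₀.1.time_nonneg, by linarith, fun l r h0 hlr hr => (hγ₀ l r h0 hlr hr).trans
      (mul_le_mul_of_nonneg_right (hμK.trans ?_) (abs_nonneg _))⟩
    exact le_mul_of_one_le_right hμ0.le (by linarith)
  obtain ⟨C, hC, hCl⟩ := hWc.exists_lipschitz M₀ hM0
  set θ := V γ₀ - W γ₀ with hθ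
  have hθ0 : 0 < θ := by linarith
  -- The term ε₀(T - t) costs at most θ/2, so the penalized maximum remains at least θ/2.
  set ε₀ := θ / (2 * T) with hε₀
  have hε₀0 : 0 < ε₀ := by positivity
  have hε₀T : ε₀ * T = θ / 2 := by rw [hε₀]; field_simp
  obtain ⟨ε, hε, hεh, hεθ, hεL, hε8⟩ : ∃ ε > 0, ε ≤ 1 / 2 ∧ L * ε ≤ θ / 4 ∧ L * ε ≤ ε₀ / 8 ∧
      ε ≤ ε₀ / 8 := by
    refine ⟨min (1 / 2) (min (θ / 4 / L) (min (ε₀ / 8 / L) (ε₀ / 8))), by positivity, ?_, ?_, ?_, ?_⟩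
    · exact min_le_left _ _
    · rw [mul_comm, ← le_div_iff₀ hL]
      exact (min_le_right _ _).trans (min_le_left _ _)
    · rw [mul_comm, ← le_div_iff₀ hL]
      exact (min_le_right _ _).trans ((min_le_right _ _).trans (min_le_left _ _))
    · exact (min_le_right _ _).trans ((min_le_right _ _).trans (min_le_right _ _))
  obtain ⟨δ, hδ, hscale⟩ := exists_scale (A := (16 * (μ * (1 + M₀)) + 8 * M₀) * C) (C := C)
    (by positivity) hC hε
  have hR := reachSet_subset_lipPaths hL.le hγmem hμL (by rw [hM₀]; linarith)
  have htime : Continuous fun γ : ContPath T d => γ.1.time :=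
    CadlagPath.continuous_time.comp continuous_subtype_val
  have hVc : Continuous V := (inUniquenessClass_valueFunctional hF hq hφ hT).continuous
  obtain ⟨γ, hγ, η, hη, hγη, hmax, hm, hx⟩ := exists_max_penalized hT.le hK hM0 hC hδ
    (w := fun γ => -W γ) (z := fun η => -V η + ε₀ * (T - η.1.time)) (t := t)
    hWc.continuous.neg (by fun_prop)
    ((isCompact_lipPaths hT.le hK.le).of_isClosed_subset (isClosed_reachSet L γ₀) hR)
    ⟨γ₀, self_mem_reachSet hL.le γ₀⟩ hR (fun γ hγ η hη h => by
      have := (abs_le.1 (hCl μ t γ hγ η hη h)).1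
      linarith)
  have hm0 := CadlagPath.supDist_nonneg γ.1 η.1
  obtain ⟨hmε, hxε, hpε⟩ := hscale _ _ hm0 (norm_nonneg _) hm hx
  have hP0 : 0 ≤ penalty γ η := (sq_nonneg _).trans (penalty_bounds hγ (hR hη) hK hM0 hγη).1
  have hPδ : 0 ≤ 1 / δ * penalty γ η := by positivity
  have hstart := hmax γ₀ (hR (self_mem_reachSet hL.le γ₀)) γ₀ (self_mem_reachSet hL.le γ₀) rfl
  rw [penalty_self] at hstart
  have ht0 : 0 ≤ ε₀ * t := mul_nonneg hε₀0.le γ₀.1.time_nonneg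
  have hηnorm := supNorm_le_of_mem_reachSet hL.le hη
  have hLm : L * γ.1.supDist η.1 ≤ L * ε := mul_le_mul_of_nonneg_left hmε hL.le
  rcases γ.1.time_le.eq_or_lt with hend | hend
  · have h1 := (hW μ (le_max_left _ _)).1 ⟨γ, hend⟩
    have h2 := valueFunctional_terminal (q := q) (φ := φ) hF ⟨η, hγη ▸ hend⟩
    have h3 := (abs_le.1 (hφ.lipschitz ⟨γ, hend⟩ ⟨η, hγη ▸ hend⟩)).1
    have h4 : η.1.time = T := hγη ▸ hend
    rw [h4, sub_self, mul_zero] at hstart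
    simp only at h1 h2 h3
    rw [← hV] at h2
    linarith
  -- the interior case
  set x := γ.1 T - η.1 T with hxdef
  set p : Vec d := (2 * (1 / δ)) • x with hp
  -- The control is nearly optimal for the Hamiltonian at γ, where the viscosity inequality holds,
  -- but it drives Y from η; the mismatch is controlled by |p| L ‖γ - η‖₀.
  obtain ⟨v, hv⟩ : ∃ v, inner ℝ (-p) (F γ v) + q γ v < hamiltonian F q γ (-p) + ε₀ / 4 :=
    exists_lt_of_ciInf_lt (lt_add_of_pos_right _ (by positivity))
  obtain ⟨Y, hY⟩ := exists_isTrajectory hF η (measurable_const (a := v))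
  have hηT : η.1.time < T := hγη ▸ hend
  have hgc := hF.continuous_restrict Y.1 v
  have hqc := hq.continuous_restrict Y.1 v
  let D : Target T d γ.1.time :=
    { X := Y.1.1
      g := fun s => F (Y.1.restrict s) v
      j := fun s => (-W γ - 1 / δ * penalty γ η) + (∫ σ in γ.1.time..s, q (Y.1.restrict σ) v) -
        ε₀ * (s - γ.1.time)
      j' := fun s => q (Y.1.restrict s) v - ε₀
      continuous_X := Y.1.2
      continuous_g := hgc
      continuous_j := by
        have : Continuous fun s => ∫ σ in γ.1.time..s, q (Y.1.restrict σ) v :=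
          intervalIntegral.continuous_primitive (fun a b => hqc.intervalIntegrable a b) _
        fun_prop
      continuous_j' := hqc.sub continuous_const
      deriv_X := fun s hs => by
        rw [hγη] at hs
        exact hasDerivWithinAt_of_eq_integral hgc hY.2 hs
      deriv_j := fun s hs => by
        have h1 := (hqc.integral_hasStrictDerivAt γ.1.time s).hasDerivAt
        have h2 := ((hasDerivAt_id s).sub_const γ.1.time).const_mul ε₀
        refine ((h1.const_add (-W γ - 1 / δ * penalty γ η)).sub h2).hasDerivWithinAt.congr_deriv ?_
        rw [mul_one] }
  have hval : ∀ γ' : ContPath T d, D.value (1 / δ) γ'.1 =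
      (-W γ - 1 / δ * penalty γ η) + (∫ σ in γ.1.time..γ'.1.time, q (Y.1.restrict σ) v) -
        ε₀ * (γ'.1.time - γ.1.time) + 1 / δ * penalty γ' (Y.1.restrict γ'.1.time) :=
    fun γ' => D.value_eq_penalty (1 / δ) Y (fun _ _ => rfl) γ'
  have hYη : Y.1.restrict γ.1.time = η := by rw [hγη]; exact hY.restrict_initial
  have hzero : W γ + D.value (1 / δ) γ.1 = 0 := by
    rw [hval, hYη, intervalIntegral.integral_same]
    ring
  have htest : D.functional (1 / δ) hT ∈ testBelow μ M₀ γ W := by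
    refine ⟨hzero, ?_, fun b hb => ?_⟩
    · rintro _ ⟨γ', hγ', rfl⟩
      change 0 ≤ W γ' + D.value (1 / δ) γ'.1
      have hs : γ'.1.time ∈ Icc η.1.time T := ⟨hγη ▸ hγ'.1, γ'.1.time_le⟩
      have h1 := hmax γ' (lipPaths_mono hγ.1 hγ') _
        (hY.restrict_mem_reachSet hF hη measurable_const hs)
        (Y.restrict_time ⟨η.1.time_nonneg.trans hs.1, hs.2⟩).symm
      rw [Y.restrict_time ⟨η.1.time_nonneg.trans hs.1, hs.2⟩] at h1
      have h2 := valueFunctional_le_integral_add hF hq hφ measurable_const hY hs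
      rw [← hV] at h2
      rw [hval, hγη]
      linarith
    · exact hzero ▸ hb ⟨γ, lipPaths_mono le_rfl ⟨le_rfl, hγ.2⟩, rfl⟩
  have hnorm : ‖γ.1 γ.1.time‖ < M₀ := by
    have h1 := γ.1.le_supDist η.1 γ.1.time
    have h2 := η.1.norm_le_supNorm γ.1.time
    have h3 := norm_le_norm_add_norm_sub (η.1 γ.1.time) (γ.1 γ.1.time)
    rw [norm_sub_rev] at h3
    linarith
  have hsuper := (hW μ (le_max_left _ _)).2 M₀ hM0 γ (lipPaths_mono γ₀.1.time_nonneg hγ) hend hnorm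
    _ htest
  have hYT : Y.1.1 γ.1.time = η.1 T := by
    rw [hγη, hY.1 _ (right_mem_Icc.2 η.1.time_nonneg), η.1.apply_of_time_le η.1.time_le]
  have hdt : (D.functional (1 / δ) hT).dt γ.1 = q η v - ε₀ +
      1 / δ * (‖x‖ ^ 2 - 2 * inner ℝ x (F η v)) := by
    change D.dt (1 / δ) γ.1 = _
    rw [D.dt_of_continuous]
    change q (Y.1.restrict γ.1.time) v - ε₀ + 1 / δ * (‖γ.1 T - Y.1.1 γ.1.time‖ ^ 2 -
      2 * inner ℝ (γ.1 T - Y.1.1 γ.1.time) (F (Y.1.restrict γ.1.time) v)) = _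
    rw [hYη, hYT]
  have hdx : (D.functional (1 / δ) hT).dx γ.1 = p := by
    change (2 * (1 / δ)) • (γ.1 T - Y.1.1 γ.1.time) = _
    rw [hYT]
  rw [hdt, hdx] at hsuper
  have hpF : inner ℝ p (F η v) = 2 * (1 / δ) * inner ℝ x (F η v) := by
    rw [hp, real_inner_smul_left]
  have hpn : ‖p‖ = 2 / δ * ‖x‖ := by
    rw [hp, norm_smul, Real.norm_of_nonneg (by positivity)]
    ring
  have h1 : inner ℝ p (F γ v) - inner ℝ p (F η v) ≤ L * ε := by
    rw [← inner_sub_right]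
    refine (real_inner_le_norm _ _).trans ?_
    have h2 := mul_le_mul_of_nonneg_left (hF.lipschitz γ η hγη v) (norm_nonneg p)
    have h3 : ‖p‖ * (L * γ.1.supDist η.1) = L * (2 / δ * ‖x‖ * γ.1.supDist η.1) := by
      rw [hpn]; ring
    exact h2.trans (h3.le.trans (mul_le_mul_of_nonneg_left hpε hL.le))
  have h2 := (abs_le.1 (hq.lipschitz γ η hγη v)).1
  have h3 : 1 / δ * ‖x‖ ^ 2 ≤ ε := by rwa [one_div, inv_mul_eq_div]
  rw [inner_neg_left] at hv
  -- The errors are ε₀/4 from the choice of v and at most ε₀/8 each from F, q and ‖x‖²/δ; together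
  -- they are less than ε₀.
  linarith

end Supersolution

/-! ### Forward averages in time. -/

section Average

variable {E : Type*} [NormedAddCommGroup E] [NormedSpace ℝ E]

/-- The forward average `κ⁻¹ ∫_r^{r+κ} b`. -/
def average (κ : ℝ) (b : ℝ → E) (r : ℝ) : E := (1 / κ) • ∫ θ in r..r + κ, b θ

variable {κ B : ℝ} {b : ℝ → E}

theorem average_eq (hb : ∀ a c, IntervalIntegrable b volume a c) (κ r : ℝ) :
    average κ b r = (1 / κ) • ((∫ θ in (0 : ℝ)..r + κ, b θ) - ∫ θ in (0 : ℝ)..r, b θ) := by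
  rw [average, intervalIntegral.integral_interval_sub_left (hb _ _) (hb _ _)]

theorem continuous_average (hb : ∀ a c, IntervalIntegrable b volume a c) (κ : ℝ) :
    Continuous (average κ b) := by
  have h1 := intervalIntegral.continuous_primitive hb 0
  have h2 : Continuous fun r => ∫ θ in (0 : ℝ)..r + κ, b θ := h1.comp (continuous_add_const κ)
  have h3 : average κ b = fun r => (1 / κ) • ((∫ θ in (0 : ℝ)..r + κ, b θ) -
      ∫ θ in (0 : ℝ)..r, b θ) := funext (average_eq hb κ)
  rw [h3]
  exact (h2.sub h1).const_smul _

variable [CompleteSpace E]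

theorem norm_average_sub_le (hκ : 0 < κ) (hb : ∀ a c, IntervalIntegrable b volume a c) {r c : ℝ}
    {y : E} (h : ∀ θ ∈ Icc r (r + κ), ‖b θ - y‖ ≤ c) : ‖average κ b r - y‖ ≤ c := by
  have h1 : average κ b r - y = (1 / κ) • ∫ θ in r..r + κ, (b θ - y) := by
    rw [intervalIntegral.integral_sub (hb _ _) intervalIntegrable_const,
      intervalIntegral.integral_const, add_sub_cancel_left, smul_sub, smul_smul,
      one_div_mul_cancel hκ.ne', one_smul, average]
  have h2 : ‖∫ θ in r..r + κ, (b θ - y)‖ ≤ c * |r + κ - r| :=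
    intervalIntegral.norm_integral_le_of_norm_le_const fun θ hθ => by
      rw [uIoc_of_le (by linarith)] at hθ
      exact h θ (Ioc_subset_Icc_self hθ)
  rw [add_sub_cancel_left, abs_of_pos hκ] at h2
  rw [h1, norm_smul, Real.norm_of_nonneg (by positivity), one_div, inv_mul_le_iff₀ hκ, mul_comm]
  exact h2

theorem norm_average_le (hκ : 0 < κ) (hb : ∀ a c, IntervalIntegrable b volume a c)
    (hB : ∀ θ, ‖b θ‖ ≤ B) (r : ℝ) : ‖average κ b r‖ ≤ B := by
  simpa using norm_average_sub_le (y := 0) hκ hb fun θ _ => by simpa using hB θ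

theorem le_average {b : ℝ → ℝ} (hκ : 0 < κ) (hb : ∀ a c, IntervalIntegrable b volume a c)
    {r c : ℝ} (h : ∀ θ ∈ Icc r (r + κ), c ≤ b θ) : c ≤ average κ b r := by
  have h1 : ∫ _θ in r..r + κ, c ≤ ∫ θ in r..r + κ, b θ :=
    intervalIntegral.integral_mono_on (by linarith) intervalIntegrable_const (hb _ _) h
  rw [intervalIntegral.integral_const, add_sub_cancel_left, smul_eq_mul] at h1
  rw [average, smul_eq_mul, one_div, le_inv_mul_iff₀ hκ]
  exact h1

theorem average_inner_add {f : ℝ → Vec d} {g : ℝ → ℝ}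
    (hf : ∀ a c, IntervalIntegrable f volume a c) (hg : ∀ a c, IntervalIntegrable g volume a c)
    (p : Vec d) (κ r : ℝ) :
    average κ (fun θ => inner ℝ p (f θ) + g θ) r =
      inner ℝ p (average κ f r) + average κ g r := by
  have h1 := (innerSL ℝ p).intervalIntegral_comp_comm (hf r (r + κ))
  simp only [innerSL_apply_apply] at h1
  have hfi : IntervalIntegrable (fun θ => (inner ℝ p (f θ) : ℝ)) volume r (r + κ) :=
    ⟨(hf _ _).1.const_inner p, (hf _ _).2.const_inner p⟩
  rw [average, intervalIntegral.integral_add hfi (hg _ _), h1, average, average, inner_smul_right, smul_add, smul_eq_mul, smul_eq_mul]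

theorem norm_average_primitive_sub_le (hκ : 0 < κ) (hb : ∀ a c, IntervalIntegrable b volume a c)
    (hB : ∀ θ, ‖b θ‖ ≤ B) (s : ℝ) :
    ‖average κ (fun r => ∫ θ in (0 : ℝ)..r, b θ) s - ∫ θ in (0 : ℝ)..s, b θ‖ ≤ B * κ := by
  have hB0 : 0 ≤ B := (norm_nonneg _).trans (hB 0)
  refine norm_average_sub_le hκ
    (fun a c => (intervalIntegral.continuous_primitive hb 0).intervalIntegrable a c) fun θ hθ => ?_
  rw [intervalIntegral.integral_interval_sub_left (hb _ _) (hb _ _)]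
  refine (intervalIntegral.norm_integral_le_of_norm_le_const fun r _ => hB r).trans
    (mul_le_mul_of_nonneg_left ?_ hB0)
  rw [abs_of_nonneg (by linarith [hθ.1])]
  linarith [hθ.2]

/-- Integration and averaging commute, so the integral of the average is an increment of the
averaged primitive. The primitive is B-Lipschitz and moves by at most Bκ under averaging, at each of
the two ends. Nothing beyond boundedness of b enters, so measurable controls are allowed. -/
theorem norm_integral_average_sub_le (hκ : 0 < κ) (hb : ∀ a c, IntervalIntegrable b volume a c)
    (hB : ∀ θ, ‖b θ‖ ≤ B) (a s : ℝ) :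
    ‖(∫ r in a..s, average κ b r) - ∫ r in a..s, b r‖ ≤ 2 * B * κ := by
  set Φ : ℝ → E := fun r => ∫ θ in (0 : ℝ)..r, b θ with hΦ
  have hΦc : Continuous Φ := intervalIntegral.continuous_primitive hb 0
  have hΦi : ∀ a c, IntervalIntegrable Φ volume a c := fun a c => hΦc.intervalIntegrable a c
  have hsh : Continuous fun r => Φ (r + κ) := hΦc.comp (continuous_add_const κ)
  have h1 : ∫ r in a..s, average κ b r = average κ Φ s - average κ Φ a := by
    have h2 : ∀ r, average κ b r = (1 / κ) • (Φ (r + κ) - Φ r) := average_eq hb κ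
    simp only [h2]
    rw [intervalIntegral.integral_smul, intervalIntegral.integral_sub
      (hsh.intervalIntegrable _ _) (hΦi _ _),
      intervalIntegral.integral_comp_add_right, average, average, ← smul_sub,
      intervalIntegral.integral_interval_sub_interval_comm' (hΦi _ _) (hΦi _ _) (hΦi _ _)]
  rw [h1, ← intervalIntegral.integral_interval_sub_left (hb 0 s) (hb 0 a)]
  have h3 := norm_average_primitive_sub_le hκ hb hB s
  have h4 := norm_average_primitive_sub_le hκ hb hB a
  have h5 : average κ Φ s - average κ Φ a - (Φ s - Φ a) =
      (average κ Φ s - Φ s) - (average κ Φ a - Φ a) := by abel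
  change ‖average κ Φ s - average κ Φ a - (Φ s - Φ a)‖ ≤ _
  rw [h5]
  exact (norm_sub_le _ _).trans (by linarith)

end Average

/-- Every continuous path is a uniform limit of Lipschitz paths. -/
theorem exists_lipschitz_path (γ : ContPath T d) {ε : ℝ} (hε : 0 < ε) :
    ∃ η : ContPath T d, dist η γ ≤ ε ∧ ∃ K, ∀ l r, 0 ≤ l → l < r → r ≤ η.1.time →
      ‖η.1 l - η.1 r‖ ≤ K * |l - r| := by
  obtain ⟨δ, hδ, h⟩ := Metric.uniformContinuous_iff.1 γ.uniformContinuous ε hε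
  set κ := δ / 2 with hκ
  have hκ0 : 0 < κ := by positivity
  have hi : ∀ a c, IntervalIntegrable γ.1.toFun volume a c := fun a c => γ.2.intervalIntegrable a c
  have happ : ∀ s ∈ Icc 0 γ.1.time, (ContPath.ofFun γ.1.time γ.1.time_mem (average κ γ.1.toFun)
      (continuous_average hi κ)).1 s = average κ γ.1.toFun s :=
    fun s hs => ContPath.ofFun_apply γ.1.time_mem _ hs
  refine ⟨ContPath.ofFun γ.1.time γ.1.time_mem (average κ γ.1.toFun) (continuous_average hi κ), ?_,
    1 / κ * (2 * γ.1.supNorm), fun l r h0 hlr hr => ?_⟩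
  · change dist (ContPath.ofFun γ.1.time γ.1.time_mem (average κ γ.1.toFun)
      (continuous_average hi κ)).1 γ.1 ≤ ε
    rw [CadlagPath.dist_of_time_eq (show (ContPath.ofFun γ.1.time γ.1.time_mem
      (average κ γ.1.toFun) (continuous_average hi κ)).1.time = γ.1.time from rfl)]
    refine CadlagPath.supDist_le_of_time_le (t := γ.1.time) le_rfl le_rfl fun s hs => ?_
    rw [happ s hs]
    refine norm_average_sub_le hκ0 hi fun θ hθ => ?_
    rw [← dist_eq_norm]
    refine (h ?_).le
    rw [Real.dist_eq, abs_of_nonneg (by linarith [hθ.1])]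
    linarith [hθ.2]
  · have hr : r ≤ γ.1.time := hr
    have hb : ∀ a c, ‖∫ θ in a..c, γ.1 θ‖ ≤ γ.1.supNorm * |c - a| := fun a c =>
      intervalIntegral.norm_integral_le_of_norm_le_const fun θ _ => γ.1.norm_le_supNorm θ
    rw [happ l ⟨h0, hlr.le.trans hr⟩, happ r ⟨h0.trans hlr.le, hr⟩, average, average, ← smul_sub,
      intervalIntegral.integral_interval_sub_interval_comm' (hi _ _) (hi _ _) (hi _ _), norm_smul,
      Real.norm_of_nonneg (by positivity), mul_assoc]
    refine mul_le_mul_of_nonneg_left ((norm_sub_le _ _).trans ?_) (by positivity)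
    have h1 := hb (r + κ) (l + κ)
    have h2 := hb r l
    rw [add_sub_add_right_eq_sub] at h1
    linarith

/-! ### Every subsolution of the class lies below the cost of each control. -/

section Subsolution

variable [TopologicalSpace U] {F : ContPath T d → U → EuclideanSpace ℝ (Fin d)}
  {q : ContPath T d → U → ℝ} {φ : TerminalPath T d → ℝ} {L : ℝ}

/-- A Lebesgue number for a cover of [0,T] turns pointwise continuity, uniform in the control, into
a modulus in time. The time θ may exceed T, since forward averages look past T, where the path is
frozen. -/
theorem IsCoefficient.exists_modulus {E : Type*} [NormedAddCommGroup E]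
    {G : ContPath T d → U → E} (hG : IsCoefficient L G) (X : ContPath T d) {ε : ℝ} (hε : 0 < ε) :
    ∃ κ > 0, ∀ r ∈ Icc 0 T, ∀ θ, |θ - r| < κ → ∀ v,
      ‖G (X.restrict r) v - G (X.restrict θ) v‖ ≤ ε := by
  choose δ hδ h using fun s : ℝ => hG.uniform (X.restrict s) (ε / 2) (half_pos hε)
  obtain ⟨κ, hκ, hball⟩ := lebesgue_number_lemma_of_metric (isCompact_Icc (a := 0) (b := T))
    (c := fun s : ℝ => {r | dist (X.restrict r) (X.restrict s) < δ s})
    (fun s => isOpen_lt (X.continuous_restrict.dist continuous_const) continuous_const)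
    (fun s _ => mem_iUnion.2 ⟨s, by simpa using hδ s⟩)
  refine ⟨κ, hκ, fun r hr θ hθ v => ?_⟩
  obtain ⟨s, hs⟩ := hball r hr
  have h1 := h s _ (hs (Metric.mem_ball_self hκ)) v
  have h2 := h s _ (hs (show θ ∈ Metric.ball r κ from hθ)) v
  have h3 := norm_sub_le_norm_sub_add_norm_sub (G (X.restrict r) v) (G (X.restrict s) v)
    (G (X.restrict θ) v)
  rw [norm_sub_rev (G (X.restrict s) v)] at h3
  linarith

theorem exists_path_of_velocity (γ : ContPath T d) {g : ℝ → Vec d} (hg : Continuous g) :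
    ∃ Z : TerminalPath T d, (∀ r ∈ Icc 0 γ.1.time, Z.1.1 r = γ.1 r) ∧
      ∀ r ∈ Icc γ.1.time T, Z.1.1 r = γ.1 γ.1.time + ∫ σ in γ.1.time..r, g σ := by
  have hT : T ∈ Icc 0 T := right_mem_Icc.2 (γ.1.time_nonneg.trans γ.1.time_le)
  have hc : Continuous fun s => γ.1 (min s γ.1.time) + ∫ σ in γ.1.time..max s γ.1.time, g σ :=
    (γ.2.comp (continuous_id.min continuous_const)).add
      ((intervalIntegral.continuous_primitive (fun a b => hg.intervalIntegrable a b) _).comp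
        (continuous_id.max continuous_const))
  refine ⟨⟨ContPath.ofFun T hT _ hc, rfl⟩, fun r hr => ?_, fun r hr => ?_⟩
  · change (ContPath.ofFun T hT _ hc).1 r = _
    rw [ContPath.ofFun_apply hT hc ⟨hr.1, hr.2.trans γ.1.time_le⟩, min_eq_left hr.2,
      max_eq_right hr.2, intervalIntegral.integral_same, add_zero]
  · change (ContPath.ofFun T hT _ hc).1 r = _
    rw [ContPath.ofFun_apply hT hc ⟨γ.1.time_nonneg.trans hr.1, hr.2⟩, min_eq_right hr.1,
      max_eq_left hr.1]

variable [MeasurableSpace U] [BorelSpace U]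

/-- The role of V is played by the cost still to be paid along X. As u is only measurable, X is
replaced by a path Z with averaged, hence continuous, velocity, and the running cost is averaged as
well. The second variable of the penalized maximum is then just a time on Z. -/
theorem le_cost_of_subsolution (hT : 0 < T) (hF : IsCoefficient L F)
    (hq : IsCoefficient L q) (hφ : IsTerminalCost L φ) {W : ContPath T d → ℝ}
    (hWc : InUniquenessClass W) {μ₀ : ℝ} (hW : ∀ μ ≥ μ₀, IsMuSubsolution F q φ μ W)
    {γ₀ : ContPath T d} {K₀ : ℝ}
    (hγ₀ : ∀ l r, 0 ≤ l → l < r → r ≤ γ₀.1.time → ‖γ₀.1 l - γ₀.1 r‖ ≤ K₀ * |l - r|)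
    {u : ℝ → U} (hu : Measurable u) {X : TerminalPath T d} (hX : IsTrajectory F γ₀ u X) :
    W γ₀ ≤ cost q φ γ₀.1.time u X := by
  by_contra! hlt
  have hL := hF.nonneg
  have hγ0 := γ₀.1.supNorm_nonneg
  set J := cost q φ γ₀.1.time u X with hJ
  set t := γ₀.1.time with ht
  have ht0 : 0 ≤ t := γ₀.1.time_nonneg
  have htT : t ≤ T := γ₀.1.time_le
  set B' := (1 + γ₀.1.supNorm) * Real.exp (L * T) with hB'
  have hB1 : 1 + γ₀.1.supNorm ≤ B' :=
    le_mul_of_one_le_right (by linarith) (Real.one_le_exp (by positivity))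
  have hXB : 1 + X.1.1.supNorm ≤ B' := hX.norm_bound hF
  set B := L * B' with hB
  have hB'0 : 0 < B' := by linarith
  have hB0 : 0 < B := by positivity
  set M₀ := B' + 1 with hM₀
  have hM0 : 0 < M₀ := by linarith
  set μ := max μ₀ (max L K₀) with hμ
  have hμL : L ≤ μ := (le_max_left _ _).trans (le_max_right _ _)
  have hμK : K₀ ≤ μ := (le_max_right _ _).trans (le_max_right _ _)
  have hμ0 : 0 < μ := hL.trans_le hμL
  have hK : 0 < μ * (1 + M₀) := by positivity
  have hγmem : γ₀ ∈ lipPaths T d μ 0 M₀ := by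
    refine ⟨ht0, by linarith, fun l r h0 hlr hr => (hγ₀ l r h0 hlr hr).trans
      (mul_le_mul_of_nonneg_right (hμK.trans ?_) (abs_nonneg _))⟩
    exact le_mul_of_one_le_right hμ0.le (by linarith)
  obtain ⟨C, hC, hCl⟩ := hWc.exists_lipschitz M₀ hM0
  set θ := W γ₀ - J with hθ
  have hθ0 : 0 < θ := by linarith
  set ε₀ := θ / (2 * T) with hε₀
  have hε₀0 : 0 < ε₀ := by positivity
  have hε₀T : ε₀ * T = θ / 2 := by rw [hε₀]; field_simp
  obtain ⟨ε, hε, hεh, hεθ, hεL, hε8⟩ : ∃ ε > 0, ε ≤ 1 / 2 ∧ L * ε ≤ θ / 8 ∧ L * ε ≤ ε₀ / 8 ∧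
      ε ≤ ε₀ / 8 := by
    refine ⟨min (1 / 2) (min (θ / 8 / L) (min (ε₀ / 8 / L) (ε₀ / 8))), by positivity, ?_, ?_, ?_, ?_⟩
    · exact min_le_left _ _
    · rw [mul_comm, ← le_div_iff₀ hL]
      exact (min_le_right _ _).trans (min_le_left _ _)
    · rw [mul_comm, ← le_div_iff₀ hL]
      exact (min_le_right _ _).trans ((min_le_right _ _).trans (min_le_left _ _))
    · exact (min_le_right _ _).trans ((min_le_right _ _).trans (min_le_right _ _))
  obtain ⟨δ, hδ, hscale⟩ := exists_scale (A := (16 * (μ * (1 + M₀)) + 8 * M₀) * C) (C := C)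
    (by positivity) hC hε
  -- A bound for |p| + 1 that depends only on δ. It is needed before κ, which must make the
  -- averaging errors small even after multiplication by |p|.
  set P := 4 * M₀ / δ + 1 with hP
  have hP0 : 0 < P := by positivity
  set ω := ε₀ / 8 / P with hω
  have hω0 : 0 < ω := by positivity
  have hPω : P * ω = ε₀ / 8 := by rw [hω]; field_simp
  obtain ⟨κ₁, hκ₁, Hκ₁⟩ := hF.exists_modulus X.1 hω0
  obtain ⟨κ₂, hκ₂, Hκ₂⟩ := hq.exists_modulus X.1 hω0
  obtain ⟨κ, hκ, hκa, hκb, hκc, hκd, hκF, hκq⟩ : ∃ κ > 0, 2 * B * κ ≤ 1 / 2 ∧ 2 * B * κ ≤ θ / 16 ∧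
      L * (2 * B * κ) ≤ θ / 16 ∧ P * (L * (2 * B * κ)) ≤ ε₀ / 8 ∧ κ < κ₁ ∧ κ < κ₂ := by
    have hlim : ∀ a : ℝ, Tendsto (fun κ : ℝ => a * κ) (𝓝[>] 0) (𝓝 0) := fun a => by
      have : Tendsto (fun κ : ℝ => a * κ) (𝓝 0) (𝓝 (a * 0)) := (continuous_const_mul a).tendsto 0
      rw [mul_zero] at this
      exact this.mono_left nhdsWithin_le_nhds
    have hev : ∀ a c : ℝ, 0 < c → ∀ᶠ κ in 𝓝[>] (0 : ℝ), a * κ < c := fun a c hc =>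
      (hlim a).eventually (gt_mem_nhds hc)
    have h00 : ∀ᶠ κ in 𝓝[>] (0 : ℝ), 0 < κ := self_mem_nhdsWithin
    obtain ⟨κ, h0, h1, h2, h3, h4, h5, h6⟩ := (h00.and
      ((hev (2 * B) (1 / 2) (by norm_num)).and ((hev (2 * B) (θ / 16) (by positivity)).and
      ((hev (L * (2 * B)) (θ / 16) (by positivity)).and
      ((hev (P * (L * (2 * B))) (ε₀ / 8) (by positivity)).and
      ((hev 1 κ₁ hκ₁).and (hev 1 κ₂ hκ₂))))))).exists
    exact ⟨κ, h0, h1.le, h2.le, by linarith, by linarith, by linarith, by linarith⟩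
  -- the smoothed velocity and running cost
  set bF := fun σ => F (X.1.restrict σ) (u σ) with hbF
  set bq := fun σ => q (X.1.restrict σ) (u σ) with hbq
  have hbFi : ∀ a c, IntervalIntegrable bF volume a c := hF.intervalIntegrable X.1 hu
  have hbqi : ∀ a c, IntervalIntegrable bq volume a c := hq.intervalIntegrable X.1 hu
  have hbFB : ∀ σ, ‖bF σ‖ ≤ B := fun σ => (hF.norm_restrict_le X.1 σ _).trans
    (mul_le_mul_of_nonneg_left hXB hL.le)
  have hbqB : ∀ σ, ‖bq σ‖ ≤ B := fun σ => (hq.norm_restrict_le X.1 σ _).trans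
    (mul_le_mul_of_nonneg_left hXB hL.le)
  have hgc := continuous_average hbFi κ
  have hqc := continuous_average hbqi κ
  obtain ⟨Z, hZ1, hZ2⟩ := exists_path_of_velocity γ₀ hgc
  have hZX : Z.1.1.supDist X.1.1 ≤ 2 * B * κ := by
    refine CadlagPath.supDist_le fun r hr => ?_
    rcases le_total r t with h | h
    · rw [hZ1 r ⟨hr.1, h⟩, hX.1 r ⟨hr.1, h⟩, sub_self, norm_zero]
      positivity
    · rw [hZ2 r ⟨h, hr.2⟩, hX.2 r ⟨h, hr.2⟩, add_sub_add_left_eq_sub]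
      exact norm_integral_average_sub_le hκ hbFi hbFB t r
  have hZn := Z.1.1.supNorm_le_add X.1.1
  have hZtime : ∀ s ∈ Icc t T, (Z.1.restrict s).1.time = s := fun s hs =>
    Z.restrict_time ⟨ht0.trans hs.1, hs.2⟩
  set R := (fun s => Z.1.restrict s) '' Icc t T with hRdef
  have hRc : IsCompact R := isCompact_Icc.image Z.1.continuous_restrict
  have hR : R ⊆ lipPaths T d μ t M₀ := by
    rintro _ ⟨s, hs, rfl⟩
    refine restrict_mem_lipPaths hγmem hZ1 hs (fun r _ => ?_) fun l r hl hlr hr => ?_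
    · linarith [Z.1.1.norm_le_supNorm r]
    · have hgi : ∀ a c, IntervalIntegrable (average κ bF) volume a c :=
        fun a c => hgc.intervalIntegrable a c
      rw [hZ2 l ⟨hl, (hlr.le.trans hr).trans hs.2⟩, hZ2 r ⟨hl.trans hlr.le, hr.trans hs.2⟩,
        add_sub_add_left_eq_sub, intervalIntegral.integral_interval_sub_left (hgi _ _) (hgi _ _)]
      refine (intervalIntegral.norm_integral_le_of_norm_le_const
        fun σ _ => norm_average_le hκ hbFi hbFB σ).trans (mul_le_mul_of_nonneg_right ?_ (abs_nonneg _))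
      exact mul_le_mul hμL (by linarith) hB'0.le hμ0.le
  have htime : Continuous fun γ : ContPath T d => γ.1.time :=
    CadlagPath.continuous_time.comp continuous_subtype_val
  have hprim : Continuous fun s => ∫ σ in t..s, average κ bq σ :=
    intervalIntegral.continuous_primitive (fun a b => hqc.intervalIntegrable a b) _
  have hprim' : Continuous fun η : ContPath T d => ∫ σ in t..η.1.time, average κ bq σ :=
    hprim.comp htime
  obtain ⟨γ, hγ, η, hη, hγη, hmax, hm, hx⟩ := exists_max_penalized hT.le hK hM0 hC hδ
    (w := W) (z := fun η => J - (∫ σ in t..η.1.time, average κ bq σ) + ε₀ * (T - η.1.time)) (t := t)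
    hWc.continuous (by fun_prop) hRc ⟨_, t, left_mem_Icc.2 htT, rfl⟩ hR
    (fun γ hγ η hη h => (abs_le.1 (hCl μ t γ hγ η hη h)).2)
  have hm0 := CadlagPath.supDist_nonneg γ.1 η.1
  obtain ⟨hmε, hxε, hpε⟩ := hscale _ _ hm0 (norm_nonneg _) hm hx
  have hPn0 : 0 ≤ penalty γ η := (sq_nonneg _).trans (penalty_bounds hγ (hR hη) hK hM0 hγη).1
  have hPδ : 0 ≤ 1 / δ * penalty γ η := by positivity
  have hZγ₀ : Z.1.restrict t = γ₀ := by
    refine ContPath.ext_of_Icc (hZtime t (left_mem_Icc.2 htT)) fun r hr => ?_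
    rw [hZtime t (left_mem_Icc.2 htT)] at hr
    rw [Z.restrict_apply_of_le γ₀.1.time_mem hr.2, hZ1 r hr]
  have hstart := hmax γ₀ (hZγ₀ ▸ hR ⟨t, left_mem_Icc.2 htT, rfl⟩) γ₀
    (hZγ₀ ▸ ⟨t, left_mem_Icc.2 htT, rfl⟩) rfl
  rw [penalty_self, intervalIntegral.integral_same] at hstart
  have hε₀t : 0 ≤ ε₀ * t := mul_nonneg hε₀0.le ht0
  have hLm : L * γ.1.supDist η.1 ≤ L * ε := mul_le_mul_of_nonneg_left hmε hL.le
  have hηZ : η = Z.1.restrict γ.1.time := by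
    obtain ⟨s, hs, rfl⟩ := hη
    rw [hγη, hZtime s hs]
  have htγ : t ≤ γ.1.time := hγ.1
  rcases γ.1.time_le.eq_or_lt with hend | hend
  · have h1 := (hW μ (le_max_left _ _)).1 ⟨γ, hend⟩
    have h2 := (abs_le.1 (hφ.lipschitz ⟨γ, hend⟩ X)).2
    have h3 := (abs_le.1 (norm_integral_average_sub_le hκ hbqi hbqB t T)).2
    have h4 : η.1.time = T := hγη ▸ hend
    have h5 : J = (∫ σ in t..T, bq σ) + φ X := rfl
    have h6 : γ.1.supDist X.1.1 ≤ γ.1.supDist η.1 + 2 * B * κ := by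
      have h7 : η = Z.1 := by rw [hηZ, hend, Z.restrict_final]
      refine (γ.1.supDist_triangle η.1 X.1.1).trans (add_le_add le_rfl ?_)
      rw [h7]
      exact hZX
    have h8 := mul_le_mul_of_nonneg_left h6 hL.le
    rw [h4, sub_self, mul_zero] at hstart
    simp only at h1 h2
    linarith
  -- the interior case
  set x := γ.1 T - η.1 T with hxdef
  set p : Vec d := (2 * (1 / δ)) • x with hp
  let D : Target T d γ.1.time :=
    { X := Z.1.1
      g := average κ bF
      j := fun s => (W γ - 1 / δ * penalty γ η) - (∫ σ in γ.1.time..s, average κ bq σ) -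
        ε₀ * (s - γ.1.time)
      j' := fun s => -average κ bq s - ε₀
      continuous_X := Z.1.2
      continuous_g := hgc
      continuous_j := by
        have : Continuous fun s => ∫ σ in γ.1.time..s, average κ bq σ :=
          intervalIntegral.continuous_primitive (fun a b => hqc.intervalIntegrable a b) _
        fun_prop
      continuous_j' := hqc.neg.sub continuous_const
      deriv_X := fun s hs => hasDerivWithinAt_of_eq_integral hgc hZ2 ⟨htγ.trans hs.1, hs.2⟩
      deriv_j := fun s _ => by
        have h1 := (hqc.integral_hasStrictDerivAt γ.1.time s).hasDerivAt
        have h2 := ((hasDerivAt_id s).sub_const γ.1.time).const_mul ε₀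
        refine ((h1.const_sub (W γ - 1 / δ * penalty γ η)).sub h2).hasDerivWithinAt.congr_deriv ?_
        rw [mul_one] }
  have hval : ∀ γ' : ContPath T d, D.value (1 / δ) γ'.1 =
      (W γ - 1 / δ * penalty γ η) - (∫ σ in γ.1.time..γ'.1.time, average κ bq σ) -
        ε₀ * (γ'.1.time - γ.1.time) + 1 / δ * penalty γ' (Z.1.restrict γ'.1.time) :=
    fun γ' => D.value_eq_penalty (1 / δ) Z (fun _ _ => rfl) γ'
  have hzero : W γ - D.value (1 / δ) γ.1 = 0 := by
    rw [hval, ← hηZ, intervalIntegral.integral_same]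
    ring
  have htest : D.functional (1 / δ) hT ∈ testAbove μ M₀ γ W := by
    refine ⟨hzero, ?_, fun b hb => ?_⟩
    · rintro _ ⟨γ', hγ', rfl⟩
      change W γ' - D.value (1 / δ) γ'.1 ≤ 0
      have hs : γ'.1.time ∈ Icc t T := ⟨htγ.trans hγ'.1, γ'.1.time_le⟩
      have h1 := hmax γ' (lipPaths_mono hγ.1 hγ') _ ⟨_, hs, rfl⟩ (hZtime _ hs).symm
      rw [hZtime _ hs, ← hγη] at h1
      have h2 := intervalIntegral.integral_add_adjacent_intervals
        (hqc.intervalIntegrable (μ := volume) t γ.1.time)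
        (hqc.intervalIntegrable (μ := volume) γ.1.time γ'.1.time)
      rw [hval]
      linarith
    · exact hzero ▸ hb ⟨γ, lipPaths_mono le_rfl ⟨le_rfl, hγ.2⟩, rfl⟩
  have hnorm : ‖γ.1 γ.1.time‖ < M₀ := by
    have h1 := γ.1.le_supDist η.1 γ.1.time
    have h2 := η.1.norm_le_supNorm γ.1.time
    have h3 := norm_le_norm_add_norm_sub (η.1 γ.1.time) (γ.1 γ.1.time)
    have h4 : η.1.supNorm ≤ Z.1.1.supNorm := hηZ ▸ Z.1.supNorm_restrict_le _
    rw [norm_sub_rev] at h3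
    linarith
  have hsub := (hW μ (le_max_left _ _)).2 M₀ hM0 γ (lipPaths_mono ht0 hγ) hend hnorm _ htest
  have hZT : Z.1.1 γ.1.time = η.1 T := by
    rw [hηZ, Z.restrict_apply_final γ.1.time_mem]
  have hdt : (D.functional (1 / δ) hT).dt γ.1 = -average κ bq γ.1.time - ε₀ +
      1 / δ * (‖x‖ ^ 2 - 2 * inner ℝ x (average κ bF γ.1.time)) := by
    change D.dt (1 / δ) γ.1 = _
    rw [D.dt_of_continuous]
    change -average κ bq γ.1.time - ε₀ + 1 / δ * (‖γ.1 T - Z.1.1 γ.1.time‖ ^ 2 -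
      2 * inner ℝ (γ.1 T - Z.1.1 γ.1.time) (average κ bF γ.1.time)) = _
    rw [hZT]
  have hdx : (D.functional (1 / δ) hT).dx γ.1 = p := by
    change (2 * (1 / δ)) • (γ.1 T - Z.1.1 γ.1.time) = _
    rw [hZT]
  rw [hdt, hdx] at hsub
  have hpF : inner ℝ p (average κ bF γ.1.time) =
      2 * (1 / δ) * inner ℝ x (average κ bF γ.1.time) := by
    rw [hp, real_inner_smul_left]
  have hpn : ‖p‖ = 2 / δ * ‖x‖ := by
    rw [hp, norm_smul, Real.norm_of_nonneg (by positivity)]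
    ring
  have hpP : ‖p‖ + 1 ≤ P := by
    have h1 : ‖x‖ ≤ 2 * M₀ := (norm_sub_le _ _).trans (by
      linarith [(γ.1.norm_le_supNorm T).trans hγ.2.1, (η.1.norm_le_supNorm T).trans (hR hη).2.1])
    have h2 := mul_le_mul_of_nonneg_left h1 (show 0 ≤ 2 / δ by positivity)
    rw [hpn, hP]
    have h3 : 2 / δ * (2 * M₀) = 4 * M₀ / δ := by ring
    linarith
  -- Three moves lead from γ to X_σ: to η by the penalty, to X at the same time since η is a
  -- restriction of Z, and on to time σ by the modulus. The radius `max κ₁ κ₂ ⊓ min κ₁ κ₂` is just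
  -- `min κ₁ κ₂`.
  have hclose : ∀ {E : Type} [NormedAddCommGroup E] (G : ContPath T d → U → E),
      IsCoefficient L G → (∀ r ∈ Icc 0 T, ∀ σ, |σ - r| < max κ₁ κ₂ ⊓ min κ₁ κ₂ → ∀ v,
      ‖G (X.1.restrict r) v - G (X.1.restrict σ) v‖ ≤ ω) →
      ∀ σ ∈ Icc γ.1.time (γ.1.time + κ), ‖G γ (u σ) - G (X.1.restrict σ) (u σ)‖ ≤
        L * γ.1.supDist η.1 + L * (2 * B * κ) + ω := by
    intro E _ G hG hmod σ hσ
    have h1 := hG.lipschitz γ η hγη (u σ)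
    have h2 := hG.lipschitz η (X.1.restrict γ.1.time)
      (by rw [hηZ]; exact ContPath.time_restrict_eq (Z.2.trans X.2.symm) _) (u σ)
    have h3 : η.1.supDist (X.1.restrict γ.1.time).1 ≤ 2 * B * κ := by
      rw [hηZ]
      exact (ContPath.supDist_restrict_le Z.1 X.1 (Z.2.trans X.2.symm) _).trans hZX
    have h4 := mul_le_mul_of_nonneg_left h3 hL.le
    have h5 := hmod γ.1.time γ.1.time_mem σ (by
      rw [abs_of_nonneg (by linarith [hσ.1])]
      have : κ < min κ₁ κ₂ := lt_min hκF hκq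
      refine lt_of_le_of_lt (by linarith [hσ.2]) (lt_min (this.trans_le ?_) this)
      exact (min_le_left _ _).trans (le_max_left _ _)) (u σ)
    have h6 := norm_sub_le_norm_sub_add_norm_sub (G γ (u σ)) (G η (u σ))
      (G (X.1.restrict σ) (u σ))
    have h7 := norm_sub_le_norm_sub_add_norm_sub (G η (u σ)) (G (X.1.restrict γ.1.time) (u σ))
      (G (X.1.restrict σ) (u σ))
    linarith
  have hclF := hclose F hF fun r hr σ hσ v =>
    Hκ₁ r hr σ (hσ.trans_le ((min_le_right _ _).trans (min_le_left _ _))) v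
  have hclq := hclose q hq fun r hr σ hσ v =>
    Hκ₂ r hr σ (hσ.trans_le ((min_le_right _ _).trans (min_le_right _ _))) v
  -- Each control value u(σ) satisfies the Hamiltonian bound at γ, with the fixed vector p, so the
  -- bound passes to the average over σ. The four errors, of ε₀/8 each, come from the penalty (in F
  -- and in q), the smoothing and the modulus.
  have hham : hamiltonian F q γ p - ε₀ / 2 ≤
      average κ (fun σ => inner ℝ p (bF σ) + bq σ) γ.1.time := by
    refine le_average hκ (fun a c => ⟨((hbFi a c).1.const_inner p).add (hbqi a c).1,
      ((hbFi a c).2.const_inner p).add (hbqi a c).2⟩) fun σ hσ => ?_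
    have h1 := hamiltonian_le hF hq γ p (u σ)
    have h2 := (real_inner_le_norm p (F γ (u σ) - bF σ)).trans
      (mul_le_mul_of_nonneg_left (hclF σ hσ) (norm_nonneg p))
    rw [inner_sub_right] at h2
    have h3 := (abs_le.1 (hclq σ hσ)).2
    have h4 : ‖p‖ * (L * γ.1.supDist η.1) ≤ L * ε := by
      have h5 : ‖p‖ * (L * γ.1.supDist η.1) = L * (2 / δ * ‖x‖ * γ.1.supDist η.1) := by
        rw [hpn]; ring
      exact h5.le.trans (mul_le_mul_of_nonneg_left hpε hL.le)
    have h6 : (‖p‖ + 1) * (L * (2 * B * κ)) ≤ P * (L * (2 * B * κ)) :=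
      mul_le_mul_of_nonneg_right hpP (by positivity)
    have h7 : (‖p‖ + 1) * ω ≤ P * ω := mul_le_mul_of_nonneg_right hpP hω0.le
    change _ ≤ inner ℝ p (bF σ) + q (X.1.restrict σ) (u σ)
    linarith
  rw [average_inner_add hbFi hbqi] at hham
  have h3 : 1 / δ * ‖x‖ ^ 2 ≤ ε := by rwa [one_div, inv_mul_eq_div]
  linarith

end Subsolution

end PHJB

end

/-! ### Conclusion. -/

theorem mainTheorem1 (T : ℝ) (hT : 0 < T) (d : ℕ) (U : Type*) [MetricSpace U] [Nonempty U]
    [MeasurableSpace U] [BorelSpace U]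
    (F : PHJB.ContPath T d → U → EuclideanSpace ℝ (Fin d)) (q : PHJB.ContPath T d → U → ℝ)
    (φ : PHJB.TerminalPath T d → ℝ) (hyp : PHJB.StandingHypothesis F q φ) :
    -- the control problem is well posed and the value is a genuine infimum
    (∀ (γ : PHJB.ContPath T d) (u : ℝ → U), Measurable u → ∃! X, PHJB.IsTrajectory F γ u X) ∧
    (∀ γ, IsGLB (PHJB.costs F q φ γ) (PHJB.valueFunctional F q φ γ)) ∧
    -- the value functional is a viscosity solution in the class
    PHJB.IsViscositySolution F q φ (PHJB.valueFunctional F q φ) ∧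
    PHJB.InUniquenessClass (PHJB.valueFunctional F q φ) ∧
    -- and it is the only one
    ∀ W : PHJB.ContPath T d → ℝ, PHJB.IsViscositySolution F q φ W → PHJB.InUniquenessClass W →
      W = PHJB.valueFunctional F q φ := by
  obtain ⟨L, hF, hq, hφ⟩ := hyp.exists_constant
  have hclass := PHJB.inUniquenessClass_valueFunctional hF hq hφ hT
  refine ⟨fun γ u hu => ?_, PHJB.isGLB_valueFunctional hF hq hφ,
    PHJB.isViscositySolution_valueFunctional hF hq hφ hT, hclass, fun W hW hWc => ?_⟩
  · obtain ⟨X, hX⟩ := PHJB.exists_isTrajectory hF γ hu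
    exact ⟨X, hX, fun Y hY => hY.unique hF hu hX⟩
  · obtain ⟨μ₁, -, hsub⟩ := hW.subsolution
    obtain ⟨μ₂, -, hsup⟩ := hW.supersolution
    -- A path that is not Lipschitz lies in no C^μ, so the two comparisons start only from Lipschitz
    -- paths; density and continuity do the rest.
    have hdense : Dense {γ : PHJB.ContPath T d | W γ = PHJB.valueFunctional F q φ γ} := by
      refine Metric.dense_iff.2 fun γ ε hε => ?_
      obtain ⟨η, hη, K, hK⟩ := PHJB.exists_lipschitz_path γ (half_pos hε)
      refine ⟨η, Metric.mem_ball.2 (by linarith), le_antisymm ?_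
        (PHJB.valueFunctional_le_of_supersolution hT hF hq hφ hWc hsup hK)⟩
      refine le_csInf (PHJB.costs_nonempty hF η) ?_
      rintro _ ⟨u, hu, X, hX, rfl⟩
      exact PHJB.le_cost_of_subsolution hT hF hq hφ hWc hsub hK hu hX
    funext γ
    exact (isClosed_eq hW.continuous hclass.continuous).closure_subset (hdense γ)
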